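/- **Setting.** Let $k$ be a commutative ring, $G$ a finite group and $\mathcal C$ a $k$-linear abelian category. Let $G$ act on $\mathcal C$ by $k$-linear autoequivalences, i.e. let $T$ be a unital monoidal functor $g\mapsto T^g$ from the discrete monoidal category $G$ to the $k$-linear autoequivalences of $\mathcal C$, with natural isomorphisms $T_2^{g,h}:T^gT^h\to T^{gh}$ and $T_0:\mathrm{id}\to T^1$ satisfying the associativity and unit conditions. For $H\le G$ let $\mathcal C^H$ be the category of $H$-equivariant objects $(M,\mu)$, where the isomorphisms $\mu^h:T^hM\to M$ $(h\in H)$ satisfy $\mu^gT^g(\mu^h)=\mu^{gh}T_2^{g,h}$ and $\mu^1T_0=\mathrm{id}$; morphisms are the morphisms of $\mathcal C$ commuting with the $\mu^h$. Write ${}^aH=aHa^{-1}$. For $K\le H\le G$ and $a\in G$ let * $\mathcal R_K^H:\mathcal C^H\to\mathcal C^K$ be restriction of the equivariant structure; * $\mathcal I_K^H:\mathcal C^K\to\mathcal C^H$ be induction, $\mathcal I_K^H(V,\mu)=\bigoplus_tT^tV$ over arbitrary chosen representatives $t$ of the cosets $tK$ in $H$, where $g\in H$ acts by $T^s(\mu^h)(T_2^{s,h})^{-1}T_2^{g,t}:T^gT^tV\to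 T^sV$ for $gt=sh$, $h\in K$; * $c_{H,a}:\mathcal C^H\to\mathcal C^{{}^aH}$ be conjugation, $V\mapsto T^aV$, where $aha^{-1}$ acts by $T^a(\mu^h)(T_2^{a,h})^{-1}T_2^{aha^{-1},a}$. **Definition (categorical Mackey functor).** Let $\mathcal S$ be a $k$-linear monoidal category. A categorical Mackey functor over $\mathcal S$ consists of $k$-linear abelian categories $\mathcal M(H)$ $(H\le G)$ that are left $\mathcal S$-module categories with $k$-bilinear action, of $k$-linear $\mathcal S$-module functors $\mathcal I_K^H:\mathcal M(K)\to\mathcal M(H)$, $\mathcal R_K^H:\mathcal M(H)\to\mathcal M(K)$ for $K\le H$ and $c_{H,a}:\mathcal M(H)\to\mathcal M({}^aH)$, and of the following natural isomorphisms, all of them isomorphisms of $\mathcal S$-module functors: * $\mathcal I_H^H\cong\mathrm{id}$, $\mathcal R_H^H\cong\mathrm{id}$, and $c_{H,h}\cong\mathrm{id}$ for $h\in H$; * $\mathbf R:\mathcal R_J^H\cong\mathcal R_J^K\mathcal R_K^H$ and $\mathbf I:\mathcal I_J^H\cong\mathcal I_K^H\mathcal I_J^K$ for $J\le K\le H$;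 * $\mathbf C:c_{H,ab}\cong c_{{}^bH,a}c_{H,b}$; * $\mathbf{CI}:c_{H,a}\mathcal I_K^H\cong\mathcal I_{{}^aK}^{{}^aH}c_{K,a}$ and $\mathbf{CR}:c_{K,a}\mathcal R_K^H\cong\mathcal R_{{}^aK}^{{}^aH}c_{H,a}$ for $K\le H$; * $\mathbf{RI}:\mathcal R_L^H\mathcal I_K^H\cong\bigoplus_{x\in L\backslash H/K}\mathcal I_{{}^xK\cap L}^L\mathcal R_{{}^xK\cap L}^{{}^xK}c_{K,x}$ for $K,L\le H$ and every system of representatives $x$ of the double cosets. They have to satisfy the following coherence conditions. * Units: the composites $\mathcal I_L^H\xrightarrow{\mathbf I}\mathcal I_H^H\mathcal I_L^H\cong\mathcal I_L^H$ and $\mathcal I_L^H\xrightarrow{\mathbf I}\mathcal I_L^H\mathcal I_L^L\cong\mathcal I_L^H$ are identities, and likewise for $\mathcal R_L^H\xrightarrow{\mathbf R}\mathcal R_L^H\mathcal R_H^H\cong\mathcal R_L^H$, $\mathcal R_L^H\xrightarrow{\mathbf R}\mathcal R_L^L\mathcal R_L^H\cong\mathcal R_L^H$, $c_{H,a}\xrightarrow{\mathbf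 C}c_{H,a}c_{H,1}\cong c_{H,a}$ and $c_{H,a}\xrightarrow{\mathbf C}c_{{}^aH,1}c_{H,a}\cong c_{H,a}$. * (R), (I), (C): the two composites of $\mathbf R$'s $\mathcal R_J^H\to\mathcal R_J^K\mathcal R_K^L\mathcal R_L^H$ agree; so do the two composites of $\mathbf I$'s $\mathcal I_J^H\to\mathcal I_L^H\mathcal I_K^L\mathcal I_J^K$ and the two composites of $\mathbf C$'s $c_{H,abc}\to c_{{}^{bc}H,a}c_{{}^cH,b}c_{H,c}$. * (RRC): the two maps $c_{K,a}\mathcal R_K^H\to\mathcal R_{{}^aK}^{{}^aL}\mathcal R_{{}^aL}^{{}^aH}c_{H,a}$, namely $\mathbf R$ followed by $\mathbf{CR}$ twice, and $\mathbf{CR}$ followed by $\mathbf R$, agree. * (RCC): the two maps $c_{L,ab}\mathcal R_L^H\to\mathcal R_{{}^{ab}L}^{{}^{ab}H}c_{{}^bH,a}c_{H,b}$, namely $\mathbf{CR}$ followed by $\mathbf C$, and $\mathbf C$ followed by $\mathbf{CR}$ twice, agree. * (IIC): the two maps $c_{H,a}\mathcal I_K^H\to\mathcal I_{{}^aL}^{{}^aH}\mathcal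 I_{{}^aK}^{{}^aL}c_{K,a}$, namely $\mathbf I$ followed by $\mathbf{CI}$ twice, and $\mathbf{CI}$ followed by $\mathbf I$, agree. * (ICC): the two maps $c_{H,ab}\mathcal I_L^H\to\mathcal I_{{}^{ab}L}^{{}^{ab}H}c_{{}^bL,a}c_{L,b}$, namely $\mathbf{CI}$ followed by $\mathbf C$, and $\mathbf C$ followed by $\mathbf{CI}$ twice, agree. **Definition (categorical Green functor).** A categorical Green functor over $\mathcal S$ is a categorical Mackey functor over $\mathcal S$ together with the following. Every $\mathcal M(H)$ is a $k$-linear monoidal category (with $k$-bilinear tensor product), and all $\mathcal R_K^H$ and $c_{H,a}$ are unital monoidal functors. Every $\mathcal I_K^H$ is a left and a right $\mathcal M(H)$-module functor, where $\mathcal M(H)$ acts on $\mathcal M(K)$ along $\mathcal R_K^H$; thus there are isomorphisms $\mathcal I_K^H(\mathcal R_K^HM\otimes V)\cong M\otimes\mathcal I_K^HV$ and $\mathcal I_K^H(V\otimes\mathcal R_K^HM)\cong\mathcal I_K^HV\otimes M$. The transformations $\mathbf R$ and $\mathbf C$ are monoidal, and $\mathbf I:\mathcal I_J^H\to\mathcal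 I_K^H\mathcal I_J^K$ is a morphism of left and of right $\mathcal M(H)$-module functors. Finally, all the natural isomorphisms above, in particular $\mathbf{CI}$, $\mathbf{CR}$ and $\mathbf{RI}$, are isomorphisms of left $\mathcal M(G)$-module functors, where $\mathcal M(G)$ acts on $\mathcal M(H)$ along $\mathcal R_H^G$, and the module structures of $\mathcal R_K^H$, $\mathcal I_K^H$, $c_{H,a}$ are those induced by the monoidal structure of $\mathcal R_K^H$ and $\mathbf R$; by the $\mathcal M(H)$-module structure of $\mathcal I_K^H$ and $\mathbf R$; and by $$c_{H,a}(\mathcal R_H^GM\otimes V)\to c_{H,a}\mathcal R_H^GM\otimes c_{H,a}V\xrightarrow{\mathbf{CR}\otimes1}\mathcal R_{{}^aH}^Gc_{G,a}M\otimes c_{H,a}V\cong\mathcal R_{{}^aH}^GM\otimes c_{H,a}V .$$ **Theorem 1.1.** 1. The categories $\mathcal C^H$ and the functors $\mathcal I_K^H$, $\mathcal R_K^H$, $c_{H,a}$ above underlie a categorical Mackey functor over the monoidal category $\mathrm{Vec}_k$ of finitely generated free $k$-modules (finite-dimensional vector spaces if $k$ is a field). In it one can take $\mathcal R_H^H\cong\mathrm{id}$,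 $\mathbf R$ and $\mathbf{CR}$ to be identities on underlying objects, $\mathbf C=(T_2^{a,b})^{-1}$, $c_{H,h}\cong\mathrm{id}$ to be $\mu^h$ for $h\in H$, and $\mathcal I_H^H\cong\mathrm{id}$ to be $\mu^t:T^tV\to V$, where $t$ is the chosen representative. 2. Suppose moreover that $\mathcal C$ is a $k$-linear monoidal category (with $k$-bilinear tensor product) and that $G$ acts by monoidal autoequivalences, i.e. the $T^g$ are monoidal functors and $T_2^{g,h}$, $T_0$ are monoidal transformations. Give $\mathcal C^H$ the tensor product $M\otimes N$ with equivariant structure $T^h(M\otimes N)\to T^hM\otimes T^hN\xrightarrow{\mu^h\otimes\mu^h}M\otimes N$, give $\mathcal R_K^H$ the identity monoidal structure and $c_{H,a}$ the monoidal structure of $T^a$. Then, with the same functors and the same natural isomorphisms, $H\mapsto\mathcal C^H$ is a categorical Green functor over $\mathcal C^G$, which acts on $\mathcal C^H$ by $M\boxtimes V=\mathcal R_H^GM\otimes V$. -/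

import Mathlib

open CategoryTheory MonoidalCategory Limits
open scoped Pointwise

universe w t u v u₁ v₁ u₂ v₂ u₃ v₃

noncomputable section

/-- An action of a group `G` on a category `C`, i.e. a unital monoidal functor
`g ↦ T^g = T.fn g` from the discrete monoidal category on `G` to the endofunctors of `C`.
The isomorphism `T₂^{g,h} : T^g T^h ≅ T^{gh}` is `T.mul g h k e`, where `e : g * h = k`
(so that no transport along equalities of group elements is needed), and `T₀` is `T.one`.
(Recall that `F ⋙ G` means "first `F`, then `G`".)
Every `T^g` is then an equivalence, hence exact and additive when `C` is abelian; see
`GroupAction.isEquivalence` and `GroupAction.additive`. -/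
structure GroupAction (G : Type t) [Group G] (C : Type u) [Category.{v} C] where
  /-- the functor `T^g` -/
  fn : G → C ⥤ C
  /-- the isomorphism `T₂^{g,h} : T^g T^h ≅ T^{gh}` -/
  mul : ∀ (g h k : G), g * h = k → (fn h ⋙ fn g ≅ fn k)
  /-- the isomorphism `T₀ : id ≅ T^1` -/
  one : 𝟭 C ≅ fn 1
  assoc : ∀ (g h l gh hl ghl : G) (e₁ : g * h = gh) (e₂ : h * l = hl) (e₃ : gh * l = ghl)
    (e₄ : g * hl = ghl) (M : C),
    (mul g h gh e₁).hom.app ((fn l).obj M) ≫ (mul gh l ghl e₃).hom.app M =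
      (fn g).map ((mul h l hl e₂).hom.app M) ≫ (mul g hl ghl e₄).hom.app M
  mul_unit : ∀ (g : G) (M : C),
    (fn g).map (one.hom.app M) ≫ (mul g 1 g (mul_one g)).hom.app M = 𝟙 _
  unit_mul : ∀ (g : G) (M : C),
    one.hom.app ((fn g).obj M) ≫ (mul 1 g g (one_mul g)).hom.app M = 𝟙 _

namespace GroupAction

section Basic

variable {G : Type t} [Group G] {C : Type u} [Category.{v} C] (T : GroupAction G C)

theorem isEquivalence (g : G) : (T.fn g).IsEquivalence :=
  (CategoryTheory.Equivalence.mk (T.fn g) (T.fn g⁻¹)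
    (T.one ≪≫ (T.mul g⁻¹ g 1 (inv_mul_cancel g)).symm)
    (T.mul g g⁻¹ 1 (mul_inv_cancel g) ≪≫ T.one.symm)).isEquivalence_functor

theorem additive [Preadditive C] [HasFiniteBiproducts C] (g : G) : (T.fn g).Additive := by
  have := T.isEquivalence g
  have : HasFiniteProducts C := inferInstance
  exact Functor.additive_of_preserves_binary_products _

theorem isIso_of_axioms {H : Subgroup G} (X : C) (φ : ∀ h : H, (T.fn h).obj X ⟶ X)
    (hmul : ∀ g h : H, (T.fn g).map (φ h) ≫ φ g =
      (T.mul g h (g * h : H) rfl).hom.app X ≫ φ (g * h))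
    (hone : T.one.hom.app X ≫ φ 1 = 𝟙 X) (h : H) : IsIso (φ h) := by
  have h1 : IsIso (φ 1) := by
    have : IsIso (T.one.hom.app X ≫ φ 1) := by rw [hone]; exact IsIso.id X
    exact IsIso.of_isIso_comp_left (T.one.hom.app X) (φ 1)
  have key : ∀ g : H, IsIso ((T.fn g).map (φ g⁻¹) ≫ φ g) := by
    intro g
    have h2 : IsIso (φ (g * g⁻¹)) := by rw [mul_inv_cancel]; exact h1
    rw [hmul]; infer_instance
  have : ∀ g : G, (T.fn g).IsEquivalence := T.isEquivalence
  have := key h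
  have hm : Mono (φ h) := by
    have := key h⁻¹
    rw [inv_inv] at this
    have hm' : Mono ((T.fn ((h⁻¹ : H) : G)).map (φ h)) := mono_of_mono _ (φ h⁻¹)
    exact (T.fn ((h⁻¹ : H) : G)).mono_of_mono_map hm'
  have : IsSplitEpi (φ h) := ⟨⟨⟨inv ((T.fn h).map (φ h⁻¹) ≫ φ h) ≫ (T.fn h).map (φ h⁻¹), by
    rw [Category.assoc, IsIso.inv_hom_id]⟩⟩⟩
  exact isIso_of_mono_of_isSplitEpi _

theorem map_id_comm {X : C} (F : C ⥤ C) (φ : F.obj X ⟶ X) : F.map (𝟙 X) ≫ φ = φ ≫ 𝟙 X := by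
  simp

/-- An `H`-equivariant object of `C`: an object `M` with isomorphisms
`μ^h : T^h M ⟶ M` for `h ∈ H`, compatible with `T₂` and `T₀`. -/
structure Equivariant (H : Subgroup G) where
  /-- the underlying object -/
  obj : C
  /-- the equivariant structure -/
  μ : ∀ h : H, (T.fn h).obj obj ⟶ obj
  isIso_μ : ∀ h : H, IsIso (μ h)
  μ_mul : ∀ g h : H, (T.fn g).map (μ h) ≫ μ g =
    (T.mul g h (g * h : H) rfl).hom.app obj ≫ μ (g * h)
  μ_one : T.one.hom.app obj ≫ μ 1 = 𝟙 obj

namespace Equivariant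

variable {T} {H : Subgroup G}

/-- A morphism of equivariant objects. -/
@[ext]
structure Hom (X Y : T.Equivariant H) where
  /-- the underlying morphism -/
  hom : X.obj ⟶ Y.obj
  comm : ∀ h : H, (T.fn h).map hom ≫ Y.μ h = X.μ h ≫ hom

/-- The equivariantization `C^H`. -/
instance : Category (T.Equivariant H) where
  Hom X Y := Hom X Y
  id X := ⟨𝟙 _, fun h => by simp⟩
  comp f g := ⟨f.hom ≫ g.hom, fun h => by
    rw [Functor.map_comp, Category.assoc, g.comm, ← Category.assoc, f.comm, Category.assoc]⟩

@[ext]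
theorem hom_ext {X Y : T.Equivariant H} (f g : X ⟶ Y) (h : f.hom = g.hom) : f = g :=
  Hom.ext h

@[simp] theorem id_hom (X : T.Equivariant H) : Hom.hom (𝟙 X) = 𝟙 X.obj := rfl

@[simp] theorem comp_hom {X Y Z : T.Equivariant H} (f : X ⟶ Y) (g : Y ⟶ Z) :
    (f ≫ g).hom = f.hom ≫ g.hom := rfl

/-- An isomorphism of equivariant objects from an equivariant isomorphism in `C`. -/
@[simps]
def isoMk {X Y : T.Equivariant H} (e : X.obj ≅ Y.obj)
    (h : ∀ a : H, (T.fn a).map e.hom ≫ Y.μ a = X.μ a ≫ e.hom) : X ≅ Y where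
  hom := ⟨e.hom, h⟩
  inv := ⟨e.inv, fun a => by
    rw [← cancel_epi ((T.fn a).map e.hom), ← Category.assoc, ← Functor.map_comp, e.hom_inv_id,
      ← Category.assoc, h]
    simp⟩

variable (T H) in
/-- The functor forgetting the equivariant structure. -/
@[simps]
def forget : T.Equivariant H ⥤ C where
  obj X := X.obj
  map f := f.hom

instance : (forget T H).Faithful where
  map_injective h := hom_ext _ _ h

section Preadditive

variable [Preadditive C] [HasFiniteBiproducts C]

instance : Preadditive (T.Equivariant H) where
  homGroup X Y :=
    let F : (X ⟶ Y) → (X.obj ⟶ Y.obj) := Hom.hom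
    letI : Zero (X ⟶ Y) := ⟨⟨0, fun h => by have := T.additive h; simp⟩⟩
    letI : Add (X ⟶ Y) := ⟨fun f g => ⟨f.hom + g.hom, fun h => by
      have := T.additive h
      simp [Preadditive.add_comp, Preadditive.comp_add, f.comm, g.comm]⟩⟩
    letI : Neg (X ⟶ Y) := ⟨fun f => ⟨-f.hom, fun h => by
      have := T.additive h
      simp [f.comm]⟩⟩
    letI : Sub (X ⟶ Y) := ⟨fun f g => ⟨f.hom - g.hom, fun h => by
      have := T.additive h
      simp [Preadditive.sub_comp, Preadditive.comp_sub, f.comm, g.comm]⟩⟩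
    letI : SMul ℕ (X ⟶ Y) := ⟨fun n f => ⟨n • f.hom, fun h => by
      have := T.additive h
      simp [f.comm]⟩⟩
    letI : SMul ℤ (X ⟶ Y) := ⟨fun n f => ⟨n • f.hom, fun h => by
      have := T.additive h
      simp [f.comm]⟩⟩
    Function.Injective.addCommGroup F (fun f g h => hom_ext f g h) rfl (fun _ _ => rfl)
      (fun _ => rfl) (fun _ _ => rfl) (fun _ _ => rfl) (fun _ _ => rfl)
  add_comp _ _ _ f f' g := hom_ext _ _ (Preadditive.add_comp _ _ _ f.hom f'.hom g.hom)
  comp_add _ _ _ f g g' := hom_ext _ _ (Preadditive.comp_add _ _ _ f.hom g.hom g'.hom)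

@[simp] theorem add_hom {X Y : T.Equivariant H} (f g : X ⟶ Y) :
    (f + g).hom = f.hom + g.hom := rfl

instance : (forget T H).Additive where

variable {k : Type w} [CommRing k] [Linear k C] [hT : ∀ g : G, (T.fn g).Linear k]

instance : Linear k (T.Equivariant H) where
  homModule X Y :=
    let F : (X ⟶ Y) →+ (X.obj ⟶ Y.obj) := ⟨⟨Hom.hom, rfl⟩, fun _ _ => rfl⟩
    letI : SMul k (X ⟶ Y) := ⟨fun r f => ⟨r • f.hom, fun h => by
      rw [Functor.map_smul, Linear.smul_comp, Linear.comp_smul, f.comm]⟩⟩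
    Function.Injective.module k F (fun f g h => hom_ext f g h) (fun _ _ => rfl)
  smul_comp _ _ _ r f g := hom_ext _ _ (Linear.smul_comp _ _ _ r f.hom g.hom)
  comp_smul _ _ _ f r g := hom_ext _ _ (Linear.comp_smul _ _ _ f.hom r g.hom)

@[simp] theorem smul_hom {X Y : T.Equivariant H} (r : k) (f : X ⟶ Y) :
    (r • f).hom = r • f.hom := rfl

instance : (forget T H).Linear k where

end Preadditive

end Equivariant

/-! ### Restriction, conjugation and induction -/

section Functors

variable {T} {H : Subgroup G}

theorem mul_naturality {g h k : G} (e : g * h = k) {M N : C} (f : M ⟶ N) :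
    (T.fn g).map ((T.fn h).map f) ≫ (T.mul g h k e).hom.app N =
      (T.mul g h k e).hom.app M ≫ (T.fn k).map f :=
  (T.mul g h k e).hom.naturality f

theorem Equivariant.μ_mul' (X : T.Equivariant H) {g h k : H} (e : g * h = k) (e' : (g : G) * h = k) :
    (T.fn g).map (X.μ h) ≫ X.μ g = (T.mul g h k e').hom.app X.obj ≫ X.μ k := by
  subst e; exact X.μ_mul g h

/-- For `X ∈ C^H` and `g r = s h` with `h ∈ H`, the composite
`T^g T^r X ⟶ T^{gr} X = T^{sh} X ⟶ T^s T^h X ⟶ T^s X` of `T₂^{g,r}`, the inverse of `T₂^{s,h}`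
and `T^s(μ^h)`. -/
def twist (X : T.Equivariant H) (g r s : G) (h : H) (e : g * r = s * h) :
    (T.fn g).obj ((T.fn r).obj X.obj) ⟶ (T.fn s).obj X.obj :=
  (T.mul g r (g * r) rfl).hom.app X.obj ≫ (T.mul s h (g * r) e.symm).inv.app X.obj ≫
    (T.fn s).map (X.μ h)

theorem twist_naturality {X Y : T.Equivariant H} (f : X ⟶ Y) (g r s : G) (h : H)
    (e : g * r = s * h) :
    (T.fn g).map ((T.fn r).map f.hom) ≫ twist Y g r s h e =
      twist X g r s h e ≫ (T.fn s).map f.hom := by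
  have h1 := (T.mul s h (g * r) e.symm).inv.naturality f.hom
  dsimp at h1
  simp only [twist, Category.assoc]
  rw [← Category.assoc, mul_naturality, Category.assoc, ← Functor.map_comp, ← f.comm,
    Functor.map_comp, ← Category.assoc ((T.fn (g * r)).map f.hom), h1]
  simp only [Category.assoc]

theorem twist_mul (X : T.Equivariant H) (g g' gg r s u : G) (h h' hh : H) (eg : g * g' = gg)
    (eh : h * h' = hh) (e : g' * r = s * h') (e' : g * s = u * h) (e'' : gg * r = u * hh) :
    (T.fn g).map (twist X g' r s h' e) ≫ twist X g s u h e' =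
      (T.mul g g' gg eg).hom.app ((T.fn r).obj X.obj) ≫ twist X gg r u hh e'' := by
  have eh' : (h : G) * h' = hh := by rw [← eh]; rfl
  have n1 := (T.mul u h (g * s) e'.symm).inv.naturality (X.μ h')
  have m1 := X.μ_mul' eh eh'
  have a1 := T.assoc g g' r gg (g' * r) (gg * r) eg rfl rfl (by rw [← eg, mul_assoc]) X.obj
  have a2 := T.assoc g s h' (g * s) (g' * r) (gg * r) rfl e.symm
    (by rw [← eg, mul_assoc, mul_assoc, e]) (by rw [← eg, mul_assoc]) X.obj
  have a3 := T.assoc u h h' (g * s) hh (gg * r) e'.symm eh'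
    (by rw [← eg, mul_assoc, mul_assoc, e]) e''.symm X.obj
  dsimp at n1
  simp only [twist, Functor.map_comp, Category.assoc]
  rw [reassoc_of% a1]
  congr 1
  rw [← cancel_epi ((T.fn g).map ((T.mul s h' (g' * r) e.symm).hom.app X.obj)),
    ← Functor.map_comp_assoc, Iso.hom_inv_id_app, CategoryTheory.Functor.map_id, Category.id_comp,
    ← reassoc_of% a2, ← Category.assoc ((T.fn g).map ((T.fn s).map _)), mul_naturality, Category.assoc]
  congr 1
  rw [reassoc_of% n1, ← Functor.map_comp, m1,
    ← cancel_epi ((T.mul u h (g * s) e'.symm).hom.app ((T.fn h').obj X.obj)),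
    reassoc_of% a3, Iso.hom_inv_id_app_assoc, Iso.hom_inv_id_app_assoc, Functor.map_comp]

theorem twist_one (X : T.Equivariant H) (r : G) (e : 1 * r = r * (1 : H)) :
    T.one.hom.app ((T.fn r).obj X.obj) ≫ twist X 1 r r 1 e = 𝟙 _ := by
  have h1 := T.unit_mul r X.obj
  have h2 := T.mul_unit r X.obj
  have h3 := X.μ_one
  have key : ∀ (x : G) (hx : 1 * r = x) (hx' : r * ((1 : H) : G) = x),
      T.one.hom.app ((T.fn r).obj X.obj) ≫ (T.mul 1 r x hx).hom.app X.obj ≫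
        (T.mul r (1 : H) x hx').inv.app X.obj ≫ (T.fn r).map (X.μ 1) = 𝟙 _ := by
    intro x hx hx'
    obtain rfl : r = x := by simpa using hx
    rw [reassoc_of% h1]
    have h4 : (T.mul r (1 : H) r hx').inv.app X.obj = (T.fn r).map (T.one.hom.app X.obj) := by
      rw [← cancel_mono ((T.mul r (1 : H) r hx').hom.app X.obj), Iso.inv_hom_id_app]
      exact h2.symm
    rw [h4]
    have h5 := congrArg (T.fn r).map h3
    exact ((T.fn r).map_comp _ _).symm.trans (h5.trans ((T.fn r).map_id _))
  exact key _ rfl e.symm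

/-- The restriction functor `C^H ⥤ C^K` for `K ≤ H`. -/
@[simps]
def res {K H : Subgroup G} (hKH : K ≤ H) : T.Equivariant H ⥤ T.Equivariant K where
  obj X :=
    { obj := X.obj
      μ := fun h => X.μ ⟨h, hKH h.2⟩
      isIso_μ := fun h => X.isIso_μ ⟨h, hKH h.2⟩
      μ_mul := fun g h => X.μ_mul ⟨g, hKH g.2⟩ ⟨h, hKH h.2⟩
      μ_one := X.μ_one }
  map f := ⟨f.hom, fun h => f.comm ⟨h, hKH h.2⟩⟩

theorem conj_mem {a : G} {H H' : Subgroup G} (h : H' = MulAut.conj a • H) (g : H') :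
    a⁻¹ * g * a ∈ H := by
  have h1 : ∀ x ∈ H', a⁻¹ * x * a ∈ H := by
    intro x hx
    rw [h, Subgroup.mem_pointwise_smul_iff_inv_smul_mem] at hx
    simpa [← map_inv] using hx
  exact h1 g g.2

/-- The equivariant structure of the conjugate of `X`, given for `g = aba⁻¹` with `b ∈ H` by
`T^{aba⁻¹} T^a X ⟶ T^{ab} X ⟶ T^a T^b X ⟶ T^a X`. -/
def conjμ (a : G) {H H' : Subgroup G} (h : H' = MulAut.conj a • H) (X : T.Equivariant H) (g : H') :
    (T.fn g).obj ((T.fn a).obj X.obj) ⟶ (T.fn a).obj X.obj :=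
  twist X g a a ⟨a⁻¹ * g * a, conj_mem h g⟩ (by group)

theorem conjμ_mul (a : G) {H H' : Subgroup G} (h : H' = MulAut.conj a • H) (X : T.Equivariant H)
    (g g' : H') : (T.fn g).map (conjμ a h X g') ≫ conjμ a h X g =
      (T.mul g g' (g * g' : H') rfl).hom.app _ ≫ conjμ a h X (g * g') :=
  twist_mul X _ _ _ _ _ _ _ _ _ _
    (Subtype.ext (by simp only [Subgroup.coe_mul]; group)) _ _ _

theorem conjμ_one (a : G) {H H' : Subgroup G} (h : H' = MulAut.conj a • H) (X : T.Equivariant H) :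
    T.one.hom.app ((T.fn a).obj X.obj) ≫ conjμ a h X 1 = 𝟙 _ := by
  have : (⟨a⁻¹ * (1 : H') * a, conj_mem h 1⟩ : H) = 1 := Subtype.ext (by simp)
  simp only [conjμ, this]
  exact twist_one X a (by simp)

/-- The conjugation functor `c_{H,a} : C^H ⥤ C^{H'}`, where `H' = aHa⁻¹`. It sends `(X, μ)` to
`T^a X` with the equivariant structure `conjμ`. -/
@[simps]
def conj (a : G) {H H' : Subgroup G} (h : H' = MulAut.conj a • H) :
    T.Equivariant H ⥤ T.Equivariant H' where
  obj X :=
    { obj := (T.fn a).obj X.obj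
      μ := conjμ a h X
      isIso_μ := T.isIso_of_axioms _ _ (conjμ_mul a h X) (conjμ_one a h X)
      μ_mul := conjμ_mul a h X
      μ_one := conjμ_one a h X }
  map f := ⟨(T.fn a).map f.hom, fun g => twist_naturality f _ _ _ _ (by group)⟩
  map_id X := by ext; simp
  map_comp f g := by ext; simp

/-- A system of representatives of the left cosets `tL` of `L` in `H`. -/
structure CosetReps (L H : Subgroup G) where
  /-- the representative of a coset -/
  rep : H ⧸ L.subgroupOf H → H
  mk_rep : ∀ q, (rep q : H ⧸ L.subgroupOf H) = q

theorem CosetReps.mem {L H : Subgroup G} (R : CosetReps L H) {g : H} {p q : H ⧸ L.subgroupOf H}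
    (hp : g • p = q) : ((R.rep q : G))⁻¹ * (g * R.rep p) ∈ L := by
  have h1 : ((R.rep q : H) : H ⧸ L.subgroupOf H) = ((g * R.rep p : H) : H ⧸ L.subgroupOf H) := by
    rw [R.mk_rep, ← hp]
    conv_lhs => rw [← R.mk_rep p]
    rfl
  exact Subgroup.mem_subgroupOf.1 (QuotientGroup.eq.1 h1)

variable [Finite G] [Preadditive C] [HasFiniteBiproducts C]

section

variable {L H : Subgroup G} (R : CosetReps L H) (X : T.Equivariant L)

/-- The underlying object `⨁_t T^t X` of the induced object. -/
abbrev indObj : C := ⨁ fun q : H ⧸ L.subgroupOf H => (T.fn (R.rep q)).obj X.obj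

/-- The equivariant structure of the induced object. Its component
`T^g T^t X ⟶ T^s X` is `T₂^{g,t}` followed by the inverse of `T₂^{s,h}` and `T^s(μ^h)`, where
`g t = s h` with `h ∈ L`; the components at the other pairs `(t, s)` are zero. -/
def indμ (g : H) : (T.fn g).obj (indObj R X) ⟶ indObj R X :=
  biproduct.lift fun q => (T.fn g).map (biproduct.π _ (g⁻¹ • q)) ≫
    twist X g (R.rep (g⁻¹ • q)) (R.rep q)
      ⟨_, R.mem (g := g) (p := g⁻¹ • q) (q := q) (smul_inv_smul g q)⟩ (by group)

theorem indμ_π (g : H) (p q : H ⧸ L.subgroupOf H) (hp : g • p = q) (h : L)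
    (e : (g : G) * R.rep p = R.rep q * h) :
    indμ R X g ≫ biproduct.π _ q =
      (T.fn g).map (biproduct.π _ p) ≫ twist X g (R.rep p) (R.rep q) h e := by
  obtain rfl : p = g⁻¹ • q := by rw [← hp, inv_smul_smul]
  have : h = ⟨_, R.mem (g := g) (p := g⁻¹ • q) (q := q) (smul_inv_smul g q)⟩ :=
    Subtype.ext (eq_inv_mul_of_mul_eq e.symm)
  subst this
  simp [indμ]

theorem indμ_mul (g h : H) : (T.fn g).map (indμ R X h) ≫ indμ R X g =
    (T.mul g h (g * h : H) rfl).hom.app _ ≫ indμ R X (g * h) := by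
  refine biproduct.hom_ext _ _ fun q => ?_
  have e1 := R.mem (g := g) (p := g⁻¹ • q) (q := q) (smul_inv_smul g q)
  have e2 := R.mem (g := h) (p := h⁻¹ • g⁻¹ • q) (q := g⁻¹ • q) (smul_inv_smul h _)
  rw [Category.assoc, Category.assoc,
    indμ_π R X g (g⁻¹ • q) q (smul_inv_smul g q) ⟨_, e1⟩ (by group),
    ← Functor.map_comp_assoc,
    indμ_π R X h (h⁻¹ • g⁻¹ • q) (g⁻¹ • q) (smul_inv_smul h _) ⟨_, e2⟩ (by group),
    indμ_π R X (g * h) (h⁻¹ • g⁻¹ • q) q (by rw [mul_smul, smul_inv_smul, smul_inv_smul])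
      (⟨_, e1⟩ * ⟨_, e2⟩) (by simp only [Subgroup.coe_mul]; group),
    Functor.map_comp_assoc,
    twist_mul X g h (g * h : H) _ _ _ _ _ (⟨_, e1⟩ * ⟨_, e2⟩) rfl rfl _ _
      (by simp only [Subgroup.coe_mul]; group),
    ← Category.assoc, mul_naturality, Category.assoc]

theorem indμ_one : T.one.hom.app (indObj R X) ≫ indμ R X 1 = 𝟙 _ := by
  refine biproduct.hom_ext _ _ fun q => ?_
  have n := T.one.hom.naturality
    (biproduct.π (fun q : H ⧸ L.subgroupOf H => (T.fn (R.rep q)).obj X.obj) q)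
  dsimp at n
  rw [Category.assoc, indμ_π R X 1 q q (one_smul _ _) 1 (by simp)]
  have t := twist_one X (R.rep q) (by simp)
  erw [← reassoc_of% n, t]
  simp

/-- The induction functor `C^L ⥤ C^H`, for a chosen system of representatives of the left
cosets of `L` in `H`. -/
@[simps]
def ind : T.Equivariant L ⥤ T.Equivariant H where
  obj X :=
    { obj := indObj R X
      μ := indμ R X
      isIso_μ := T.isIso_of_axioms _ _ (indμ_mul R X) (indμ_one R X)
      μ_mul := indμ_mul R X
      μ_one := indμ_one R X }
  map {X Y} f := ⟨biproduct.map fun q => (T.fn (R.rep q)).map f.hom, fun g => by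
    refine biproduct.hom_ext _ _ fun q => ?_
    have e1 := R.mem (g := g) (p := g⁻¹ • q) (q := q) (smul_inv_smul g q)
    rw [Category.assoc, Category.assoc, biproduct.map_π,
      indμ_π R Y g (g⁻¹ • q) q (smul_inv_smul g q) ⟨_, e1⟩ (by group),
      ← Functor.map_comp_assoc, biproduct.map_π, ← Category.assoc,
      indμ_π R X g (g⁻¹ • q) q (smul_inv_smul g q) ⟨_, e1⟩ (by group),
      Functor.map_comp_assoc, twist_naturality, Category.assoc]⟩
  map_id X := by ext; simp
  map_comp f g := by ext; simp

end

end Functors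
/-! ### Actions by monoidal autoequivalences -/

section Monoidal

open Functor.LaxMonoidal Functor.OplaxMonoidal Functor.Monoidal Equivariant


/-- The group acts by monoidal autoequivalences: every `T^g` is a monoidal functor and the
isomorphisms `T₂^{g,h}` and `T₀` are monoidal natural transformations. -/
class MonoidalAction [MonoidalCategory C] where
  /-- the monoidal structure of `T^g` -/
  monoidal : ∀ g : G, (T.fn g).Monoidal
  mul_isMonoidal : ∀ (g h k : G) (e : g * h = k), NatTrans.IsMonoidal (T.mul g h k e).hom
  one_isMonoidal : NatTrans.IsMonoidal T.one.hom

variable {T} [MonoidalCategory C] [hM : T.MonoidalAction] {H : Subgroup G}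

instance (g : G) : (T.fn g).Monoidal := MonoidalAction.monoidal g

instance (g h k : G) (e : g * h = k) : NatTrans.IsMonoidal (T.mul g h k e).hom :=
  MonoidalAction.mul_isMonoidal g h k e

instance : NatTrans.IsMonoidal T.one.hom := MonoidalAction.one_isMonoidal

theorem mul_δ {g h k : G} (e : g * h = k) (M N : C) :
    (T.mul g h k e).hom.app (M ⊗ N) ≫ δ (T.fn k) M N =
      (T.fn g).map (δ (T.fn h) M N) ≫ δ (T.fn g) _ _ ≫
        ((T.mul g h k e).hom.app M ⊗ₘ (T.mul g h k e).hom.app N) := by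
  have h1 := NatTrans.IsMonoidal.tensor (τ := (T.mul g h k e).hom) M N
  rw [← cancel_mono (μ (T.fn k) M N), Category.assoc, Functor.Monoidal.δ_μ, Category.comp_id]
  simp only [Category.assoc]
  rw [← h1]
  have h2 : (T.fn g).map (δ (T.fn h) M N) ≫ δ (T.fn g) _ _ = δ (T.fn h ⋙ T.fn g) M N := by
    simp
  rw [reassoc_of% h2, Functor.Monoidal.δ_μ_assoc]

theorem mul_η {g h k : G} (e : g * h = k) :
    (T.mul g h k e).hom.app (𝟙_ C) ≫ η (T.fn k) =
      (T.fn g).map (η (T.fn h)) ≫ η (T.fn g) := by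
  have h1 := NatTrans.IsMonoidal.unit (τ := (T.mul g h k e).hom)
  rw [← cancel_mono (ε (T.fn k)), Category.assoc, Functor.Monoidal.η_ε, Category.comp_id, ← h1]
  have h2 : (T.fn g).map (η (T.fn h)) ≫ η (T.fn g) = η (T.fn h ⋙ T.fn g) := by
    simp
  rw [h2, Functor.Monoidal.η_ε_assoc]

theorem one_δ (M N : C) : T.one.hom.app (M ⊗ N) ≫ δ (T.fn 1) M N =
    (T.one.hom.app M ⊗ₘ T.one.hom.app N) := by
  have h1 := NatTrans.IsMonoidal.tensor (τ := T.one.hom) M N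
  rw [← cancel_mono (μ (T.fn 1) M N), Category.assoc, Functor.Monoidal.δ_μ, Category.comp_id,
    ← h1]
  simp

theorem one_η : T.one.hom.app (𝟙_ C) ≫ η (T.fn 1) = 𝟙 _ := by
  have h1 := NatTrans.IsMonoidal.unit (τ := T.one.hom)
  rw [← cancel_mono (ε (T.fn 1)), Category.assoc, Functor.Monoidal.η_ε, Category.comp_id, ← h1]
  simp

namespace Equivariant

theorem tensorμ_mul (X Y : T.Equivariant H) (g h : H) :
    (T.fn g).map (δ (T.fn h) X.obj Y.obj ≫ (X.μ h ⊗ₘ Y.μ h)) ≫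
        δ (T.fn g) X.obj Y.obj ≫ (X.μ g ⊗ₘ Y.μ g) =
      (T.mul g h (g * h : H) rfl).hom.app (X.obj ⊗ Y.obj) ≫
        δ (T.fn (g * h : H)) X.obj Y.obj ≫ (X.μ (g * h) ⊗ₘ Y.μ (g * h)) := by
  rw [reassoc_of% (mul_δ (T := T) (g := g) (h := h) (k := (g * h : H)) rfl X.obj Y.obj),
    tensorHom_comp_tensorHom, ← X.μ_mul, ← Y.μ_mul, ← tensorHom_comp_tensorHom,
    Functor.map_comp_assoc, δ_natural_assoc]

theorem tensorμ_one (X Y : T.Equivariant H) : T.one.hom.app (X.obj ⊗ Y.obj) ≫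
    δ (T.fn ((1 : H) : G)) X.obj Y.obj ≫ (X.μ 1 ⊗ₘ Y.μ 1) = 𝟙 _ := by
  have h1 := one_δ (T := T) X.obj Y.obj
  have hX := X.μ_one
  have hY := Y.μ_one
  erw [reassoc_of% h1, tensorHom_comp_tensorHom, hX, hY]
  simp

/-- The tensor product of equivariant objects, with the equivariant structure
`T^h (X ⊗ Y) ⟶ T^h X ⊗ T^h Y ⟶ X ⊗ Y`. -/
@[simps]
def tensor (X Y : T.Equivariant H) : T.Equivariant H where
  obj := X.obj ⊗ Y.obj
  μ h := δ (T.fn h) X.obj Y.obj ≫ (X.μ h ⊗ₘ Y.μ h)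
  isIso_μ := T.isIso_of_axioms _ _ (tensorμ_mul X Y) (tensorμ_one X Y)
  μ_mul := tensorμ_mul X Y
  μ_one := tensorμ_one X Y

variable (T H) in
/-- The unit object, with the equivariant structure given by the unit constraints of the `T^h`. -/
@[simps]
def tensorUnit : T.Equivariant H where
  obj := 𝟙_ C
  μ h := η (T.fn h)
  isIso_μ _ := inferInstance
  μ_mul _ _ := (mul_η _).symm
  μ_one := one_η

theorem tensorHom_comm {X X' Y Y' : T.Equivariant H} (f : X ⟶ X') (g : Y ⟶ Y') (h : H) :
    (T.fn h).map (f.hom ⊗ₘ g.hom) ≫ δ (T.fn h) X'.obj Y'.obj ≫ (X'.μ h ⊗ₘ Y'.μ h) =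
      (δ (T.fn h) X.obj Y.obj ≫ (X.μ h ⊗ₘ Y.μ h)) ≫ (f.hom ⊗ₘ g.hom) := by
  rw [Category.assoc, ← δ_natural_assoc, tensorHom_comp_tensorHom, tensorHom_comp_tensorHom,
    f.comm, g.comm]

theorem associator_comm (X Y Z : T.Equivariant H) (h : H) :
    (T.fn h).map (α_ X.obj Y.obj Z.obj).hom ≫ δ (T.fn h) X.obj (Y.obj ⊗ Z.obj) ≫
        (X.μ h ⊗ₘ (δ (T.fn h) Y.obj Z.obj ≫ (Y.μ h ⊗ₘ Z.μ h))) =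
      (δ (T.fn h) (X.obj ⊗ Y.obj) Z.obj ≫
        ((δ (T.fn h) X.obj Y.obj ≫ (X.μ h ⊗ₘ Y.μ h)) ⊗ₘ Z.μ h)) ≫
        (α_ X.obj Y.obj Z.obj).hom := by
  have h1 : (X.μ h ⊗ₘ (δ (T.fn h) Y.obj Z.obj ≫ (Y.μ h ⊗ₘ Z.μ h))) =
      ((T.fn h).obj X.obj ◁ δ (T.fn h) Y.obj Z.obj) ≫ (X.μ h ⊗ₘ (Y.μ h ⊗ₘ Z.μ h)) := by
    rw [← id_tensorHom, tensorHom_comp_tensorHom, Category.id_comp]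
  have h2 : ((δ (T.fn h) X.obj Y.obj ≫ (X.μ h ⊗ₘ Y.μ h)) ⊗ₘ Z.μ h) =
      (δ (T.fn h) X.obj Y.obj ▷ (T.fn h).obj Z.obj) ≫ ((X.μ h ⊗ₘ Y.μ h) ⊗ₘ Z.μ h) := by
    rw [← tensorHom_id, tensorHom_comp_tensorHom, Category.id_comp]
  have h3 := Functor.OplaxMonoidal.associativity (T.fn h) X.obj Y.obj Z.obj
  rw [h1, h2, Category.assoc, Category.assoc, associator_naturality, reassoc_of% h3]

theorem leftUnitor_comm (X : T.Equivariant H) (h : H) :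
    (T.fn h).map (λ_ X.obj).hom ≫ X.μ h =
      (δ (T.fn h) (𝟙_ C) X.obj ≫ (η (T.fn h) ⊗ₘ X.μ h)) ≫ (λ_ X.obj).hom := by
  rw [MonoidalCategory.tensorHom_def, Category.assoc, Category.assoc, leftUnitor_naturality,
    Functor.OplaxMonoidal.left_unitality_hom_assoc]

theorem rightUnitor_comm (X : T.Equivariant H) (h : H) :
    (T.fn h).map (ρ_ X.obj).hom ≫ X.μ h =
      (δ (T.fn h) X.obj (𝟙_ C) ≫ (X.μ h ⊗ₘ η (T.fn h))) ≫ (ρ_ X.obj).hom := by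
  rw [MonoidalCategory.tensorHom_def', Category.assoc, Category.assoc, rightUnitor_naturality,
    Functor.OplaxMonoidal.right_unitality_hom_assoc]

instance : MonoidalCategoryStruct (T.Equivariant H) where
  tensorObj := tensor
  tensorUnit := tensorUnit T H
  tensorHom f g := ⟨f.hom ⊗ₘ g.hom, tensorHom_comm f g⟩
  whiskerLeft X _ _ g := ⟨X.obj ◁ g.hom, fun h => by
    have := tensorHom_comm (𝟙 X) g h
    rwa [id_hom, id_tensorHom] at this⟩
  whiskerRight f Y := ⟨f.hom ▷ Y.obj, fun h => by
    have := tensorHom_comm f (𝟙 Y) h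
    rwa [id_hom, tensorHom_id] at this⟩
  associator X Y Z := isoMk (α_ X.obj Y.obj Z.obj) (associator_comm X Y Z)
  leftUnitor X := isoMk (λ_ X.obj) (leftUnitor_comm X)
  rightUnitor X := isoMk (ρ_ X.obj) (rightUnitor_comm X)

section
variable (X Y Z : T.Equivariant H)
@[simp] theorem tensorObj_obj : (X ⊗ Y).obj = X.obj ⊗ Y.obj := rfl
@[simp] theorem tensorObj_μ (h : H) :
    (X ⊗ Y).μ h = δ (T.fn h) X.obj Y.obj ≫ (X.μ h ⊗ₘ Y.μ h) := rfl
@[simp] theorem tensorUnit_obj' : (𝟙_ (T.Equivariant H)).obj = 𝟙_ C := rfl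
@[simp] theorem tensorUnit_μ' (h : H) : (𝟙_ (T.Equivariant H)).μ h = η (T.fn h) := rfl
@[simp] theorem tensorHom_hom {X' Y' : T.Equivariant H} (f : X ⟶ X') (g : Y ⟶ Y') :
    (f ⊗ₘ g).hom = f.hom ⊗ₘ g.hom := rfl
@[simp] theorem whiskerLeft_hom {Y' : T.Equivariant H} (g : Y ⟶ Y') :
    (X ◁ g).hom = X.obj ◁ g.hom := rfl
@[simp] theorem whiskerRight_hom {X' : T.Equivariant H} (f : X ⟶ X') :
    (f ▷ Y).hom = f.hom ▷ Y.obj := rfl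
@[simp] theorem associator_hom_hom : (α_ X Y Z).hom.hom = (α_ X.obj Y.obj Z.obj).hom := rfl
@[simp] theorem leftUnitor_hom_hom : (λ_ X).hom.hom = (λ_ X.obj).hom := rfl
@[simp] theorem rightUnitor_hom_hom : (ρ_ X).hom.hom = (ρ_ X.obj).hom := rfl
end

/-- The monoidal structure of `C^H`. -/
instance : MonoidalCategory (T.Equivariant H) where
  tensorHom_def f g := hom_ext _ _ (MonoidalCategory.tensorHom_def f.hom g.hom)
  id_tensorHom_id X Y := hom_ext _ _ (MonoidalCategory.id_tensorHom_id X.obj Y.obj)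
  tensorHom_comp_tensorHom f g f' g' :=
    hom_ext _ _ (MonoidalCategory.tensorHom_comp_tensorHom f.hom g.hom f'.hom g'.hom)
  whiskerLeft_id X Y := hom_ext _ _ (MonoidalCategory.whiskerLeft_id X.obj Y.obj)
  id_whiskerRight X Y := hom_ext _ _ (MonoidalCategory.id_whiskerRight X.obj Y.obj)
  associator_naturality f g h :=
    hom_ext _ _ (MonoidalCategory.associator_naturality f.hom g.hom h.hom)
  leftUnitor_naturality f := hom_ext _ _ (MonoidalCategory.leftUnitor_naturality f.hom)
  rightUnitor_naturality f := hom_ext _ _ (MonoidalCategory.rightUnitor_naturality f.hom)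
  pentagon W X Y Z := hom_ext _ _ (MonoidalCategory.pentagon W.obj X.obj Y.obj Z.obj)
  triangle X Y := hom_ext _ _ (MonoidalCategory.triangle X.obj Y.obj)

instance [Preadditive C] [HasFiniteBiproducts C] [MonoidalPreadditive C] :
    MonoidalPreadditive (T.Equivariant H) where
  whiskerLeft_zero := hom_ext _ _ MonoidalPreadditive.whiskerLeft_zero
  zero_whiskerRight := hom_ext _ _ MonoidalPreadditive.zero_whiskerRight
  whiskerLeft_add _ _ := hom_ext _ _ (MonoidalPreadditive.whiskerLeft_add _ _)
  add_whiskerRight _ _ := hom_ext _ _ (MonoidalPreadditive.add_whiskerRight _ _)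

instance [Preadditive C] [HasFiniteBiproducts C] [MonoidalPreadditive C]
    {k : Type w} [CommRing k] [Linear k C] [∀ g : G, (T.fn g).Linear k] [MonoidalLinear k C] :
    MonoidalLinear k (T.Equivariant H) where
  whiskerLeft_smul _ _ _ _ _ := hom_ext _ _ (MonoidalLinear.whiskerLeft_smul _ _ _)
  smul_whiskerRight _ _ _ _ _ := hom_ext _ _ (MonoidalLinear.smul_whiskerRight _ _ _)

end Equivariant

/-- Restriction is a strict monoidal functor. -/
instance {K H : Subgroup G} (hKH : K ≤ H) : (res (T := T) hKH).Monoidal :=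
  Functor.CoreMonoidal.toMonoidal
    { εIso := Equivariant.isoMk (X := 𝟙_ (T.Equivariant K))
        (Y := (res hKH).obj (𝟙_ (T.Equivariant H))) (Iso.refl (𝟙_ C)) fun _ => map_id_comm _ _
      μIso := fun X Y => Equivariant.isoMk (X := (res hKH).obj X ⊗ (res hKH).obj Y)
        (Y := (res hKH).obj (X ⊗ Y)) (Iso.refl (X.obj ⊗ Y.obj)) fun _ => map_id_comm _ _
      μIso_hom_natural_left := fun f X => by
        apply hom_ext; exact (Category.comp_id _).trans (Category.id_comp _).symm
      μIso_hom_natural_right := fun X f => by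
        apply hom_ext; exact (Category.comp_id _).trans (Category.id_comp _).symm
      associativity := fun X Y Z => by
        apply hom_ext
        change (𝟙 (X.obj ⊗ Y.obj) ▷ Z.obj) ≫ 𝟙 _ ≫ (α_ X.obj Y.obj Z.obj).hom =
          (α_ X.obj Y.obj Z.obj).hom ≫ (X.obj ◁ 𝟙 (Y.obj ⊗ Z.obj)) ≫ 𝟙 _
        simp
      left_unitality := fun X => by
        apply hom_ext
        change (λ_ X.obj).hom = (𝟙 (𝟙_ C) ▷ X.obj) ≫ 𝟙 _ ≫ (λ_ X.obj).hom
        simp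
      right_unitality := fun X => by
        apply hom_ext
        change (ρ_ X.obj).hom = (X.obj ◁ 𝟙 (𝟙_ C)) ≫ 𝟙 _ ≫ (ρ_ X.obj).hom
        simp }

theorem twist_tensor (X Y : T.Equivariant H) (g r s : G) (h : H) (e : g * r = s * h) :
    twist (X ⊗ Y) g r s h e ≫ δ (T.fn s) X.obj Y.obj =
      (T.fn g).map (δ (T.fn r) X.obj Y.obj) ≫ δ (T.fn g) _ _ ≫
        (twist X g r s h e ⊗ₘ twist Y g r s h e) := by
  have h1 := mul_δ (T := T) (g := g) (h := r) rfl X.obj Y.obj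
  have h2 := mul_δ (T := T) e.symm X.obj Y.obj
  have h3 : (T.mul s h (g * r) e.symm).inv.app (X.obj ⊗ Y.obj) ≫
      (T.fn s).map (δ (T.fn h) X.obj Y.obj) ≫ δ (T.fn s) _ _ = δ (T.fn (g * r)) X.obj Y.obj ≫
        ((T.mul s h (g * r) e.symm).inv.app X.obj ⊗ₘ
          (T.mul s h (g * r) e.symm).inv.app Y.obj) := by
    rw [← cancel_epi ((T.mul s h (g * r) e.symm).hom.app (X.obj ⊗ Y.obj)), reassoc_of% h2,
      Iso.hom_inv_id_app_assoc, tensorHom_comp_tensorHom, Iso.hom_inv_id_app,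
      Iso.hom_inv_id_app]
    erw [id_tensorHom_id, Category.comp_id]
  simp only [twist]
  change ((T.mul g r (g * r) rfl).hom.app (X.obj ⊗ Y.obj) ≫
    (T.mul s h (g * r) e.symm).inv.app (X.obj ⊗ Y.obj) ≫
      (T.fn s).map (δ (T.fn h) X.obj Y.obj ≫ (X.μ h ⊗ₘ Y.μ h))) ≫ δ (T.fn s) X.obj Y.obj = _
  simp only [Functor.map_comp, Category.assoc]
  rw [← δ_natural, reassoc_of% h3, reassoc_of% h1, tensorHom_comp_tensorHom,
    tensorHom_comp_tensorHom]

theorem twist_tensorUnit (g r s : G) (h : H) (e : g * r = s * h) :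
    twist (𝟙_ (T.Equivariant H)) g r s h e ≫ η (T.fn s) =
      (T.fn g).map (η (T.fn r)) ≫ η (T.fn g) := by
  have h1 := mul_η (T := T) (g := g) (h := r) rfl
  have h2 := mul_η (T := T) e.symm
  simp only [twist]
  change ((T.mul g r (g * r) rfl).hom.app (𝟙_ C) ≫
    (T.mul s h (g * r) e.symm).inv.app (𝟙_ C) ≫ (T.fn s).map (η (T.fn h))) ≫ η (T.fn s) = _
  simp only [Category.assoc]
  rw [← h2, Iso.inv_hom_id_app_assoc, h1]

/-- Conjugation is a monoidal functor, with the monoidal structure of `T^a`. -/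
instance (a : G) {H H' : Subgroup G} (h : H' = MulAut.conj a • H) :
    (conj (T := T) a h).Monoidal :=
  Functor.CoreMonoidal.toMonoidal
    { εIso := (Equivariant.isoMk (X := (conj a h).obj (𝟙_ (T.Equivariant H)))
        (Y := 𝟙_ (T.Equivariant H')) (εIso (T.fn a)).symm fun g =>
          (twist_tensorUnit _ _ _ _ (by group)).symm).symm
      μIso := fun X Y => (Equivariant.isoMk (X := (conj a h).obj (X ⊗ Y))
        (Y := (conj a h).obj X ⊗ (conj a h).obj Y) (μIso (T.fn a) X.obj Y.obj).symm fun g =>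
          (twist_tensor X Y _ _ _ _ (by group)).symm).symm
      μIso_hom_natural_left := fun f X => by
        apply hom_ext; exact (μ_natural_left (T.fn a) f.hom X.obj)
      μIso_hom_natural_right := fun X f => by
        apply hom_ext; exact (μ_natural_right (T.fn a) X.obj f.hom)
      associativity := fun X Y Z => by
        apply hom_ext; exact (Functor.LaxMonoidal.associativity (T.fn a) X.obj Y.obj Z.obj)
      left_unitality := fun X => by
        apply hom_ext; exact (Functor.LaxMonoidal.left_unitality (T.fn a) X.obj)
      right_unitality := fun X => by
        apply hom_ext; exact (Functor.LaxMonoidal.right_unitality (T.fn a) X.obj) }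

end Monoidal

end Basic

end GroupAction
/-! ### Module categories and module functors -/

section Modules

open Functor.LaxMonoidal Functor.OplaxMonoidal Functor.Monoidal

/-- The left action of a monoidal category `A` on a monoidal category `B` along a monoidal
functor `F : A ⥤ B`: the object `a` sends `b` to `F a ⊗ b`. -/
@[reducible]
def leftActionVia {A : Type u₁} [Category.{v₁} A] [MonoidalCategory A]
    {B : Type u₂} [Category.{v₂} B] [MonoidalCategory B] (F : A ⥤ B) [F.Monoidal] :
    MonoidalLeftAction A B where
  actionObj a b := F.obj a ⊗ b
  actionHomLeft f b := F.map f ▷ b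
  actionHomRight a _ _ f := F.obj a ◁ f
  actionHom f g := F.map f ⊗ₘ g
  actionAssocIso a a' b := whiskerRightIso (μIso F a a').symm b ≪≫ α_ _ _ _
  actionUnitIso b := whiskerRightIso (εIso F).symm b ≪≫ λ_ b
  actionHom_def f g := MonoidalCategory.tensorHom_def _ _
  actionHomRight_id _ _ := by simp
  id_actionHomLeft _ _ := by simp
  actionHom_comp _ _ _ _ := by simp
  actionAssocIso_hom_naturality f g h := by
    simp only [Iso.trans_hom, whiskerRightIso_hom, Iso.symm_hom, μIso_inv, Category.assoc]
    rw [← associator_naturality, ← tensorHom_id, ← tensorHom_id,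
      tensorHom_comp_tensorHom_assoc, tensorHom_comp_tensorHom_assoc, δ_natural]
    simp only [Category.comp_id, Category.id_comp]
  actionUnitIso_hom_naturality f := by
    simp [whisker_exchange_assoc]
  whiskerLeft_actionHomLeft a _ _ f b := by
    rw [Functor.Monoidal.map_whiskerLeft]
    simp only [Iso.trans_hom, Iso.trans_inv, whiskerRightIso_hom, whiskerRightIso_inv, Iso.symm_hom, Iso.symm_inv, μIso_hom, μIso_inv, comp_whiskerRight, whisker_assoc, Category.assoc]
  whiskerRight_actionHomLeft _ f b := by
    rw [Functor.Monoidal.map_whiskerRight]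
    simp only [Iso.trans_hom, Iso.trans_inv, whiskerRightIso_hom, whiskerRightIso_inv, Iso.symm_hom, Iso.symm_inv, μIso_hom, μIso_inv, comp_whiskerRight, Category.assoc, Iso.hom_inv_id_assoc, whiskerRight_tensor]
  associator_actionHom a b c d := by
    have h := congrArg (fun x => x ▷ d) (Functor.OplaxMonoidal.associativity F a b c)
    simp only [comp_whiskerRight] at h
    simp only [Iso.trans_hom, whiskerRightIso_hom, Iso.symm_hom, μIso_inv, Category.assoc,
      whiskerLeft_comp]
    rw [← associator_naturality_middle_assoc, ← reassoc_of% h, pentagon,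
      associator_naturality_left_assoc]
  leftUnitor_actionHom a b := by
    rw [Functor.Monoidal.map_leftUnitor]
    simp only [Iso.trans_hom, whiskerRightIso_hom, Iso.symm_hom, μIso_inv, εIso_inv,
      comp_whiskerRight, Category.assoc, Iso.hom_inv_id_assoc, leftUnitor_whiskerRight, whiskerRight_tensor]
  rightUnitor_actionHom a b := by
    rw [Functor.Monoidal.map_rightUnitor]
    simp only [Iso.trans_hom, whiskerRightIso_hom, Iso.symm_hom, μIso_inv, εIso_inv,
      comp_whiskerRight, whiskerLeft_comp, whisker_assoc, Category.assoc, triangle_assoc_comp_right]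

/-- The right action of a monoidal category `A` on a monoidal category `B` along a monoidal
functor `F : A ⥤ B`: the object `a` sends `b` to `b ⊗ F a`. -/
@[reducible]
def rightActionVia {A : Type u₁} [Category.{v₁} A] [MonoidalCategory A]
    {B : Type u₂} [Category.{v₂} B] [MonoidalCategory B] (F : A ⥤ B) [F.Monoidal] :
    MonoidalRightAction A B where
  actionObj b a := b ⊗ F.obj a
  actionHomRight b _ _ f := b ◁ F.map f
  actionHomLeft f a := f ▷ F.obj a
  actionHom g f := g ⊗ₘ F.map f
  actionAssocIso b a a' := whiskerLeftIso b (μIso F a a').symm ≪≫ (α_ _ _ _).symm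
  actionUnitIso b := whiskerLeftIso b (εIso F).symm ≪≫ ρ_ b
  actionHom_def f g := MonoidalCategory.tensorHom_def _ _
  actionHomRight_id _ _ := by simp
  id_actionHomLeft _ _ := by simp
  actionHom_comp _ _ _ _ := by simp
  actionAssocIso_hom_naturality f g h := by
    simp only [Iso.trans_hom, whiskerLeftIso_hom, Iso.symm_hom, μIso_inv, Category.assoc]
    rw [← associator_inv_naturality, ← id_tensorHom, ← id_tensorHom,
      tensorHom_comp_tensorHom_assoc, tensorHom_comp_tensorHom_assoc, δ_natural]
    simp only [Category.comp_id, Category.id_comp]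
  actionUnitIso_hom_naturality f := by
    simp [← whisker_exchange_assoc]
  whiskerRight_actionHomLeft a _ _ f b := by
    rw [Functor.Monoidal.map_whiskerLeft]
    simp only [Iso.trans_hom, Iso.trans_inv, whiskerLeftIso_hom,
      whiskerLeftIso_inv, Iso.symm_hom, Iso.symm_inv, μIso_hom, μIso_inv, whiskerLeft_comp, Category.assoc, Iso.inv_hom_id_assoc,
      tensor_whiskerLeft]
  actionHomRight_whiskerRight f _ b := by
    rw [Functor.Monoidal.map_whiskerRight]
    simp only [Iso.trans_hom, Iso.trans_inv, whiskerLeftIso_hom,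
      whiskerLeftIso_inv, Iso.symm_hom, Iso.symm_inv, μIso_hom, μIso_inv, whiskerLeft_comp, whisker_assoc, Category.assoc, Iso.inv_hom_id_assoc]
  actionHom_associator a b c d := by
    have h := congrArg (fun x => d ◁ x) (Functor.OplaxMonoidal.associativity F a b c)
    simp only [whiskerLeft_comp] at h
    simp only [Iso.trans_hom, whiskerLeftIso_hom, Iso.symm_hom, μIso_inv, Category.assoc,
      comp_whiskerRight]
    rw [← associator_inv_naturality_right_assoc, ← reassoc_of% h, pentagon_hom_inv_inv_inv_inv,
      associator_inv_naturality_middle_assoc]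
  actionHom_leftUnitor a b := by
    rw [Functor.Monoidal.map_leftUnitor]
    simp only [Iso.trans_hom, whiskerLeftIso_hom,
      Iso.symm_hom, μIso_inv, εIso_inv,
      comp_whiskerRight, whiskerLeft_comp, whisker_assoc, Category.assoc, Iso.inv_hom_id_assoc,
      triangle_assoc_comp_right]
  actionHom_rightUnitor a b := by
    rw [Functor.Monoidal.map_rightUnitor]
    simp only [Iso.trans_hom, whiskerLeftIso_hom,
      Iso.symm_hom, μIso_inv, εIso_inv,
      whiskerLeft_comp, Category.assoc, Iso.inv_hom_id_assoc,
      tensor_whiskerLeft, whiskerLeft_rightUnitor]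

end Modules

section ModuleFunctors

open scoped MonoidalLeftAction

variable {S : Type u₁} [Category.{v₁} S] [MonoidalCategory S]
  {M : Type u₂} [Category.{v₂} M] [MonoidalLeftAction S M]
  {N : Type u₃} [Category.{v₃} N] [MonoidalLeftAction S N]

variable (S) in
/-- A family of morphisms `F (s ⊠ m) ⟶ s ⊠ F m`, as in the structure of a module functor. -/
abbrev Lineator (F : M ⥤ N) :=
  ∀ (s : S) (m : M), F.obj (s ⊙ₗ m) ⟶ s ⊙ₗ F.obj m

/-- The isomorphisms `F (s ⊠ m) ⟶ s ⊠ F m` of a module functor `F`. -/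
def lineator {F : M ⥤ N} (ℓ : F.LeftLinear S) : Lineator S F := fun s m =>
  ℓ.toOplaxLeftLinear.δₗ s m

/-- The identity functor as a module functor. -/
def Lineator.id : Lineator S (𝟭 M) := fun _ _ => 𝟙 _

/-- The composite of two module functors as a module functor. -/
def Lineator.comp {P : Type*} [Category P] [MonoidalLeftAction S P] {F : M ⥤ N} {F' : N ⥤ P}
    (δ : Lineator S F) (δ' : Lineator S F') : Lineator S (F ⋙ F') := fun s m =>
  F'.map (δ s m) ≫ δ' s (F.obj m)

/-- A natural transformation is a morphism of module functors. -/
def IsModuleHom {F F' : M ⥤ N} (δ : Lineator S F) (δ' : Lineator S F') (τ : F ⟶ F') : Prop :=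
  ∀ (s : S) (m : M), τ.app (s ⊙ₗ m) ≫ δ' s m = δ s m ≫ s ⊴ₗ τ.app m

end ModuleFunctors

/-- A decomposition `F ≅ ⨁ i, F' i` of a functor into a finite direct sum of functors, given by
the projections and the inclusions. -/
structure DirectSumDecomposition {M : Type u₁} [Category.{v₁} M] {N : Type u₂} [Category.{v₂} N]
    [Preadditive N] {ι : Type*} [Fintype ι] (F : M ⥤ N) (F' : ι → (M ⥤ N)) where
  /-- the projections -/
  proj : ∀ i, F ⟶ F' i
  /-- the inclusions -/
  incl : ∀ i, F' i ⟶ F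
  incl_proj : ∀ i, incl i ≫ proj i = 𝟙 (F' i)
  incl_proj_ne : ∀ i j, i ≠ j → ∀ X : M, (incl i).app X ≫ (proj j).app X = 0
  total : ∀ X : M, ∑ i, (proj i).app X ≫ (incl i).app X = 𝟙 (F.obj X)

/-- The isomorphism `I_K^H (R_K^H m ⊗ v) ⟶ m ⊗ I_K^H v` of the left `M H`-module functor
`I_K^H`. -/
def leftProjection {A : Type u₁} [Category.{v₁} A] [MonoidalCategory A] {B : Type u₂}
    [Category.{v₂} B] [MonoidalCategory B] {R : A ⥤ B} [R.Monoidal] {I : B ⥤ A}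
    (ℓ : letI := leftActionVia R
      letI := MonoidalCategory.selfLeftAction A
      I.LeftLinear A) (m : A) (v : B) : I.obj (R.obj m ⊗ v) ⟶ m ⊗ I.obj v :=
  letI := leftActionVia R
  letI := MonoidalCategory.selfLeftAction A
  lineator ℓ m v

/-- The isomorphism `I_K^H (v ⊗ R_K^H m) ⟶ I_K^H v ⊗ m` of the right `M H`-module functor
`I_K^H`. -/
def rightProjection {A : Type u₁} [Category.{v₁} A] [MonoidalCategory A] {B : Type u₂}
    [Category.{v₂} B] [MonoidalCategory B] {R : A ⥤ B} [R.Monoidal] {I : B ⥤ A}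
    (ℓ : letI := rightActionVia R
      letI := MonoidalCategory.selRightfAction A
      I.RightLinear A) (m : A) (v : B) : I.obj (v ⊗ R.obj m) ⟶ I.obj v ⊗ m :=
  letI := rightActionVia R
  letI := MonoidalCategory.selRightfAction A
  ℓ.toOplaxRightLinear.δᵣ v m

/-- The isomorphism `F (R m ⊗ v) ⟶ R' m ⊗ F v` of an `A`-module functor `F` between categories on
which `A` acts along the monoidal functors `R` and `R'`. -/
def lineatorVia {A : Type u₁} [Category.{v₁} A] [MonoidalCategory A] {B : Type u₂}
    [Category.{v₂} B] [MonoidalCategory B] {B' : Type u₃} [Category.{v₃} B'] [MonoidalCategory B']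
    {R : A ⥤ B} [R.Monoidal] {R' : A ⥤ B'} [R'.Monoidal] {F : B ⥤ B'}
    (ℓ : letI := leftActionVia R
      letI := leftActionVia R'
      F.LeftLinear A) (m : A) (v : B) : F.obj (R.obj m ⊗ v) ⟶ R'.obj m ⊗ F.obj v :=
  letI := leftActionVia R
  letI := leftActionVia R'
  lineator ℓ m v

/-! ### Categorical Mackey functors -/

section Mackey

open scoped MonoidalLeftAction MonoidalRightAction

variable {G : Type t} [Group G]

/-- `X` is a system of representatives of the double cosets `L x K` contained in `H`. -/
def IsDoubleCosetReps (L K H : Subgroup G) (X : Finset G) : Prop :=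
  (∀ x ∈ X, x ∈ H) ∧ ∀ g ∈ H, ∃! x, x ∈ X ∧ ∃ l ∈ L, ∃ y ∈ K, g = l * x * y

variable {M : Subgroup G → Type u} [∀ H, Category.{v} (M H)]

variable (M) in
/-- The functors underlying a categorical Mackey functor `H ↦ M H`: induction, restriction and
conjugation. The conjugation functor `c_{H,a} : M H ⥤ M (aHa⁻¹)` is `conj a h`, where
`h : H' = aHa⁻¹` (so that no transport along equalities of subgroups is needed). -/
structure MackeyData where
  /-- the induction functors `I_K^H` -/
  ind : ∀ {K H : Subgroup G}, K ≤ H → (M K ⥤ M H)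
  /-- the restriction functors `R_K^H` -/
  res : ∀ {K H : Subgroup G}, K ≤ H → (M H ⥤ M K)
  /-- the conjugation functors `c_{H,a}` -/
  conj : ∀ (a : G) {H H' : Subgroup G}, H' = MulAut.conj a • H → (M H ⥤ M H')

/-- The natural isomorphisms of a categorical Mackey functor, with their coherence conditions. -/
structure MackeyIsos [∀ H, Preadditive (M H)] (D : MackeyData M) where
  /-- `I_H^H ≅ id` -/
  indId : ∀ H : Subgroup G, D.ind (le_refl H) ≅ 𝟭 (M H)
  /-- `R_H^H ≅ id` -/
  resId : ∀ H : Subgroup G, D.res (le_refl H) ≅ 𝟭 (M H)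
  /-- `c_{H,a} ≅ id` for `a ∈ H` -/
  conjId : ∀ {H : Subgroup G} (a : G), a ∈ H → ∀ h : H = MulAut.conj a • H,
    D.conj a h ≅ 𝟭 (M H)
  /-- `R_J^H ≅ R_J^K R_K^H` -/
  resComp : ∀ {J K H : Subgroup G} (hJK : J ≤ K) (hKH : K ≤ H),
    D.res (hJK.trans hKH) ≅ D.res hKH ⋙ D.res hJK
  /-- `I_J^H ≅ I_K^H I_J^K` -/
  indComp : ∀ {J K H : Subgroup G} (hJK : J ≤ K) (hKH : K ≤ H),
    D.ind (hJK.trans hKH) ≅ D.ind hJK ⋙ D.ind hKH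
  /-- `c_{H,ab} ≅ c_{bHb⁻¹,a} c_{H,b}`; here `c = ab`, `H' = bHb⁻¹` and `H'' = aH'a⁻¹` -/
  conjComp : ∀ (a b c : G), a * b = c → ∀ {H H' H'' : Subgroup G} (hb : H' = MulAut.conj b • H)
    (ha : H'' = MulAut.conj a • H') (hc : H'' = MulAut.conj c • H),
    D.conj c hc ≅ D.conj b hb ⋙ D.conj a ha
  /-- `c_{H,a} I_K^H ≅ I_{K'}^{H'} c_{K,a}`, where `K' = aKa⁻¹` and `H' = aHa⁻¹` -/
  conjInd : ∀ (a : G) {K H K' H' : Subgroup G} (h : K ≤ H) (h' : K' ≤ H')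
    (hK : K' = MulAut.conj a • K) (hH : H' = MulAut.conj a • H),
    D.ind h ⋙ D.conj a hH ≅ D.conj a hK ⋙ D.ind h'
  /-- `c_{K,a} R_K^H ≅ R_{K'}^{H'} c_{H,a}`, where `K' = aKa⁻¹` and `H' = aHa⁻¹` -/
  conjRes : ∀ (a : G) {K H K' H' : Subgroup G} (h : K ≤ H) (h' : K' ≤ H')
    (hK : K' = MulAut.conj a • K) (hH : H' = MulAut.conj a • H),
    D.res h ⋙ D.conj a hK ≅ D.conj a hH ⋙ D.res h'
  /-- the Mackey decomposition
  `R_L^H I_K^H ≅ ⨁_x I_{xKx⁻¹ ⊓ L}^L R_{xKx⁻¹ ⊓ L}^{xKx⁻¹} c_{K,x}` -/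
  mackey : ∀ {L K H : Subgroup G} (hL : L ≤ H) (hK : K ≤ H) (X : Finset G),
    IsDoubleCosetReps L K H X →
    DirectSumDecomposition (D.ind hK ⋙ D.res hL) fun x : X =>
      D.conj x.1 (rfl : MulAut.conj x.1 • K = MulAut.conj x.1 • K) ⋙
        D.res (inf_le_left : MulAut.conj x.1 • K ⊓ L ≤ MulAut.conj x.1 • K) ⋙
          D.ind (inf_le_right : MulAut.conj x.1 • K ⊓ L ≤ L)
  indComp_right_id : ∀ {L H : Subgroup G} (h : L ≤ H) (X : M L),
    (indComp h (le_refl H)).hom.app X ≫ (indId H).hom.app ((D.ind h).obj X) = 𝟙 _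
  indComp_left_id : ∀ {L H : Subgroup G} (h : L ≤ H) (X : M L),
    (indComp (le_refl L) h).hom.app X ≫ (D.ind h).map ((indId L).hom.app X) = 𝟙 _
  resComp_right_id : ∀ {L H : Subgroup G} (h : L ≤ H) (X : M H),
    (resComp h (le_refl H)).hom.app X ≫ (D.res h).map ((resId H).hom.app X) = 𝟙 _
  resComp_left_id : ∀ {L H : Subgroup G} (h : L ≤ H) (X : M H),
    (resComp (le_refl L) h).hom.app X ≫ (resId L).hom.app ((D.res h).obj X) = 𝟙 _
  conjComp_right_id : ∀ (a : G) {H H' : Subgroup G} (h₁ : H = MulAut.conj (1 : G) • H)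
    (h : H' = MulAut.conj a • H) (X : M H),
    (conjComp a 1 a (mul_one a) h₁ h h).hom.app X ≫
      (D.conj a h).map ((conjId 1 H.one_mem h₁).hom.app X) = 𝟙 _
  conjComp_left_id : ∀ (a : G) {H H' : Subgroup G} (h : H' = MulAut.conj a • H)
    (h₁ : H' = MulAut.conj (1 : G) • H') (X : M H),
    (conjComp 1 a a (one_mul a) h h₁ h).hom.app X ≫
      (conjId 1 H'.one_mem h₁).hom.app ((D.conj a h).obj X) = 𝟙 _
  /-- coherence of the isomorphisms `R_J^H ≅ R_J^K R_K^H` -/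
  diagram_R : ∀ {J K L H : Subgroup G} (hJK : J ≤ K) (hKL : K ≤ L) (hLH : L ≤ H) (X : M H),
    (resComp (hJK.trans hKL) hLH).hom.app X ≫ (resComp hJK hKL).hom.app ((D.res hLH).obj X) =
      (resComp hJK (hKL.trans hLH)).hom.app X ≫ (D.res hJK).map ((resComp hKL hLH).hom.app X)
  /-- coherence of the isomorphisms `I_J^H ≅ I_K^H I_J^K` -/
  diagram_I : ∀ {J K L H : Subgroup G} (hJK : J ≤ K) (hKL : K ≤ L) (hLH : L ≤ H) (X : M J),
    (indComp (hJK.trans hKL) hLH).hom.app X ≫ (D.ind hLH).map ((indComp hJK hKL).hom.app X) =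
      (indComp hJK (hKL.trans hLH)).hom.app X ≫ (indComp hKL hLH).hom.app ((D.ind hJK).obj X)
  /-- coherence of the isomorphisms `c_{H,ab} ≅ c_{bHb⁻¹,a} c_{H,b}` -/
  diagram_C : ∀ (a b c ab bc abc : G) (e₁ : a * b = ab) (e₂ : b * c = bc) (e₃ : ab * c = abc)
    (e₄ : a * bc = abc) {H H₁ H₂ H₃ : Subgroup G} (hc : H₁ = MulAut.conj c • H)
    (hb : H₂ = MulAut.conj b • H₁) (ha : H₃ = MulAut.conj a • H₂)
    (hab : H₃ = MulAut.conj ab • H₁) (hbc : H₂ = MulAut.conj bc • H)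
    (habc : H₃ = MulAut.conj abc • H) (X : M H),
    (conjComp ab c abc e₃ hc hab habc).hom.app X ≫
        (conjComp a b ab e₁ hb ha hab).hom.app ((D.conj c hc).obj X) =
      (conjComp a bc abc e₄ hbc ha habc).hom.app X ≫
        (D.conj a ha).map ((conjComp b c bc e₂ hc hb hbc).hom.app X)
  /-- compatibility of conjugation with iterated restriction -/
  diagram_RRC : ∀ (a : G) {K L H K' L' H' : Subgroup G} (hKL : K ≤ L) (hLH : L ≤ H)
    (hKL' : K' ≤ L') (hLH' : L' ≤ H') (hK : K' = MulAut.conj a • K)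
    (hL : L' = MulAut.conj a • L) (hH : H' = MulAut.conj a • H) (X : M H),
    (D.conj a hK).map ((resComp hKL hLH).hom.app X) ≫
        (conjRes a hKL hKL' hK hL).hom.app ((D.res hLH).obj X) ≫
          (D.res hKL').map ((conjRes a hLH hLH' hL hH).hom.app X) =
      (conjRes a (hKL.trans hLH) (hKL'.trans hLH') hK hH).hom.app X ≫
        (resComp hKL' hLH').hom.app ((D.conj a hH).obj X)
  /-- compatibility of restriction with iterated conjugation -/
  diagram_RCC : ∀ (a b ab : G) (e : a * b = ab) {L H L₁ H₁ L₂ H₂ : Subgroup G} (h : L ≤ H)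
    (h₁ : L₁ ≤ H₁) (h₂ : L₂ ≤ H₂) (hL₁ : L₁ = MulAut.conj b • L) (hH₁ : H₁ = MulAut.conj b • H)
    (hL₂ : L₂ = MulAut.conj a • L₁) (hH₂ : H₂ = MulAut.conj a • H₁)
    (hL : L₂ = MulAut.conj ab • L) (hH : H₂ = MulAut.conj ab • H) (X : M H),
    (conjRes ab h h₂ hL hH).hom.app X ≫
        (D.res h₂).map ((conjComp a b ab e hH₁ hH₂ hH).hom.app X) =
      (conjComp a b ab e hL₁ hL₂ hL).hom.app ((D.res h).obj X) ≫
        (D.conj a hL₂).map ((conjRes b h h₁ hL₁ hH₁).hom.app X) ≫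
          (conjRes a h₁ h₂ hL₂ hH₂).hom.app ((D.conj b hH₁).obj X)
  /-- compatibility of conjugation with iterated induction -/
  diagram_IIC : ∀ (a : G) {K L H K' L' H' : Subgroup G} (hKL : K ≤ L) (hLH : L ≤ H)
    (hKL' : K' ≤ L') (hLH' : L' ≤ H') (hK : K' = MulAut.conj a • K)
    (hL : L' = MulAut.conj a • L) (hH : H' = MulAut.conj a • H) (X : M K),
    (D.conj a hH).map ((indComp hKL hLH).hom.app X) ≫
        (conjInd a hLH hLH' hL hH).hom.app ((D.ind hKL).obj X) ≫
          (D.ind hLH').map ((conjInd a hKL hKL' hK hL).hom.app X) =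
      (conjInd a (hKL.trans hLH) (hKL'.trans hLH') hK hH).hom.app X ≫
        (indComp hKL' hLH').hom.app ((D.conj a hK).obj X)
  /-- compatibility of induction with iterated conjugation -/
  diagram_ICC : ∀ (a b ab : G) (e : a * b = ab) {L H L₁ H₁ L₂ H₂ : Subgroup G} (h : L ≤ H)
    (h₁ : L₁ ≤ H₁) (h₂ : L₂ ≤ H₂) (hL₁ : L₁ = MulAut.conj b • L) (hH₁ : H₁ = MulAut.conj b • H)
    (hL₂ : L₂ = MulAut.conj a • L₁) (hH₂ : H₂ = MulAut.conj a • H₁)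
    (hL : L₂ = MulAut.conj ab • L) (hH : H₂ = MulAut.conj ab • H) (X : M L),
    (conjInd ab h h₂ hL hH).hom.app X ≫
        (D.ind h₂).map ((conjComp a b ab e hL₁ hL₂ hL).hom.app X) =
      (conjComp a b ab e hH₁ hH₂ hH).hom.app ((D.ind h).obj X) ≫
        (D.conj a hH₂).map ((conjInd b h h₁ hL₁ hH₁).hom.app X) ≫
          (conjInd a h₁ h₂ hL₂ hH₂).hom.app ((D.conj b hL₁).obj X)

/-- Structures of `S`-module functors on induction, restriction and conjugation for which all the
natural isomorphisms are isomorphisms of `S`-module functors. -/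
structure MackeyModule [∀ H, Preadditive (M H)] (S : Type u₁) [Category.{v₁} S]
    [MonoidalCategory S] [∀ H, MonoidalLeftAction S (M H)] {D : MackeyData M}
    (φ : MackeyIsos D) where
  ind : ∀ {K H : Subgroup G} (h : K ≤ H), (D.ind h).LeftLinear S
  res : ∀ {K H : Subgroup G} (h : K ≤ H), (D.res h).LeftLinear S
  conj : ∀ (a : G) {H H' : Subgroup G} (h : H' = MulAut.conj a • H), (D.conj a h).LeftLinear S
  indId : ∀ H : Subgroup G,
    IsModuleHom (lineator (ind (le_refl H))) Lineator.id (φ.indId H).hom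
  resId : ∀ H : Subgroup G,
    IsModuleHom (lineator (res (le_refl H))) Lineator.id (φ.resId H).hom
  conjId : ∀ {H : Subgroup G} (a : G) (ha : a ∈ H) (h : H = MulAut.conj a • H),
    IsModuleHom (lineator (conj a h)) Lineator.id (φ.conjId a ha h).hom
  resComp : ∀ {J K H : Subgroup G} (hJK : J ≤ K) (hKH : K ≤ H),
    IsModuleHom (lineator (res (hJK.trans hKH)))
      ((lineator (res hKH)).comp (lineator (res hJK))) (φ.resComp hJK hKH).hom
  indComp : ∀ {J K H : Subgroup G} (hJK : J ≤ K) (hKH : K ≤ H),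
    IsModuleHom (lineator (ind (hJK.trans hKH)))
      ((lineator (ind hJK)).comp (lineator (ind hKH))) (φ.indComp hJK hKH).hom
  conjComp : ∀ (a b c : G) (e : a * b = c) {H H' H'' : Subgroup G}
    (hb : H' = MulAut.conj b • H) (ha : H'' = MulAut.conj a • H') (hc : H'' = MulAut.conj c • H),
    IsModuleHom (lineator (conj c hc)) ((lineator (conj b hb)).comp (lineator (conj a ha)))
      (φ.conjComp a b c e hb ha hc).hom
  conjInd : ∀ (a : G) {K H K' H' : Subgroup G} (h : K ≤ H) (h' : K' ≤ H')
    (hK : K' = MulAut.conj a • K) (hH : H' = MulAut.conj a • H),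
    IsModuleHom ((lineator (ind h)).comp (lineator (conj a hH)))
      ((lineator (conj a hK)).comp (lineator (ind h'))) (φ.conjInd a h h' hK hH).hom
  conjRes : ∀ (a : G) {K H K' H' : Subgroup G} (h : K ≤ H) (h' : K' ≤ H')
    (hK : K' = MulAut.conj a • K) (hH : H' = MulAut.conj a • H),
    IsModuleHom ((lineator (res h)).comp (lineator (conj a hK)))
      ((lineator (conj a hH)).comp (lineator (res h'))) (φ.conjRes a h h' hK hH).hom
  mackey_proj : ∀ {L K H : Subgroup G} (hL : L ≤ H) (hK : K ≤ H) (X : Finset G)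
    (hX : IsDoubleCosetReps L K H X) (x : X),
    IsModuleHom ((lineator (ind hK)).comp (lineator (res hL)))
      ((lineator (conj x.1 rfl)).comp ((lineator (res inf_le_left)).comp
        (lineator (ind inf_le_right)))) ((φ.mackey hL hK X hX).proj x)
  mackey_incl : ∀ {L K H : Subgroup G} (hL : L ≤ H) (hK : K ≤ H) (X : Finset G)
    (hX : IsDoubleCosetReps L K H X) (x : X),
    IsModuleHom ((lineator (conj x.1 rfl)).comp ((lineator (res inf_le_left)).comp
        (lineator (ind inf_le_right))))
      ((lineator (ind hK)).comp (lineator (res hL))) ((φ.mackey hL hK X hX).incl x)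

/-- A categorical Mackey functor over the `k`-linear monoidal category `S`, with the underlying
`S`-module categories `M H` and the underlying functors `D`. -/
structure CategoricalMackeyFunctor (k : Type w) [CommRing k] (S : Type u₁) [Category.{v₁} S]
    [MonoidalCategory S] [Preadditive S] [Linear k S] [∀ H, Preadditive (M H)]
    [∀ H, Linear k (M H)] [∀ H, MonoidalLeftAction S (M H)] (D : MackeyData M) where
  /-- every `M H` is an abelian category -/
  abelian : ∀ H : Subgroup G, ∃ A : Abelian (M H), A.toPreadditive = (inferInstance : Preadditive (M H))
  /-- the actions of `S` are `k`-bilinear -/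
  action_add_left : ∀ {H : Subgroup G} {s s' : S} (f g : s ⟶ s') (m : M H),
    (f + g) ⊵ₗ m = f ⊵ₗ m + g ⊵ₗ m
  action_smul_left : ∀ {H : Subgroup G} {s s' : S} (r : k) (f : s ⟶ s') (m : M H),
    (r • f) ⊵ₗ m = r • (f ⊵ₗ m)
  action_add_right : ∀ {H : Subgroup G} (s : S) {m m' : M H} (f g : m ⟶ m'),
    s ⊴ₗ (f + g) = s ⊴ₗ f + s ⊴ₗ g
  action_smul_right : ∀ {H : Subgroup G} (s : S) {m m' : M H} (r : k) (f : m ⟶ m'),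
    s ⊴ₗ (r • f) = r • (s ⊴ₗ f)
  ind_additive : ∀ {K H : Subgroup G} (h : K ≤ H), (D.ind h).Additive
  res_additive : ∀ {K H : Subgroup G} (h : K ≤ H), (D.res h).Additive
  conj_additive : ∀ (a : G) {H H' : Subgroup G} (h : H' = MulAut.conj a • H),
    (D.conj a h).Additive
  ind_linear : ∀ {K H : Subgroup G} (h : K ≤ H), (D.ind h).Linear k
  res_linear : ∀ {K H : Subgroup G} (h : K ≤ H), (D.res h).Linear k
  conj_linear : ∀ (a : G) {H H' : Subgroup G} (h : H' = MulAut.conj a • H),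
    (D.conj a h).Linear k
  /-- the natural isomorphisms and their coherence -/
  isos : MackeyIsos D
  /-- the structures of `S`-module functors -/
  modules : MackeyModule S isos

/-- The left actions of the monoidal category `M ⊤` on the categories `M H` along `R_H^⊤`: the
object `m` sends `v` to `R_H^⊤ m ⊗ v`. -/
@[reducible]
def MackeyData.topAction [∀ H, MonoidalCategory (M H)] (D : MackeyData M)
    [∀ {K H : Subgroup G} (h : K ≤ H), (D.res h).Monoidal] (H : Subgroup G) :
    MonoidalLeftAction (M ⊤) (M H) :=
  leftActionVia (D.res (le_top : H ≤ ⊤))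

/-- A categorical Green functor over the `k`-linear monoidal category `S`: a categorical Mackey
functor such that the categories `M H` are monoidal, the restriction and conjugation functors are
monoidal functors, `I_K^H` is a left and a right `M H`-module functor, where `M H` acts on `M K`
along `R_K^H`, and the natural isomorphisms are compatible with these structures. -/
structure CategoricalGreenFunctor (k : Type w) [CommRing k] (S : Type u₁) [Category.{v₁} S]
    [MonoidalCategory S] [Preadditive S] [Linear k S] [∀ H, Preadditive (M H)]
    [∀ H, Linear k (M H)] [∀ H, MonoidalLeftAction S (M H)]
    [∀ H, MonoidalCategory (M H)] [∀ H, MonoidalPreadditive (M H)]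
    [∀ H, MonoidalLinear k (M H)] (D : MackeyData M)
    [∀ {K H : Subgroup G} (h : K ≤ H), (D.res h).Monoidal]
    [∀ (a : G) {H H' : Subgroup G} (h : H' = MulAut.conj a • H), (D.conj a h).Monoidal]
    extends CategoricalMackeyFunctor k S D where
  /-- `I_K^H` is a left `M H`-module functor -/
  indLeft : ∀ {K H : Subgroup G} (h : K ≤ H),
    letI := leftActionVia (D.res h)
    letI := MonoidalCategory.selfLeftAction (M H)
    (D.ind h).LeftLinear (M H)
  /-- `I_K^H` is a right `M H`-module functor -/
  indRight : ∀ {K H : Subgroup G} (h : K ≤ H),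
    letI := rightActionVia (D.res h)
    letI := MonoidalCategory.selRightfAction (M H)
    (D.ind h).RightLinear (M H)
  resComp_monoidal : ∀ {J K H : Subgroup G} (hJK : J ≤ K) (hKH : K ≤ H),
    NatTrans.IsMonoidal (isos.resComp hJK hKH).hom
  conjComp_monoidal : ∀ (a b c : G) (e : a * b = c) {H H' H'' : Subgroup G}
    (hb : H' = MulAut.conj b • H) (ha : H'' = MulAut.conj a • H') (hc : H'' = MulAut.conj c • H),
    NatTrans.IsMonoidal (isos.conjComp a b c e hb ha hc).hom
  /-- the isomorphism `I_J^H ≅ I_K^H I_J^K` is a morphism of left `M H`-module functors, where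
  `M H` acts on `M J` along `R_J^H ≅ R_J^K R_K^H` -/
  indComp_left : ∀ {J K H : Subgroup G} (hJK : J ≤ K) (hKH : K ≤ H) (m : M H) (v : M J),
    leftProjection (indLeft (hJK.trans hKH)) m v ≫ m ◁ (isos.indComp hJK hKH).hom.app v =
      (isos.indComp hJK hKH).hom.app ((D.res (hJK.trans hKH)).obj m ⊗ v) ≫
        (D.ind hKH).map ((D.ind hJK).map ((isos.resComp hJK hKH).hom.app m ▷ v) ≫
          leftProjection (indLeft hJK) ((D.res hKH).obj m) v) ≫
            leftProjection (indLeft hKH) m ((D.ind hJK).obj v)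
  /-- the isomorphism `I_J^H ≅ I_K^H I_J^K` is a morphism of right `M H`-module functors -/
  indComp_right : ∀ {J K H : Subgroup G} (hJK : J ≤ K) (hKH : K ≤ H) (m : M H) (v : M J),
    rightProjection (indRight (hJK.trans hKH)) m v ≫ (isos.indComp hJK hKH).hom.app v ▷ m =
      (isos.indComp hJK hKH).hom.app (v ⊗ (D.res (hJK.trans hKH)).obj m) ≫
        (D.ind hKH).map ((D.ind hJK).map (v ◁ (isos.resComp hJK hKH).hom.app m) ≫
          rightProjection (indRight hJK) ((D.res hKH).obj m) v) ≫
            rightProjection (indRight hKH) m ((D.ind hJK).obj v)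
  /-- all the natural isomorphisms are isomorphisms of `M ⊤`-module functors, where `M ⊤` acts on
  `M H` along `R_H^⊤` -/
  top : letI := D.topAction
    MackeyModule (M ⊤) isos
  /-- the structure of an `M ⊤`-module functor on `R_K^H` is
  `R_K^H (R_H^⊤ m ⊗ v) ⟶ R_K^H R_H^⊤ m ⊗ R_K^H v ⟶ R_K^⊤ m ⊗ R_K^H v` -/
  top_res : ∀ {K H : Subgroup G} (h : K ≤ H) (m : M ⊤) (v : M H),
    letI := D.topAction
    lineatorVia (top.res h) m v =
      Functor.OplaxMonoidal.δ (D.res h) ((D.res le_top).obj m) v ≫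
        (isos.resComp h le_top).inv.app m ▷ (D.res h).obj v
  /-- the structure of an `M ⊤`-module functor on `I_K^H` is
  `I_K^H (R_K^⊤ m ⊗ v) ⟶ I_K^H (R_K^H R_H^⊤ m ⊗ v) ⟶ R_H^⊤ m ⊗ I_K^H v` -/
  top_ind : ∀ {K H : Subgroup G} (h : K ≤ H) (m : M ⊤) (v : M K),
    letI := D.topAction
    lineatorVia (top.ind h) m v =
      (D.ind h).map ((isos.resComp h le_top).hom.app m ▷ v) ≫
        leftProjection (indLeft h) ((D.res le_top).obj m) v
  /-- the structure of an `M ⊤`-module functor on `c_{H,a}` is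
  `c_{H,a} (R_H^⊤ m ⊗ v) ⟶ c_{H,a} R_H^⊤ m ⊗ c_{H,a} v ⟶ R_{H'}^⊤ c_{⊤,a} m ⊗ c_{H,a} v ⟶
  R_{H'}^⊤ m ⊗ c_{H,a} v`, where `H' = aHa⁻¹` and the last morphism comes from `c_{⊤,a} ≅ id` -/
  top_conj : ∀ (a : G) {H H' : Subgroup G} (h : H' = MulAut.conj a • H)
    (h' : (⊤ : Subgroup G) = MulAut.conj a • ⊤) (m : M ⊤) (v : M H),
    letI := D.topAction
    lineatorVia (top.conj a h) m v =
      Functor.OplaxMonoidal.δ (D.conj a h) ((D.res le_top).obj m) v ≫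
        ((isos.conjRes a le_top le_top h h').hom.app m ≫
          (D.res le_top).map ((isos.conjId a (Subgroup.mem_top a) h').hom.app m)) ▷
            (D.conj a h).obj v

end Mackey

/-! ### The categorical Mackey functor of a group action -/

/-- The property of being a finitely generated free module. -/
def finiteFree (k : Type w) [CommRing k] : ObjectProperty (ModuleCat.{w} k) :=
  fun V => Module.Finite k V ∧ Module.Free k V

instance (k : Type w) [CommRing k] : (finiteFree k).IsMonoidal where
  prop_unit := ⟨inferInstanceAs (Module.Finite k k), inferInstanceAs (Module.Free k k)⟩
  prop_tensor V W hV hW := by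
    have := hV.1
    have := hV.2
    have := hW.1
    have := hW.2
    exact ⟨inferInstanceAs (Module.Finite k (TensorProduct k V W)),
      inferInstanceAs (Module.Free k (TensorProduct k V W))⟩

/-- The `k`-linear monoidal category of finitely generated free `k`-modules; if `k` is a field,
these are the finite-dimensional vector spaces. -/
abbrev Vec (k : Type w) [CommRing k] := (finiteFree k).FullSubcategory

namespace GroupAction

variable {G : Type t} [Group G] [Finite G] {C : Type u} [Category.{v} C] [Preadditive C]
  [HasFiniteBiproducts C] (T : GroupAction G C)

/-- The induction, restriction and conjugation functors between the categories `C^H`, where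
induction is formed with the representatives `σ` of the left cosets. -/
def mackeyData (σ : ∀ {L H : Subgroup G}, L ≤ H → CosetReps L H) :
    MackeyData (fun H : Subgroup G => T.Equivariant H) where
  ind h := ind (σ h)
  res h := res h
  conj a _ _ h := conj a h

variable {T} {σ : ∀ {L H : Subgroup G}, L ≤ H → CosetReps L H}

instance [MonoidalCategory C] [T.MonoidalAction] {K H : Subgroup G} (h : K ≤ H) :
    ((T.mackeyData σ).res h).Monoidal :=
  inferInstanceAs (res (T := T) h).Monoidal

instance [MonoidalCategory C] [T.MonoidalAction] (a : G) {H H' : Subgroup G}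
    (h : H' = MulAut.conj a • H) : ((T.mackeyData σ).conj a h).Monoidal :=
  inferInstanceAs (conj (T := T) a h).Monoidal

/-- The natural isomorphisms which do not involve induction from a proper subgroup are the
evident ones. -/
structure IsCanonical (φ : MackeyIsos (T.mackeyData σ)) : Prop where
  /-- `R_H^H = id` -/
  resId : ∀ (H : Subgroup G) (X : T.Equivariant H),
    ((φ.resId H).hom.app X).hom = 𝟙 X.obj
  /-- `R_J^H = R_J^K R_K^H` -/
  resComp : ∀ {J K H : Subgroup G} (hJK : J ≤ K) (hKH : K ≤ H) (X : T.Equivariant H),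
    ((φ.resComp hJK hKH).hom.app X).hom = 𝟙 X.obj
  /-- `c_{K,a} R_K^H = R_{K'}^{H'} c_{H,a}` -/
  conjRes : ∀ (a : G) {K H K' H' : Subgroup G} (h : K ≤ H) (h' : K' ≤ H')
    (hK : K' = MulAut.conj a • K) (hH : H' = MulAut.conj a • H) (X : T.Equivariant H),
    ((φ.conjRes a h h' hK hH).hom.app X).hom = 𝟙 ((T.fn a).obj X.obj)
  /-- `c_{H,ab} ≅ c_{bHb⁻¹,a} c_{H,b}` is given by the inverse of `T₂^{a,b}` -/
  conjComp : ∀ (a b c : G) (e : a * b = c) {H H' H'' : Subgroup G} (hb : H' = MulAut.conj b • H)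
    (ha : H'' = MulAut.conj a • H') (hc : H'' = MulAut.conj c • H) (X : T.Equivariant H),
    ((φ.conjComp a b c e hb ha hc).hom.app X).hom = (T.mul a b c e).inv.app X.obj
  /-- `c_{H,a} ≅ id` is given by `μ^a` for `a ∈ H` -/
  conjId : ∀ {H : Subgroup G} (a : G) (ha : a ∈ H) (h : H = MulAut.conj a • H)
    (X : T.Equivariant H), ((φ.conjId a ha h).hom.app X).hom = X.μ ⟨a, ha⟩
  /-- `I_H^H ≅ id` is given by `μ^t`, where `t` is the chosen representative of the only coset -/
  indId : ∀ (H : Subgroup G) (X : T.Equivariant H),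
    ((φ.indId H).hom.app X).hom = biproduct.desc fun q => X.μ ((σ (le_refl H)).rep q)

end GroupAction

end

attribute [local instance] Abelian.hasFiniteBiproducts

/-!
The proof rests on two universal properties, which reduce all coherence conditions to short
computations with the group action.

**The action of free modules.** A finitely generated free module `V` acts on a `k`-linear category
with finite biproducts by the copower `V ⊙ M`, which represents `N ↦ Hom_k(V, Hom(M, N))`
(`vecAction`, `copowerDesc`, `copower_hom_ext`). A `k`-linear functor preserves direct sums, hence
copowers, and so is a module functor in a canonical way. By the universal property every natural
transformation of such functors is a morphism of module functors (`IsVecLineator.isModuleHom`). The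
first half of the theorem therefore consists in the construction of the natural isomorphisms and in
their coherence. That the category `C^H` is abelian is seen by giving kernels, cokernels and finite
biproducts in `C` their unique compatible equivariant structure (`Equivariant.abelian`).

**Frobenius reciprocity.** Up to the isomorphism `T^t X ≅ X`, the summand of `I_L^H X` indexed by
the trivial coset is `X`. The inclusion `indIn : X ⟶ I_L^H X` of `L`-equivariant objects is
universal: every `L`-equivariant morphism `X ⟶ W` into an `H`-equivariant object extends uniquely to
`I_L^H X` (`indDesc`, `ind_hom_ext`), because `H` permutes the summands transitively. So equations
between morphisms out of an induced object can be tested on `X`, where `I`, `CI`, the Mackey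
inclusions and the projection morphisms have simple descriptions.

The extension of `f : X ⟶ W` is invertible as soon as `f` has a retraction `p` such that the
conjugates of the idempotent `W ⟶ X ⟶ W` by representatives of the cosets of `L` in `H` are
orthogonal with sum `1` (`isIso_indDesc`). The idempotent of `I_L^H X` itself has this property for
every system of representatives (`sum_conjEnd_indOut_indIn`). Applying `T^a` gives the
compatibility of induction with conjugation (`conjInd`), and tensoring with `M` gives the projection
formulas `I_K^H (R_K^H M ⊗ V) ≅ M ⊗ I_K^H V` and `I_K^H (V ⊗ R_K^H M) ≅ I_K^H V ⊗ M`
(`isIso_indTensorLeft`, `isIso_indTensorRight`). Grouping the cosets of `K` in `H` according to the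
double cosets in `L \ H / K` (`bijective_mackey`) splits the sum of the idempotents and gives the
Mackey decomposition (`mackeyDecomposition`).

**Module structures over `C^G`.** The projection formulas turn induction into a left and right
`C^H`-module functor (`indLeftLinear`, `indRightLinear`) and into a `C^G`-module functor
(`indTopLinear`). Conjugation becomes a `C^G`-module functor through the morphisms `conjTensor`,
which combine the oplax structure of `T^a` with the equivariant structure `T^a M ⟶ M` of the object
of `C^G`. That the natural isomorphisms respect these structures is again tested on `X`
(`topModule`).
-/

noncomputable section

/-! ### Finite biproducts indexed by a type in an arbitrary universe -/

section Biproducts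

variable {D : Type u₁} [Category.{v₁} D] [Preadditive D] [HasFiniteBiproducts D]
  {D' : Type u₂} [Category.{v₂} D'] [Preadditive D']

theorem sum_biproduct_π_comp_ι {J : Type*} [Fintype J] (f : J → D) :
    ∑ j, biproduct.π f j ≫ biproduct.ι f j = 𝟙 (⨁ f) := by
  classical
  refine biproduct.hom_ext _ _ fun j => ?_
  simp [Preadditive.sum_comp, biproduct.ι_π, comp_dite]

theorem map_biproduct_hom_ext {J : Type*} [Finite J] (f : J → D) (F : D ⥤ D') [F.Additive]
    {Z : D'} {a b : F.obj (⨁ f) ⟶ Z}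
    (h : ∀ j, F.map (biproduct.ι f j) ≫ a = F.map (biproduct.ι f j) ≫ b) : a = b := by
  have := Fintype.ofFinite J
  have h1 : ∑ j, F.map (biproduct.π f j) ≫ F.map (biproduct.ι f j) = 𝟙 (F.obj (⨁ f)) := by
    simp only [← F.map_comp]
    rw [← F.map_sum, sum_biproduct_π_comp_ι, F.map_id]
  rw [← Category.id_comp a, ← Category.id_comp b, ← h1, Preadditive.sum_comp,
    Preadditive.sum_comp]
  exact Finset.sum_congr rfl fun j _ => by rw [Category.assoc, Category.assoc, h]

end Biproducts

/-! ### The action of free modules on a linear category -/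

section Copower

variable {k : Type w} [CommRing k]
  {D : Type u₁} [Category.{v₁} D] [Preadditive D] [HasFiniteBiproducts D] [Linear k D]

instance (V : Vec k) : Module.Finite k V.obj := V.property.1

instance (V : Vec k) : Module.Free k V.obj := V.property.2

/-- The copower of the object `M` by the finitely generated free module `V`: the direct sum of
copies of `M` indexed by a basis of `V`. It represents the functor
`N ↦ Hom_k (V, Hom (M, N))`, see `copowerDesc` and `copower_hom_ext`. -/
def copower (V : Vec k) (M : D) : D :=
  ⨁ fun _ : Module.Free.ChooseBasisIndex k V.obj => M

/-- The basis of `V` used to form copowers by `V`. -/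
def copowerBasis (V : Vec k) :
    Module.Basis (Module.Free.ChooseBasisIndex k V.obj) k V.obj :=
  Module.Free.chooseBasis k V.obj

/-- The bilinear map `(x, y) ↦ x ⊗ y` into the underlying module of `V ⊗ W`. -/
def vecTmul (V W : Vec k) : V.obj →ₗ[k] W.obj →ₗ[k] (V ⊗ W).obj :=
  TensorProduct.mk k V.obj W.obj

section

variable {U V V' W W' : Vec k}

@[simp] theorem id_vec_apply (x : V.obj) : (𝟙 V : V ⟶ V).hom.hom x = x := rfl

@[simp] theorem tensorHom_vecTmul (f : V ⟶ V') (g : W ⟶ W') (x : V.obj) (y : W.obj) :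
    (f ⊗ₘ g).hom.hom (vecTmul V W x y) = vecTmul V' W' (f.hom.hom x) (g.hom.hom y) := rfl

@[simp] theorem whiskerLeft_vecTmul (g : W ⟶ W') (x : V.obj) (y : W.obj) :
    (V ◁ g).hom.hom (vecTmul V W x y) = vecTmul V W' x (g.hom.hom y) := rfl

@[simp] theorem whiskerRight_vecTmul (f : V ⟶ V') (x : V.obj) (y : W.obj) :
    (f ▷ W).hom.hom (vecTmul V W x y) = vecTmul V' W (f.hom.hom x) y := rfl

@[simp] theorem associator_vecTmul (x : U.obj) (y : V.obj) (z : W.obj) :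
    (α_ U V W).hom.hom.hom (vecTmul (U ⊗ V) W (vecTmul U V x y) z) =
      vecTmul U (V ⊗ W) x (vecTmul V W y z) := rfl

variable (k) in
/-- The element `r` of the underlying module of the unit object. -/
def vecUnit : k →ₗ[k] (𝟙_ (Vec k)).obj := LinearMap.id

@[simp] theorem leftUnitor_vecTmul (r : k) (x : V.obj) :
    (λ_ V).hom.hom.hom (vecTmul _ V (vecUnit k r) x) = r • x := rfl

@[simp] theorem rightUnitor_vecTmul (r : k) (x : V.obj) :
    (ρ_ V).hom.hom.hom (vecTmul V _ x (vecUnit k r)) = r • x := rfl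

theorem vec_hom_ext {A : Type*} [AddCommGroup A] [Module k A] {f g : (V ⊗ W).obj →ₗ[k] A}
    (h : ∀ x y, f (vecTmul V W x y) = g (vecTmul V W x y)) : f = g :=
  TensorProduct.ext' h

end

/-- The morphism `M ⟶ V ⊙ M` attached to an element of `V`. -/
def copowerι (V : Vec k) (M : D) : V.obj →ₗ[k] (M ⟶ copower V M) :=
  (copowerBasis V).constr k fun i =>
    (biproduct.ι (fun _ => M) i : M ⟶ copower V M)

theorem copowerι_basis (V : Vec k) (M : D) (i) :
    copowerι V M (copowerBasis V i) = biproduct.ι (fun _ => M) i :=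
  Module.Basis.constr_basis _ _ _ _

/-- The projections from the copower. -/
def copowerπ (V : Vec k) (M : D) (i : Module.Free.ChooseBasisIndex k V.obj) : copower V M ⟶ M :=
  biproduct.π (fun _ => M) i

theorem copowerι_π_self (V : Vec k) (M : D) (i) :
    copowerι V M (copowerBasis V i) ≫ copowerπ V M i = 𝟙 M :=
  (congrArg (· ≫ copowerπ V M i) (copowerι_basis V M i)).trans
    (biproduct.ι_π_self (fun _ => M) i)

theorem copowerι_π_ne (V : Vec k) (M : D) {i j} (h : i ≠ j) :
    copowerι V M (copowerBasis V i) ≫ copowerπ V M j = 0 :=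
  (congrArg (· ≫ copowerπ V M j) (copowerι_basis V M i)).trans
    (biproduct.ι_π_ne (fun _ => M) h)

/-- The morphism `V ⊙ M ⟶ N` attached to a linear map `V → Hom (M, N)`. -/
def copowerDesc {V : Vec k} {M N : D} (l : V.obj →ₗ[k] (M ⟶ N)) : copower V M ⟶ N :=
  biproduct.desc fun i => l (copowerBasis V i)

@[simp]
theorem copowerι_desc {V : Vec k} {M N : D} (l : V.obj →ₗ[k] (M ⟶ N)) (x : V.obj) :
    copowerι V M x ≫ copowerDesc l = l x := by
  have : (Linear.rightComp k M (copowerDesc l)) ∘ₗ copowerι V M = l := by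
    refine (copowerBasis V).ext fun i => ?_
    rw [LinearMap.comp_apply, copowerι_basis]
    exact biproduct.ι_desc _ i
  exact LinearMap.congr_fun this x

@[simp]
theorem copowerι_desc_assoc {V : Vec k} {M N : D} (l : V.obj →ₗ[k] (M ⟶ N)) (x : V.obj) {Z : D}
    (h : N ⟶ Z) :
    copowerι V M x ≫ copowerDesc l ≫ h = l x ≫ h := by
  simp only [← Category.assoc, copowerι_desc]

theorem map_copower_hom_ext {D' : Type u₂} [Category.{v₂} D'] [Preadditive D']
    (F : D ⥤ D') [F.Additive] {V : Vec k} {M : D} {N : D'}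
    {f g : F.obj (copower V M) ⟶ N}
    (h : ∀ x, F.map (copowerι V M x) ≫ f = F.map (copowerι V M x) ≫ g) : f = g := by
  refine map_biproduct_hom_ext _ F fun i => ?_
  have := h (copowerBasis V i)
  rwa [copowerι_basis] at this

theorem copower_hom_ext {V : Vec k} {M N : D} {f g : copower V M ⟶ N}
    (h : ∀ x, copowerι V M x ≫ f = copowerι V M x ≫ g) : f = g :=
  map_copower_hom_ext (𝟭 D) h

theorem copower_tensor_hom_ext {V W : Vec k} {M N : D} {f g : copower (V ⊗ W) M ⟶ N}
    (h : ∀ x y, copowerι (V ⊗ W) M (vecTmul V W x y) ≫ f =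
      copowerι (V ⊗ W) M (vecTmul V W x y) ≫ g) : f = g := by
  refine copower_hom_ext fun z => ?_
  have : (Linear.rightComp k M f) ∘ₗ (copowerι (V ⊗ W) M) =
      (Linear.rightComp k M g) ∘ₗ (copowerι (V ⊗ W) M) := vec_hom_ext h
  exact LinearMap.congr_fun this z

theorem copower_tensor_tensor_hom_ext {U V W : Vec k} {M N : D}
    {f g : copower ((U ⊗ V) ⊗ W) M ⟶ N}
    (h : ∀ x y z, copowerι _ M (vecTmul (U ⊗ V) W (vecTmul U V x y) z) ≫ f =
      copowerι _ M (vecTmul (U ⊗ V) W (vecTmul U V x y) z) ≫ g) : f = g := by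
  refine copower_tensor_hom_ext fun t z => ?_
  have : (Linear.rightComp k M f) ∘ₗ (copowerι _ M) ∘ₗ (vecTmul (U ⊗ V) W).flip z =
      (Linear.rightComp k M g) ∘ₗ (copowerι _ M) ∘ₗ (vecTmul (U ⊗ V) W).flip z :=
    vec_hom_ext fun x y => h x y z
  exact LinearMap.congr_fun this t

/-- The functoriality of the copower in both variables. -/
def copowerMap {V W : Vec k} {M N : D} (f : V ⟶ W) (g : M ⟶ N) : copower V M ⟶ copower W N :=
  copowerDesc ((Linear.leftComp k _ g) ∘ₗ (copowerι W N) ∘ₗ f.hom.hom)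

@[simp]
theorem copowerι_map {V W : Vec k} {M N : D} (f : V ⟶ W) (g : M ⟶ N) (x : V.obj) :
    copowerι V M x ≫ copowerMap f g = g ≫ copowerι W N (f.hom.hom x) :=
  copowerι_desc _ _

@[simp]
theorem copowerι_map_assoc {V W : Vec k} {M N : D} (f : V ⟶ W) (g : M ⟶ N) (x : V.obj) {Z : D}
    (h : copower W N ⟶ Z) :
    copowerι V M x ≫ copowerMap f g ≫ h = g ≫ copowerι W N (f.hom.hom x) ≫ h := by
  simp only [← Category.assoc, copowerι_map]

theorem copowerMap_id (V : Vec k) (M : D) : copowerMap (𝟙 V) (𝟙 M) = 𝟙 _ :=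
  copower_hom_ext fun x => by simp

theorem copowerMap_comp {V V' V'' : Vec k} {M M' M'' : D} (f : V ⟶ V') (f' : V' ⟶ V'')
    (g : M ⟶ M') (g' : M' ⟶ M'') :
    copowerMap (f ≫ f') (g ≫ g') = copowerMap f g ≫ copowerMap f' g' :=
  copower_hom_ext fun x => by simp

theorem exists_copowerAssoc_hom (V W : Vec k) (M : D) :
    ∃ f : copower (V ⊗ W) M ⟶ copower V (copower W M), ∀ x y,
      copowerι (V ⊗ W) M (vecTmul V W x y) ≫ f = copowerι W M y ≫ copowerι V _ x := by
  let b : V.obj →ₗ[k] W.obj →ₗ[k] (M ⟶ copower V (copower W M)) := LinearMap.mk₂ k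
    (fun x y => copowerι W M y ≫ copowerι V _ x) (by simp) (by simp) (by simp) (by simp)
  refine ⟨copowerDesc (V := V ⊗ W) (TensorProduct.lift b), fun x y => ?_⟩
  rw [copowerι_desc]
  exact TensorProduct.lift.tmul x y

theorem exists_copowerAssoc_inv (V W : Vec k) (M : D) :
    ∃ f : copower V (copower W M) ⟶ copower (V ⊗ W) M, ∀ x y,
      copowerι W M y ≫ copowerι V _ x ≫ f = copowerι (V ⊗ W) M (vecTmul V W x y) := by
  refine ⟨copowerDesc (LinearMap.mk (AddHom.mk (fun x => copowerDesc
    ((copowerι (V ⊗ W) M) ∘ₗ (vecTmul V W x)))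
    fun x x' => copower_hom_ext fun y => by simp [Preadditive.comp_add])
    fun r x => copower_hom_ext fun y => by simp [Linear.comp_smul]), fun x y => ?_⟩
  simp

/-- The isomorphism `(V ⊗ W) ⊙ M ≅ V ⊙ (W ⊙ M)`. -/
def copowerAssoc (V W : Vec k) (M : D) : copower (V ⊗ W) M ≅ copower V (copower W M) where
  hom := (exists_copowerAssoc_hom V W M).choose
  inv := (exists_copowerAssoc_inv V W M).choose
  hom_inv_id := copower_tensor_hom_ext fun x y => by
    rw [← Category.assoc, (exists_copowerAssoc_hom V W M).choose_spec, Category.assoc,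
      (exists_copowerAssoc_inv V W M).choose_spec, Category.comp_id]
  inv_hom_id := copower_hom_ext fun x => copower_hom_ext fun y => by
    rw [← Category.assoc, ← Category.assoc, Category.assoc (copowerι W M y),
      (exists_copowerAssoc_inv V W M).choose_spec, (exists_copowerAssoc_hom V W M).choose_spec,
      Category.comp_id]

@[simp]
theorem copowerι_assoc_hom (V W : Vec k) (M : D) (x : V.obj) (y : W.obj) :
    copowerι (V ⊗ W) M (vecTmul V W x y) ≫ (copowerAssoc V W M).hom =
      copowerι W M y ≫ copowerι V _ x :=
  (exists_copowerAssoc_hom V W M).choose_spec x y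

@[simp]
theorem copowerι_assoc_hom_assoc (V W : Vec k) (M : D) (x : V.obj) (y : W.obj) {Z : D}
    (h : copower V (copower W M) ⟶ Z) :
    copowerι (V ⊗ W) M (vecTmul V W x y) ≫ (copowerAssoc V W M).hom ≫ h =
      copowerι W M y ≫ copowerι V _ x ≫ h := by
  simp only [← Category.assoc, copowerι_assoc_hom]

@[simp]
theorem copowerι_assoc_inv (V W : Vec k) (M : D) (x : V.obj) (y : W.obj) :
    copowerι W M y ≫ copowerι V _ x ≫ (copowerAssoc V W M).inv =
      copowerι (V ⊗ W) M (vecTmul V W x y) :=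
  (exists_copowerAssoc_inv V W M).choose_spec x y

theorem copower_unit_hom_ext {M N : D} {f g : copower (𝟙_ (Vec k)) M ⟶ N}
    (h : copowerι (𝟙_ (Vec k)) M (vecUnit k 1) ≫ f =
      copowerι (𝟙_ (Vec k)) M (vecUnit k 1) ≫ g) : f = g := by
  refine copower_hom_ext fun x => ?_
  have : (Linear.rightComp k M f) ∘ₗ (copowerι _ M) ∘ₗ vecUnit k =
      (Linear.rightComp k M g) ∘ₗ (copowerι _ M) ∘ₗ vecUnit k := LinearMap.ext_ring h
  exact LinearMap.congr_fun this x

theorem copower_unit_tensor_hom_ext {V : Vec k} {M N : D} {f g : copower (𝟙_ (Vec k) ⊗ V) M ⟶ N}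
    (h : ∀ x, copowerι _ M (vecTmul _ V (vecUnit k 1) x) ≫ f =
      copowerι _ M (vecTmul _ V (vecUnit k 1) x) ≫ g) : f = g := by
  refine copower_tensor_hom_ext fun r x => ?_
  have : (Linear.rightComp k M f) ∘ₗ (copowerι _ M) ∘ₗ (vecTmul _ V).flip x ∘ₗ vecUnit k =
      (Linear.rightComp k M g) ∘ₗ (copowerι _ M) ∘ₗ (vecTmul _ V).flip x ∘ₗ vecUnit k :=
    LinearMap.ext_ring (h x)
  exact LinearMap.congr_fun this r

theorem copower_tensor_unit_hom_ext {V : Vec k} {M N : D} {f g : copower (V ⊗ 𝟙_ (Vec k)) M ⟶ N}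
    (h : ∀ x, copowerι _ M (vecTmul V _ x (vecUnit k 1)) ≫ f =
      copowerι _ M (vecTmul V _ x (vecUnit k 1)) ≫ g) : f = g := by
  refine copower_tensor_hom_ext fun x r => ?_
  have : (Linear.rightComp k M f) ∘ₗ (copowerι _ M) ∘ₗ (vecTmul V _ x) ∘ₗ vecUnit k =
      (Linear.rightComp k M g) ∘ₗ (copowerι _ M) ∘ₗ (vecTmul V _ x) ∘ₗ vecUnit k :=
    LinearMap.ext_ring (h x)
  exact LinearMap.congr_fun this r

/-- The isomorphism `k ⊙ M ≅ M`. -/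
def copowerUnit (M : D) : copower (𝟙_ (Vec k)) M ≅ M where
  hom := copowerDesc (V := 𝟙_ (Vec k)) (LinearMap.toSpanSingleton k (M ⟶ M) (𝟙 M))
  inv := copowerι (𝟙_ (Vec k)) M (vecUnit k 1)
  hom_inv_id := copower_unit_hom_ext <| by
    rw [copowerι_desc_assoc]
    exact (congrArg (· ≫ _) (one_smul k (𝟙 M))).trans
      ((Category.id_comp _).trans (Category.comp_id _).symm)
  inv_hom_id := by
    rw [copowerι_desc]
    exact one_smul k (𝟙 M)

@[simp]
theorem copowerι_unit_hom (M : D) :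
    copowerι (𝟙_ (Vec k)) M (vecUnit k 1) ≫ (copowerUnit M).hom = 𝟙 M :=
  (copowerUnit M).inv_hom_id

@[simp]
theorem copowerι_unit_hom_assoc (M : D) {Z : D} (h : M ⟶ Z) :
    copowerι (𝟙_ (Vec k)) M (vecUnit k 1) ≫ (copowerUnit M).hom ≫ h = h := by
  simp only [← Category.assoc, copowerι_unit_hom, Category.id_comp]

variable (k D) in
/-- The action of the category of finitely generated free modules on a linear category, by
copowers. All the identities are verified on the morphisms `copowerι`. -/
@[reducible]
def vecAction : MonoidalLeftAction (Vec k) D where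
  actionObj := copower
  actionHomLeft f M := copowerMap f (𝟙 M)
  actionHomRight V _ _ g := copowerMap (𝟙 V) g
  actionHom := copowerMap
  actionAssocIso := copowerAssoc
  actionUnitIso := copowerUnit
  actionHom_def f g := by rw [← copowerMap_comp]; simp
  actionHomRight_id := copowerMap_id
  id_actionHomLeft := copowerMap_id
  actionHom_comp := copowerMap_comp
  actionAssocIso_hom_naturality f g h := copower_tensor_hom_ext fun x y => by
    simp only [copowerι_map_assoc, copowerι_assoc_hom_assoc, tensorHom_vecTmul,
      copowerι_assoc_hom, copowerι_map]
  actionUnitIso_hom_naturality f := copower_unit_hom_ext <| by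
    rw [copowerι_unit_hom_assoc, copowerι_map_assoc]
    exact (Category.comp_id _).symm.trans (congrArg (f ≫ ·) (copowerι_unit_hom _).symm)
  whiskerLeft_actionHomLeft V _ _ f M := copower_tensor_hom_ext fun x y => by
    simp only [copowerι_map_assoc, copowerι_assoc_hom_assoc, whiskerLeft_vecTmul, id_vec_apply,
      copowerι_assoc_inv, copowerι_map, Category.id_comp]
  whiskerRight_actionHomLeft V f M := copower_tensor_hom_ext fun x y => by
    simp only [copowerι_map_assoc, copowerι_assoc_hom_assoc, whiskerRight_vecTmul,
      copowerι_assoc_inv, copowerι_map, Category.id_comp]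
  associator_actionHom U V W M := copower_tensor_tensor_hom_ext fun x y z => by
    simp only [copowerι_map_assoc, copowerι_assoc_hom_assoc, id_vec_apply,
      copowerι_assoc_hom, copowerι_map, associator_vecTmul, Category.id_comp]
  leftUnitor_actionHom V M := copower_unit_tensor_hom_ext fun x => by
    simp only [copowerι_map, copowerι_assoc_hom_assoc, leftUnitor_vecTmul, one_smul,
      copowerι_unit_hom, Category.id_comp, Category.comp_id]
  rightUnitor_actionHom V M := copower_tensor_unit_hom_ext fun x => by
    simp only [copowerι_map, copowerι_assoc_hom_assoc, rightUnitor_vecTmul, one_smul,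
      copowerι_unit_hom_assoc, Category.id_comp, id_vec_apply]

theorem copowerMap_add_left {V W : Vec k} (f f' : V ⟶ W) (M : D) :
    copowerMap (f + f') (𝟙 M) = copowerMap f (𝟙 M) + copowerMap f' (𝟙 M) :=
  copower_hom_ext fun x => by
    rw [Preadditive.comp_add, copowerι_map, copowerι_map, copowerι_map, ← Preadditive.comp_add,
      ← map_add]
    rfl

theorem copowerMap_smul_left {V W : Vec k} (r : k) (f : V ⟶ W) (M : D) :
    copowerMap (r • f) (𝟙 M) = r • copowerMap f (𝟙 M) :=
  copower_hom_ext fun x => by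
    rw [Linear.comp_smul, copowerι_map, copowerι_map, ← Linear.comp_smul, ← map_smul]
    rfl

theorem copowerMap_add_right (V : Vec k) {M N : D} (g g' : M ⟶ N) :
    copowerMap (𝟙 V) (g + g') = copowerMap (𝟙 V) g + copowerMap (𝟙 V) g' :=
  copower_hom_ext fun x => by
    rw [Preadditive.comp_add, copowerι_map, copowerι_map, copowerι_map, ← Preadditive.add_comp]

theorem copowerMap_smul_right (V : Vec k) {M N : D} (r : k) (g : M ⟶ N) :
    copowerMap (𝟙 V) (r • g) = r • copowerMap (𝟙 V) g :=
  copower_hom_ext fun x => by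
    rw [Linear.comp_smul, copowerι_map, copowerι_map, ← Linear.smul_comp]

section Functor

variable {D' : Type u₂} [Category.{v₂} D'] [Preadditive D'] [HasFiniteBiproducts D'] [Linear k D']
  (F : D ⥤ D') [F.Additive] [F.Linear k]

/-- The comparison `F (V ⊙ M) ⟶ V ⊙ F M` for a linear functor `F`; its defining property is
`map_copowerι_comparison`. -/
def copowerComparison (V : Vec k) (M : D) : F.obj (copower V M) ⟶ copower V (F.obj M) :=
  ∑ i, F.map (copowerπ V M i) ≫
    copowerι V (F.obj M) (copowerBasis V i)

@[simp]
theorem map_copowerι_comparison (V : Vec k) (M : D) (x : V.obj) :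
    F.map (copowerι V M x) ≫ copowerComparison F V M = copowerι V (F.obj M) x := by
  classical
  have : (Linear.rightComp k _ (copowerComparison F V M)) ∘ₗ
      (F.mapLinearMap k) ∘ₗ copowerι V M = copowerι V (F.obj M) := by
    refine (copowerBasis V).ext fun i => ?_
    change F.map (copowerι V M (copowerBasis V i)) ≫ copowerComparison F V M = _
    rw [copowerComparison, Preadditive.comp_sum, Finset.sum_eq_single i]
    · rw [← F.map_comp_assoc, copowerι_π_self, F.map_id, Category.id_comp]
    · intro j _ hj
      rw [← F.map_comp_assoc, copowerι_π_ne _ _ hj.symm, F.map_zero, zero_comp]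
    · exact fun h => absurd (Finset.mem_univ i) h
  exact LinearMap.congr_fun this x

@[simp]
theorem map_copowerι_comparison_assoc (V : Vec k) (M : D) (x : V.obj) {Z : D'}
    (h : copower V (F.obj M) ⟶ Z) :
    F.map (copowerι V M x) ≫ copowerComparison F V M ≫ h = copowerι V (F.obj M) x ≫ h := by
  simp only [← Category.assoc, map_copowerι_comparison]

/-- The inverse of `copowerComparison`. -/
def copowerComparisonInv (V : Vec k) (M : D) : copower V (F.obj M) ⟶ F.obj (copower V M) :=
  copowerDesc ((F.mapLinearMap k) ∘ₗ copowerι V M)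

@[simp]
theorem copowerι_comparisonInv (V : Vec k) (M : D) (x : V.obj) :
    copowerι V (F.obj M) x ≫ copowerComparisonInv F V M = F.map (copowerι V M x) :=
  copowerι_desc _ _

@[simp]
theorem copowerι_comparisonInv_assoc (V : Vec k) (M : D) (x : V.obj) {Z : D'}
    (h : F.obj (copower V M) ⟶ Z) :
    copowerι V (F.obj M) x ≫ copowerComparisonInv F V M ≫ h = F.map (copowerι V M x) ≫ h := by
  simp only [← Category.assoc, copowerι_comparisonInv]

variable (k) in
/-- Every linear functor is a module functor over the category of finitely generated free
modules. -/
@[reducible]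
def vecLinear :
    letI := vecAction k D
    letI := vecAction k D'
    F.LeftLinear (Vec k) :=
  letI := vecAction k D
  letI := vecAction k D'
  { μₗ := copowerComparisonInv F
    δₗ := copowerComparison F
    μₗ_naturality_left := fun f M => copower_hom_ext fun x => by
      change _ ≫ copowerMap f (𝟙 (F.obj M)) ≫ _ = _ ≫ _ ≫ F.map (copowerMap f (𝟙 M))
      rw [copowerι_map_assoc, Category.id_comp, copowerι_comparisonInv,
        copowerι_comparisonInv_assoc, ← F.map_comp, copowerι_map, Category.id_comp]
    μₗ_naturality_right := fun V _ _ g => copower_hom_ext fun x => by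
      change _ ≫ copowerMap (𝟙 V) (F.map g) ≫ _ = _ ≫ _ ≫ F.map (copowerMap (𝟙 V) g)
      rw [copowerι_map_assoc, copowerι_comparisonInv,
        copowerι_comparisonInv_assoc, ← F.map_comp, ← F.map_comp, copowerι_map, id_vec_apply]
    μₗ_associativity := fun V W M => copower_tensor_hom_ext fun x y => by
      change _ ≫ _ ≫ F.map (copowerAssoc V W M).hom = _ ≫ (copowerAssoc V W (F.obj M)).hom ≫
        copowerMap (𝟙 V) (copowerComparisonInv F W M) ≫ copowerComparisonInv F V (copower W M)
      simp only [copowerι_assoc_hom_assoc, copowerι_map_assoc, copowerι_comparisonInv_assoc,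
        copowerι_comparisonInv, id_vec_apply, ← F.map_comp, copowerι_assoc_hom]
    μₗ_unitality := fun M => copower_unit_hom_ext <| by
      change _ ≫ (copowerUnit _).hom = _ ≫ _ ≫ F.map (copowerUnit M).hom
      rw [copowerι_unit_hom, copowerι_comparisonInv_assoc, ← F.map_comp, copowerι_unit_hom,
        F.map_id]
    δₗ_naturality_left := fun f M => map_copower_hom_ext F fun x => by
      change _ ≫ F.map (copowerMap f (𝟙 M)) ≫ _ = _ ≫ _ ≫ copowerMap f (𝟙 (F.obj M))
      rw [← F.map_comp_assoc, copowerι_map, Category.id_comp, map_copowerι_comparison,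
        map_copowerι_comparison_assoc, copowerι_map, Category.id_comp]
    δₗ_naturality_right := fun V _ _ g => map_copower_hom_ext F fun x => by
      change _ ≫ F.map (copowerMap (𝟙 V) g) ≫ _ = _ ≫ _ ≫ copowerMap (𝟙 V) (F.map g)
      rw [← F.map_comp_assoc, copowerι_map, F.map_comp_assoc, map_copowerι_comparison,
        map_copowerι_comparison_assoc, copowerι_map, id_vec_apply]
    δₗ_associativity := fun V W M => by
      change _ ≫ (copowerAssoc V W (F.obj M)).hom = F.map (copowerAssoc V W M).hom ≫
        copowerComparison F V (copower W M) ≫ copowerMap (𝟙 V) (copowerComparison F W M)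
      rw [← cancel_epi (F.map (copowerAssoc V W M).inv), ← F.map_comp_assoc, Iso.inv_hom_id,
        F.map_id, Category.id_comp]
      refine map_copower_hom_ext F fun x => map_copower_hom_ext F fun y => ?_
      rw [← F.map_comp_assoc, ← F.map_comp_assoc, Category.assoc, copowerι_assoc_inv,
        map_copowerι_comparison_assoc, map_copowerι_comparison_assoc, copowerι_assoc_hom,
        copowerι_map, map_copowerι_comparison_assoc, id_vec_apply]
    δₗ_unitality_inv := fun M => by
      change copowerι _ _ _ = F.map (copowerι _ _ _) ≫ _
      rw [map_copowerι_comparison]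
    μₗ_comp_δₗ := fun V M => copower_hom_ext fun x => by
      rw [copowerι_comparisonInv_assoc, map_copowerι_comparison]
      exact (Category.comp_id _).symm
    δₗ_comp_μₗ := fun V M => map_copower_hom_ext F fun x => by
      rw [map_copowerι_comparison_assoc, copowerι_comparisonInv]
      exact (Category.comp_id _).symm }

end Functor

section ModuleHom

variable {D' : Type u₂} [Category.{v₂} D'] [Preadditive D'] [HasFiniteBiproducts D'] [Linear k D']

/-- A lineator is the one of `vecLinear` as soon as it is compatible with the morphisms
`copowerι`. -/
def IsVecLineator (F : D ⥤ D')
    (δ : letI := vecAction k D; letI := vecAction k D'; Lineator (Vec k) F) : Prop :=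
  ∀ (V : Vec k) (M : D) (x : V.obj), F.map (copowerι V M x) ≫ δ V M = copowerι V (F.obj M) x

theorem isVecLineator_vecLinear (F : D ⥤ D') [F.Additive] [F.Linear k] :
    IsVecLineator F (letI := vecAction k D; letI := vecAction k D'; lineator (vecLinear k F)) :=
  map_copowerι_comparison F

theorem isVecLineator_id :
    IsVecLineator (𝟭 D) (letI := vecAction k D; Lineator.id (S := Vec k)) :=
  fun _ _ _ => Category.comp_id _

theorem IsVecLineator.comp {D'' : Type u₃} [Category.{v₃} D''] [Preadditive D'']
    [HasFiniteBiproducts D''] [Linear k D''] {F : D ⥤ D'} {F' : D' ⥤ D''}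
    {δ : letI := vecAction k D; letI := vecAction k D'; Lineator (Vec k) F}
    {δ' : letI := vecAction k D'; letI := vecAction k D''; Lineator (Vec k) F'}
    (h : IsVecLineator F δ) (h' : IsVecLineator F' δ') :
    IsVecLineator (F ⋙ F') (letI := vecAction k D; letI := vecAction k D';
      letI := vecAction k D''; Lineator.comp δ δ') := fun V M x => by
  have h1 := congrArg F'.map (h V M x)
  rw [F'.map_comp] at h1
  exact (Category.assoc _ _ _).symm.trans ((congrArg (· ≫ δ' V (F.obj M)) h1).trans
    (h' V (F.obj M) x))

/-- Every natural transformation of linear functors is a morphism of module functors over the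
category of finitely generated free modules. -/
theorem IsVecLineator.isModuleHom {F F' : D ⥤ D'} [F.Additive]
    {δ δ' : _} (h : IsVecLineator (k := k) F δ) (h' : IsVecLineator (k := k) F' δ') (τ : F ⟶ F') :
    letI := vecAction k D
    letI := vecAction k D'
    IsModuleHom δ δ' τ := fun V M => map_copower_hom_ext F fun x => by
  change F.map _ ≫ τ.app (copower V M) ≫ _ = _
  rw [τ.naturality_assoc]
  have h1 := h V M x
  have h2 := h' V M x
  refine (congrArg (τ.app M ≫ ·) h2).trans ((copowerι_map (𝟙 V) (τ.app M) x).symm.trans ?_)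
  exact (congrArg (· ≫ copowerMap (𝟙 V) (τ.app M)) h1.symm).trans (Category.assoc _ _ _)

end ModuleHom

end Copower

/-! ### Equivariant objects form an abelian category -/

namespace GroupAction

attribute [local instance] GroupAction.additive

namespace Equivariant

variable {G : Type t} [Group G] {C : Type u} [Category.{v} C] {T : GroupAction G C}
  {H : Subgroup G}

/-- For `W ∈ C^H`, `g ∈ H` and `f : X ⟶ W` in `C`, the composite `T^g X ⟶ T^g W ⟶ W`. -/
def act (W : T.Equivariant H) (g : H) {X : C} (f : X ⟶ W.obj) : (T.fn g).obj X ⟶ W.obj :=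
  (T.fn g).map f ≫ W.μ g

theorem act_id (W : T.Equivariant H) (g : H) : W.act g (𝟙 W.obj) = W.μ g := by
  simp [act]

theorem act_comp {W W' : T.Equivariant H} (φ : W ⟶ W') (g : H) {X : C} (f : X ⟶ W.obj) :
    W.act g f ≫ φ.hom = W'.act g (f ≫ φ.hom) := by
  simp [act, φ.comm]

theorem comp_act (W : T.Equivariant H) (g : H) {X Y : C} (e : Y ⟶ X) (f : X ⟶ W.obj) :
    (T.fn g).map e ≫ W.act g f = W.act g (e ≫ f) := by
  simp [act]

theorem act_act (W : T.Equivariant H) {g h gh : H} (e : (g : G) * h = gh) {X : C}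
    (f : X ⟶ W.obj) : W.act g (W.act h f) = (T.mul g h gh e).hom.app X ≫ W.act gh f := by
  have e' : g * h = gh := Subtype.ext e
  rw [act, act, act, Functor.map_comp, Category.assoc, W.μ_mul' e' e, ← Category.assoc,
    mul_naturality, Category.assoc]

theorem one_act (W : T.Equivariant H) {X : C} (f : X ⟶ W.obj) :
    T.one.hom.app X ≫ W.act 1 f = f := by
  have h1 := T.one.hom.naturality f
  have h2 := W.μ_one
  have h3 : f ≫ T.one.hom.app W.obj ≫ W.μ 1 = f :=
    (congrArg (f ≫ ·) h2).trans (Category.comp_id f)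
  refine Eq.trans ?_ h3
  exact (Category.assoc _ _ _).symm.trans ((congrArg (· ≫ W.μ 1) h1.symm).trans
    (Category.assoc _ _ _))

theorem sum_hom [Preadditive C] [HasFiniteBiproducts C] {X Y : T.Equivariant H} {J : Type*}
    (s : Finset J) (f : J → (X ⟶ Y)) : (∑ j ∈ s, f j).hom = ∑ j ∈ s, (f j).hom :=
  (forget T H).map_sum f s

theorem isIso_of_isIso_hom {X Y : T.Equivariant H} (f : X ⟶ Y) [IsIso f.hom] : IsIso f :=
  (isoMk (asIso f.hom) f.comm).isIso_hom

/-- The structure of an equivariant object on the source of a monomorphism into `X` which is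
stable under the maps `μ h`. -/
def ofMono (X : T.Equivariant H) {K : C} (i : K ⟶ X.obj) [Mono i]
    (μ : ∀ h : H, (T.fn h).obj K ⟶ K) (hμ : ∀ h, μ h ≫ i = (T.fn h).map i ≫ X.μ h) :
    T.Equivariant H :=
  have h1 : ∀ g h : H, (T.fn g).map (μ h) ≫ μ g =
      (T.mul g h (g * h : H) rfl).hom.app K ≫ μ (g * h) := fun g h => by
    rw [← cancel_mono i, Category.assoc, Category.assoc, hμ, hμ, ← Functor.map_comp_assoc, hμ,
      Functor.map_comp_assoc, X.μ_mul, ← Category.assoc, mul_naturality, Category.assoc]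
  have h2 : T.one.hom.app K ≫ μ 1 = 𝟙 K := by
    rw [← cancel_mono i, Category.assoc, hμ]
    refine Eq.trans ?_ (Category.id_comp i).symm
    exact X.one_act i
  { obj := K
    μ := μ
    isIso_μ := T.isIso_of_axioms _ _ h1 h2
    μ_mul := h1
    μ_one := h2 }

/-- The structure of an equivariant object on the target of an epimorphism from `X` which is
compatible with the maps `μ h`. -/
def ofEpi [∀ g : G, (T.fn g).PreservesEpimorphisms]
    (X : T.Equivariant H) {Q : C} (p : X.obj ⟶ Q) [Epi p]
    (μ : ∀ h : H, (T.fn h).obj Q ⟶ Q) (hμ : ∀ h : H, (T.fn h).map p ≫ μ h = X.μ h ≫ p) :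
    T.Equivariant H :=
  have h1 : ∀ g h : H, (T.fn g).map (μ h) ≫ μ g =
      (T.mul g h (g * h : H) rfl).hom.app Q ≫ μ (g * h) := fun g h => by
    rw [← cancel_epi ((T.fn g).map ((T.fn h).map p)), ← Functor.map_comp_assoc, hμ,
      Functor.map_comp_assoc, hμ, reassoc_of% X.μ_mul, ← Category.assoc ((T.fn g).map _),
      mul_naturality, Category.assoc, hμ]
  have h2 : T.one.hom.app Q ≫ μ 1 = 𝟙 Q := by
    rw [← cancel_epi p]
    have n := T.one.hom.naturality p
    refine (Category.assoc _ _ _).symm.trans ((congrArg (· ≫ μ 1) n).trans ?_)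
    refine (Category.assoc _ _ _).trans ((congrArg (T.one.hom.app X.obj ≫ ·) (hμ 1)).trans ?_)
    refine (Category.assoc _ _ _).symm.trans ((congrArg (· ≫ p) X.μ_one).trans ?_)
    exact (Category.id_comp p).trans (Category.comp_id p).symm
  { obj := Q
    μ := μ
    isIso_μ := T.isIso_of_axioms _ _ h1 h2
    μ_mul := h1
    μ_one := h2 }

section Biproducts

variable [Preadditive C] [HasFiniteBiproducts C]

/-- The direct sum of equivariant objects. -/
def directSum {J : Type} [Finite J] (X : J → T.Equivariant H) : T.Equivariant H :=
  have h1 : ∀ g h : H,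
      (T.fn g).map (biproduct.lift fun j => (T.fn h).map (biproduct.π _ j) ≫ (X j).μ h) ≫
        (biproduct.lift fun j => (T.fn g).map (biproduct.π _ j) ≫ (X j).μ g) =
      (T.mul g h (g * h : H) rfl).hom.app (⨁ fun j => (X j).obj) ≫
        biproduct.lift fun j =>
          (T.fn (g * h : H)).map (biproduct.π _ j) ≫ (X j).μ (g * h) := fun g h => by
    refine biproduct.hom_ext _ _ fun j => ?_
    rw [Category.assoc, Category.assoc, biproduct.lift_π, biproduct.lift_π,
      ← Functor.map_comp_assoc, biproduct.lift_π, Functor.map_comp_assoc, (X j).μ_mul,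
      ← Category.assoc, mul_naturality, Category.assoc]
  have h2 : T.one.hom.app (⨁ fun j => (X j).obj) ≫
      (biproduct.lift fun j => (T.fn ((1 : H) : G)).map (biproduct.π _ j) ≫ (X j).μ 1) = 𝟙 _ := by
    refine biproduct.hom_ext _ _ fun j => ?_
    rw [Category.assoc, biproduct.lift_π]
    exact ((X j).one_act _).trans (Category.id_comp _).symm
  { obj := ⨁ fun j => (X j).obj
    μ := fun h => biproduct.lift fun j => (T.fn h).map (biproduct.π _ j) ≫ (X j).μ h
    isIso_μ := T.isIso_of_axioms _ _ h1 h2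
    μ_mul := h1
    μ_one := h2 }

/-- The direct sum of equivariant objects, with its projections and inclusions. -/
def directSumBicone {J : Type} [Finite J] [DecidableEq J] (X : J → T.Equivariant H) :
    Bicone X where
  pt := directSum X
  π j := ⟨biproduct.π (fun j => (X j).obj) j, fun h =>
    (biproduct.lift_π (fun j => (T.fn h).map (biproduct.π _ j) ≫ (X j).μ h) j).symm⟩
  ι j := ⟨biproduct.ι (fun j => (X j).obj) j, fun h => by
    refine biproduct.hom_ext _ _ fun i => ?_
    change ((T.fn h).map (biproduct.ι (fun j => (X j).obj) j) ≫ biproduct.lift _) ≫ _ =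
      ((X j).μ h ≫ biproduct.ι (fun j => (X j).obj) j) ≫ biproduct.π (fun j => (X j).obj) i
    rw [Category.assoc, Category.assoc, biproduct.lift_π, ← Functor.map_comp_assoc]
    by_cases hij : j = i
    · subst hij
      rw [biproduct.ι_π_self]
      simp
    · rw [biproduct.ι_π_ne _ hij]
      simp⟩
  ι_π j i := by
    refine hom_ext _ _ ((biproduct.ι_π _ _ _).trans ?_)
    split_ifs with h
    · subst h; rfl
    · rfl

instance : HasFiniteBiproducts (T.Equivariant H) where
  out n :=
    { has_biproduct := fun X => by
        classical
        have := Fintype.ofFinite (Fin n)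
        refine hasBiproduct_of_total (directSumBicone X) (hom_ext _ _ ?_)
        rw [sum_hom]
        exact sum_biproduct_π_comp_ι _ }

end Biproducts

section Abelian

variable [Abelian C]

attribute [local instance] Abelian.hasFiniteBiproducts

instance (g : G) : (T.fn g).PreservesEpimorphisms :=
  have := T.isEquivalence g
  inferInstance

/-- The object part of the kernel of an equivariant morphism. -/
def kernelObj {X Y : T.Equivariant H} (f : X ⟶ Y) : T.Equivariant H :=
  X.ofMono (kernel.ι f.hom) (fun h => kernel.lift f.hom
    ((T.fn h).map (kernel.ι f.hom) ≫ X.μ h) (by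
      rw [Category.assoc, ← f.comm, ← Functor.map_comp_assoc, kernel.condition]
      simp)) fun _ => kernel.lift_ι _ _ _

/-- The inclusion of the kernel of an equivariant morphism. -/
def kernelι {X Y : T.Equivariant H} (f : X ⟶ Y) : kernelObj f ⟶ X :=
  ⟨kernel.ι f.hom, fun _ => (kernel.lift_ι f.hom _ _).symm⟩

theorem kernelι_comp {X Y : T.Equivariant H} (f : X ⟶ Y) : kernelι f ≫ f = 0 :=
  hom_ext _ _ (kernel.condition f.hom)

/-- An equivariant monomorphism whose underlying morphism is a kernel of the underlying
morphism of `f` is a kernel of `f`. -/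
def isLimitKernelFork {X Y Z : T.Equivariant H} (f : X ⟶ Y) (i : Z ⟶ X) [Mono i.hom]
    (w : i ≫ f = 0)
    (hl : ∀ {A : C} (a : A ⟶ X.obj), a ≫ f.hom = 0 → ∃ l : A ⟶ Z.obj, l ≫ i.hom = a) :
    IsLimit (KernelFork.ofι i w) :=
  KernelFork.IsLimit.ofι i w
    (fun a ha => ⟨(hl a.hom (congrArg Hom.hom ha)).choose, fun h => by
      have e := (hl a.hom (congrArg Hom.hom ha)).choose_spec
      rw [← cancel_mono i.hom, Category.assoc, Category.assoc, ← i.comm, e,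
        ← Functor.map_comp_assoc, e, a.comm]⟩)
    (fun a ha => hom_ext _ _ (hl a.hom (congrArg Hom.hom ha)).choose_spec)
    (fun a ha m hm => hom_ext _ _ (by
      rw [← cancel_mono i.hom]
      exact (congrArg Hom.hom hm).trans (hl a.hom (congrArg Hom.hom ha)).choose_spec.symm))

/-- An equivariant epimorphism whose underlying morphism is a cokernel of the underlying
morphism of `f` is a cokernel of `f`. -/
def isColimitCokernelCofork {X Y Z : T.Equivariant H} (f : X ⟶ Y) (p : Y ⟶ Z) [Epi p.hom]
    (w : f ≫ p = 0)
    (hl : ∀ {A : C} (a : Y.obj ⟶ A), f.hom ≫ a = 0 → ∃ l : Z.obj ⟶ A, p.hom ≫ l = a) :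
    IsColimit (CokernelCofork.ofπ p w) :=
  CokernelCofork.IsColimit.ofπ p w
    (fun a ha => ⟨(hl a.hom (congrArg Hom.hom ha)).choose, fun h => by
      have e := (hl a.hom (congrArg Hom.hom ha)).choose_spec
      rw [← cancel_epi ((T.fn h).map p.hom), ← Functor.map_comp_assoc, e, a.comm,
        reassoc_of% p.comm, e]⟩)
    (fun a ha => hom_ext _ _ (hl a.hom (congrArg Hom.hom ha)).choose_spec)
    (fun a ha m hm => hom_ext _ _ (by
      rw [← cancel_epi p.hom]
      exact (congrArg Hom.hom hm).trans (hl a.hom (congrArg Hom.hom ha)).choose_spec.symm))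

instance {X Y : T.Equivariant H} (f : X ⟶ Y) : Mono (kernelι f).hom :=
  inferInstanceAs (Mono (kernel.ι f.hom))

instance : HasKernels (T.Equivariant H) where
  has_limit f := ⟨_, isLimitKernelFork f (kernelι f) (kernelι_comp f) fun a ha =>
    ⟨kernel.lift _ a ha, kernel.lift_ι _ _ _⟩⟩

theorem exists_cokernelμ {X Y : T.Equivariant H} (f : X ⟶ Y) (h : H) :
    ∃ m : (T.fn h).obj (cokernel f.hom) ⟶ cokernel f.hom,
      (T.fn h).map (cokernel.π f.hom) ≫ m = Y.μ h ≫ cokernel.π f.hom := by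
  have := T.isEquivalence h
  have w : (T.fn h).map f.hom ≫ Y.μ h ≫ cokernel.π f.hom = 0 := by
    rw [reassoc_of% f.comm, cokernel.condition, comp_zero]
  refine ⟨(PreservesCokernel.iso (T.fn h) f.hom).hom ≫ cokernel.desc _ _ w, ?_⟩
  rw [← Category.assoc, PreservesCokernel.π_iso_hom, cokernel.π_desc]

/-- The object part of the cokernel of an equivariant morphism. -/
def cokernelObj {X Y : T.Equivariant H} (f : X ⟶ Y) : T.Equivariant H :=
  Y.ofEpi (cokernel.π f.hom) (fun h => (exists_cokernelμ f h).choose)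
    fun h => (exists_cokernelμ f h).choose_spec

/-- The projection to the cokernel of an equivariant morphism. -/
def cokernelπ {X Y : T.Equivariant H} (f : X ⟶ Y) : Y ⟶ cokernelObj f :=
  ⟨cokernel.π f.hom, fun h => (exists_cokernelμ f h).choose_spec⟩

theorem comp_cokernelπ {X Y : T.Equivariant H} (f : X ⟶ Y) : f ≫ cokernelπ f = 0 :=
  hom_ext _ _ (cokernel.condition f.hom)

instance {X Y : T.Equivariant H} (f : X ⟶ Y) : Epi (cokernelπ f).hom :=
  inferInstanceAs (Epi (cokernel.π f.hom))

instance : HasCokernels (T.Equivariant H) where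
  has_colimit f := ⟨_, isColimitCokernelCofork f (cokernelπ f) (comp_cokernelπ f) fun a ha =>
    ⟨cokernel.desc _ a ha, cokernel.π_desc _ _ _⟩⟩

theorem mono_hom {X Y : T.Equivariant H} (f : X ⟶ Y) [Mono f] : Mono f.hom := by
  have h : kernelι f = 0 := by rw [← cancel_mono f, kernelι_comp, zero_comp]
  exact Preadditive.mono_of_kernel_zero (congrArg Hom.hom h)

theorem epi_hom {X Y : T.Equivariant H} (f : X ⟶ Y) [Epi f] : Epi f.hom := by
  have h : cokernelπ f = 0 := by rw [← cancel_epi f, comp_cokernelπ, comp_zero]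
  exact Preadditive.epi_of_cokernel_zero (congrArg Hom.hom h)

instance : IsNormalMonoCategory (T.Equivariant H) where
  normalMonoOfMono f _ :=
    have := mono_hom f
    ⟨{  Z := cokernelObj f
        g := cokernelπ f
        w := comp_cokernelπ f
        isLimit := isLimitKernelFork (cokernelπ f) f (comp_cokernelπ f) fun a ha =>
          ⟨Abelian.monoLift f.hom a ha, Abelian.monoLift_comp f.hom a ha⟩ }⟩

instance : IsNormalEpiCategory (T.Equivariant H) where
  normalEpiOfEpi f _ :=
    have := epi_hom f
    ⟨{  W := kernelObj f
        g := kernelι f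
        w := kernelι_comp f
        isColimit := isColimitCokernelCofork (kernelι f) f (kernelι_comp f) fun a ha =>
          ⟨Abelian.epiDesc f.hom a ha, Abelian.comp_epiDesc f.hom a ha⟩ }⟩

/-- The equivariantization of an abelian category is abelian. -/
@[reducible]
def abelian : Abelian (T.Equivariant H) where
  has_finite_products := inferInstance

end Abelian
end Equivariant
end GroupAction

/-! ### Frobenius reciprocity -/

namespace GroupAction

attribute [local instance] GroupAction.additive

section Induction

variable {G : Type t} [Group G] {C : Type u} [Category.{v} C] {T : GroupAction G C}
  {L H : Subgroup G}

instance (X : T.Equivariant H) (h : H) : IsIso (X.μ h) := X.isIso_μ h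

namespace Equivariant

/-- For `L ≤ H`, `X ∈ C^L` and `W ∈ C^H`, a morphism `f : X ⟶ W` of `C` is a morphism
`X ⟶ R_L^H W` of `C^L`. -/
def IsResHom (hL : L ≤ H) (X : T.Equivariant L) (W : T.Equivariant H) (f : X.obj ⟶ W.obj) :
    Prop :=
  ∀ l : L, W.act ⟨l, hL l.2⟩ f = X.μ l ≫ f

theorem isResHom_hom (hL : L ≤ H) {X : T.Equivariant L} {W : T.Equivariant H}
    (f : X ⟶ (res hL).obj W) : IsResHom hL X W f.hom := f.comm

theorem IsResHom.trans {K : Subgroup G} {hK : K ≤ L} {hL : L ≤ H} {X : T.Equivariant K}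
    {Y : T.Equivariant L} {W : T.Equivariant H} {f : X.obj ⟶ Y.obj} {g : Y.obj ⟶ W.obj}
    (hf : IsResHom hK X Y f) (hg : IsResHom hL Y W g) :
    IsResHom (hK.trans hL) X W (f ≫ g) := fun l => by
  rw [← comp_act]
  have h1 := hg ⟨l, hK l.2⟩
  have h2 := hf l
  rw [act] at h1 h2
  rw [act, h1, ← Category.assoc, h2, Category.assoc]

/-- The conjugate of an endomorphism `e` of the underlying object of `W ∈ C^H` by `g ∈ H`. -/
def conjEnd (W : T.Equivariant H) (g : H) (e : W.obj ⟶ W.obj) : W.obj ⟶ W.obj :=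
  inv (W.μ g) ≫ W.act g e

theorem conjEnd_conjEnd (W : T.Equivariant H) (g h gh : H) (eg : (g : G) * h = gh)
    (e : W.obj ⟶ W.obj) : W.conjEnd g (W.conjEnd h e) = W.conjEnd gh e := by
  have e' : g * h = gh := Subtype.ext eg
  have h1 := W.μ_mul' e' eg
  rw [conjEnd, conjEnd, conjEnd, ← cancel_epi (W.μ gh),
    ← cancel_epi ((T.mul g h gh eg).hom.app W.obj), IsIso.hom_inv_id_assoc, ← act_act,
    ← reassoc_of% h1, IsIso.hom_inv_id_assoc, comp_act, IsIso.hom_inv_id_assoc]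

end Equivariant

open Equivariant

theorem twist_eq (X : T.Equivariant L) (g r s x : G) (l : L) (e : g * r = s * l)
    (ex : g * r = x) (ex' : s * l = x) :
    twist X g r s l e = (T.mul g r x ex).hom.app X.obj ≫ (T.mul s l x ex').inv.app X.obj ≫
      (T.fn s).map (X.μ l) := by
  subst ex; rfl

/-- The maps `T^s X ⟶ W` coming from a morphism `X ⟶ R_L^H W` are compatible with `twist`. -/
theorem twist_act {hL : L ≤ H} {X : T.Equivariant L} {W : T.Equivariant H}
    {f : X.obj ⟶ W.obj} (hf : IsResHom hL X W f) (g r : G) (s x : H) (l : L)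
    (e : g * r = s * l) (ex : g * r = x) :
    twist X g r s l e ≫ W.act s f = (T.mul g r x ex).hom.app X.obj ≫ W.act x f := by
  have ex' : (s : G) * l = x := e.symm.trans ex
  rw [twist_eq X g r s x l e ex ex', Category.assoc, Category.assoc, comp_act, ← hf l,
    W.act_act (h := ⟨l, hL l.2⟩) ex', Iso.inv_hom_id_app_assoc]

theorem mk_eq_mk_one_iff {g : H} :
    (g : H ⧸ L.subgroupOf H) = ((1 : H) : H ⧸ L.subgroupOf H) ↔ (g : G) ∈ L := by
  rw [eq_comm, QuotientGroup.eq, inv_one, one_mul, Subgroup.mem_subgroupOf]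

theorem smul_mk_one (g : H) :
    g • ((1 : H) : H ⧸ L.subgroupOf H) = (g : H ⧸ L.subgroupOf H) :=
  congrArg ((↑) : H → H ⧸ L.subgroupOf H) (mul_one g)

/-- The chosen representative of the trivial coset. -/
def CosetReps.base (R : CosetReps L H) : L :=
  ⟨R.rep ((1 : H) : H ⧸ L.subgroupOf H), mk_eq_mk_one_iff.1 (R.mk_rep _)⟩

theorem act_inv_μ_map {W : T.Equivariant H} {A : C} (f : A ⟶ W.obj) {Z : C} (p : W.obj ⟶ Z)
    (s r g : H)
    (e : (s : G) * g = r) :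
    W.act r f ≫ inv (W.μ s) ≫ (T.fn s).map p =
      (T.mul s g r e).inv.app _ ≫ (T.fn s).map (W.act g f ≫ p) := by
  rw [← cancel_epi ((T.mul s g r e).hom.app A), ← Category.assoc, ← W.act_act e,
    Iso.hom_inv_id_app_assoc, act, Category.assoc, IsIso.hom_inv_id_assoc, ← Functor.map_comp]

theorem exists_rep_mul (R : CosetReps L H) (g : H) (p q : H ⧸ L.subgroupOf H) (hp : g • p = q) :
    ∃ l : L, (g : G) * R.rep p = R.rep q * l :=
  ⟨⟨_, R.mem hp⟩, by group⟩

variable [Finite G] [Preadditive C] [HasFiniteBiproducts C] (R : CosetReps L H)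

/-- The inclusion of the summand `T^t X`, where `t` represents the coset `q`. -/
def indι (X : T.Equivariant L) (q : H ⧸ L.subgroupOf H) :
    (T.fn (R.rep q)).obj X.obj ⟶ ((ind R).obj X).obj :=
  biproduct.ι (fun q => (T.fn (R.rep q)).obj X.obj) q

/-- The projection to the summand `T^t X`, where `t` represents the coset `q`. -/
def indπ (X : T.Equivariant L) (q : H ⧸ L.subgroupOf H) :
    ((ind R).obj X).obj ⟶ (T.fn (R.rep q)).obj X.obj :=
  biproduct.π (fun q => (T.fn (R.rep q)).obj X.obj) q

section

variable (X : T.Equivariant L)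

@[simp]
theorem indι_π_self (q) : indι R X q ≫ indπ R X q = 𝟙 _ := biproduct.ι_π_self _ _

theorem indι_π_ne {p q} (h : p ≠ q) : indι R X p ≫ indπ R X q = 0 := biproduct.ι_π_ne _ h

theorem sum_indπ_indι [Fintype (H ⧸ L.subgroupOf H)] :
    ∑ q, indπ R X q ≫ indι R X q = 𝟙 _ := sum_biproduct_π_comp_ι _

theorem map_indObj_hom_ext {D : Type*} [Category D] [Preadditive D] (F : C ⥤ D) [F.Additive]
    {Z : D} {a b : F.obj ((ind R).obj X).obj ⟶ Z}
    (h : ∀ q, F.map (indι R X q) ≫ a = F.map (indι R X q) ≫ b) : a = b :=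
  map_biproduct_hom_ext _ F h

theorem indObj_hom_ext {Z : C} {a b : ((ind R).obj X).obj ⟶ Z}
    (h : ∀ q, indι R X q ≫ a = indι R X q ≫ b) : a = b :=
  biproduct.hom_ext' _ _ h

theorem ind_μ_π (g : H) (p q : H ⧸ L.subgroupOf H) (hp : g • p = q) (l : L)
    (e : (g : G) * R.rep p = R.rep q * l) :
    ((ind R).obj X).μ g ≫ indπ R X q =
      (T.fn g).map (indπ R X p) ≫ twist X g (R.rep p) (R.rep q) l e :=
  indμ_π R X g p q hp l e

theorem act_indι_eq_zero (g : H) (p q : H ⧸ L.subgroupOf H) (hp : g • p ≠ q) :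
    ((ind R).obj X).act g (indι R X p) ≫ indπ R X q = 0 := by
  obtain ⟨l, e⟩ := exists_rep_mul R g (g⁻¹ • q) q (smul_inv_smul g q)
  rw [act, Category.assoc, ind_μ_π R X g (g⁻¹ • q) q (smul_inv_smul g q) l e,
    ← Functor.map_comp_assoc, indι_π_ne, Functor.map_zero, zero_comp]
  exact fun h => hp (by rw [h, smul_inv_smul])

theorem act_indι (g : H) (p q : H ⧸ L.subgroupOf H) (hp : g • p = q) (l : L)
    (e : (g : G) * R.rep p = R.rep q * l) :
    ((ind R).obj X).act g (indι R X p) = twist X g (R.rep p) (R.rep q) l e ≫ indι R X q := by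
  refine biproduct.hom_ext _ _ fun q' => ?_
  change _ ≫ indπ R X q' = _ ≫ indπ R X q'
  by_cases h : q = q'
  · subst h
    rw [act, Category.assoc, Category.assoc, ind_μ_π R X g p q hp l e,
      ← Functor.map_comp_assoc, indι_π_self, indι_π_self, CategoryTheory.Functor.map_id,
      Category.id_comp,
      Category.comp_id]
  · rw [act_indι_eq_zero R X g p q' (by rwa [hp]), Category.assoc, indι_π_ne R X h, comp_zero]

/-- The inclusion of the summand of the trivial coset. -/
def indBaseι : (T.fn R.base).obj X.obj ⟶ ((ind R).obj X).obj :=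
  indι R X ((1 : H) : H ⧸ L.subgroupOf H)

/-- The projection to the summand of the trivial coset. -/
def indBaseπ : ((ind R).obj X).obj ⟶ (T.fn R.base).obj X.obj :=
  indπ R X ((1 : H) : H ⧸ L.subgroupOf H)

@[simp]
theorem indBaseι_π : indBaseι R X ≫ indBaseπ R X = 𝟙 _ := indι_π_self R X _

@[simp]
theorem indBaseι_π_assoc {Z : C} (h : (T.fn R.base).obj X.obj ⟶ Z) :
    indBaseι R X ≫ indBaseπ R X ≫ h = h := by
  simp only [← Category.assoc, indBaseι_π, Category.id_comp]

theorem act_indBaseι (g : H) (q : H ⧸ L.subgroupOf H) (hq : (g : H ⧸ L.subgroupOf H) = q) (l : L)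
    (e : (g : G) * R.base = R.rep q * l) :
    ((ind R).obj X).act g (indBaseι R X) = twist X g R.base (R.rep q) l e ≫ indι R X q :=
  act_indι R X g _ q ((smul_mk_one g).trans hq) l e

theorem act_indBaseι_of_mem (g : H) (hg : (g : G) ∈ L) (l : L)
    (e : (g : G) * R.base = R.base * l) :
    ((ind R).obj X).act g (indBaseι R X) = twist X g R.base R.base l e ≫ indBaseι R X :=
  act_indι R X g _ _ ((smul_mk_one g).trans (mk_eq_mk_one_iff.2 hg)) l e

theorem act_indBaseι_π (g : H) (hg : (g : G) ∉ L) :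
    ((ind R).obj X).act g (indBaseι R X) ≫ indBaseπ R X = 0 :=
  act_indι_eq_zero R X g _ _ fun h => hg (mk_eq_mk_one_iff.1 ((smul_mk_one g).symm.trans h))

theorem ind_μ_baseπ (g : H) (q : H ⧸ L.subgroupOf H) (hq : (g : H ⧸ L.subgroupOf H) = q) (l : L)
    (e : (g : G) * R.base = R.rep q * l) :
    ((ind R).obj X).μ g ≫ indπ R X q =
      (T.fn g).map (indBaseπ R X) ≫ twist X g R.base (R.rep q) l e :=
  ind_μ_π R X g _ q ((smul_mk_one g).trans hq) l e

/-- The unit `X ⟶ R_L^H I_L^H X` of the adjunction between induction and restriction, as a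
morphism of `C`. -/
def indIn : X.obj ⟶ ((ind R).obj X).obj :=
  inv (X.μ R.base) ≫ indBaseι R X

/-- The counit `R_L^H I_L^H X ⟶ X` of the adjunction between restriction and induction, as a
morphism of `C`. -/
def indOut : ((ind R).obj X).obj ⟶ X.obj :=
  indBaseπ R X ≫
    X.μ R.base

theorem act_indIn (q : H ⧸ L.subgroupOf H) :
    ((ind R).obj X).act (R.rep q) (indIn R X) = indι R X q := by
  rw [indIn, ← comp_act, act_indBaseι R X (R.rep q) q (R.mk_rep q) R.base rfl,
    twist_eq X _ _ _ _ _ rfl rfl rfl]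
  simp

theorem isResHom_indIn (hL : L ≤ H) : IsResHom hL X ((ind R).obj X) (indIn R X) := fun l => by
  have e : (l : G) * R.base = R.base * ((R.base⁻¹ * l * R.base : L) : G) := by
    simp only [Subgroup.coe_mul, Subgroup.coe_inv]
    group
  have hid : IsResHom le_rfl X X (𝟙 X.obj) := fun l => by rw [act_id, Category.comp_id]
  have h2 := twist_act hid l R.base R.base (l * R.base) _ e rfl
  rw [act_id, act_id, ← X.μ_mul] at h2
  rw [indIn, ← comp_act, act_indBaseι_of_mem R X ⟨l, hL l.2⟩ l.2 _ e, ← Category.assoc,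
    ← Category.assoc]
  congr 1
  rw [← cancel_mono (X.μ R.base), Category.assoc, Category.assoc, IsIso.inv_hom_id]
  refine (congrArg (_ ≫ ·) h2).trans ?_
  rw [← Functor.map_comp_assoc, IsIso.inv_hom_id]
  simp

theorem indIn_indOut : indIn R X ≫ indOut R X = 𝟙 X.obj := by
  rw [indIn, indOut, Category.assoc, indBaseι_π_assoc, IsIso.inv_hom_id]

theorem act_indIn_indOut (g : H) (hg : (g : G) ∉ L) :
    ((ind R).obj X).act g (indIn R X) ≫ indOut R X = 0 := by
  rw [indIn, indOut, ← comp_act, Category.assoc, ← Category.assoc (act _ _ _),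
    act_indBaseι_π R X g hg, zero_comp, comp_zero]

theorem conjEnd_indOut_indIn (g : H) (q : H ⧸ L.subgroupOf H) (hq : (g : H ⧸ L.subgroupOf H) = q) :
    ((ind R).obj X).conjEnd g (indOut R X ≫ indIn R X) = indπ R X q ≫ indι R X q := by
  obtain ⟨l, e⟩ : ∃ l : L, (g : G) * R.base = R.rep q * l :=
    exists_rep_mul R g _ q ((smul_mk_one g).trans hq)
  rw [conjEnd, IsIso.inv_comp_eq, indIn, indOut, Category.assoc, IsIso.hom_inv_id_assoc,
    ← comp_act, act_indBaseι R X _ q hq l e, ← Category.assoc, ← ind_μ_baseπ R X _ q hq l e,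
    Category.assoc]

/-- The conjugates of the idempotent `I_L^H X ⟶ X ⟶ I_L^H X` by representatives of the cosets of
`L` in `H` sum up to the identity. -/
theorem sum_conjEnd_indOut_indIn {J : Type*} [Fintype J] (γ : J → H)
    (hγ : Function.Bijective fun j => (γ j : H ⧸ L.subgroupOf H)) :
    ∑ j, ((ind R).obj X).conjEnd (γ j) (indOut R X ≫ indIn R X) = 𝟙 _ := by
  have := Fintype.ofFinite (H ⧸ L.subgroupOf H)
  rw [← sum_indπ_indι R X, ← (Equiv.ofBijective _ hγ).sum_comp]
  exact Finset.sum_congr rfl fun j _ => conjEnd_indOut_indIn R X _ _ rfl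

end

/-- Two morphisms from an induced object agree if they agree on `X`. -/
theorem ind_hom_ext {X : T.Equivariant L} {W : T.Equivariant H} {f g : (ind R).obj X ⟶ W}
    (h : indIn R X ≫ f.hom = indIn R X ≫ g.hom) : f = g := by
  refine Equivariant.hom_ext _ _ (indObj_hom_ext R X fun q => ?_)
  rw [← act_indIn, act_comp, act_comp, h]

section Desc

variable {R} {hL : L ≤ H} {X : T.Equivariant L} {W : T.Equivariant H}

variable (R) in
/-- The morphism of `C` underlying the morphism `I_L^H X ⟶ W` with restriction `f` to `X`. -/
def indDescHom (f : X.obj ⟶ W.obj) : ((ind R).obj X).obj ⟶ W.obj :=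
  biproduct.desc fun q => W.act (R.rep q) f

@[simp]
theorem indι_desc (f : X.obj ⟶ W.obj) (q) :
    indι R X q ≫ indDescHom R (W := W) f = W.act (R.rep q) f :=
  biproduct.ι_desc _ _

@[simp]
theorem indι_desc_assoc (f : X.obj ⟶ W.obj) (q) {Z : C} (h : W.obj ⟶ Z) :
    indι R X q ≫ indDescHom R (W := W) f ≫ h = W.act (R.rep q) f ≫ h := by
  simp only [← Category.assoc, indι_desc]

variable (R) in
/-- Frobenius reciprocity: the morphism `I_L^H X ⟶ W` of `C^H` attached to a morphism
`X ⟶ R_L^H W` of `C^L`. -/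
def indDesc {f : X.obj ⟶ W.obj} (hf : IsResHom hL X W f) : (ind R).obj X ⟶ W where
  hom := indDescHom R f
  comm h := map_indObj_hom_ext R X _ fun p => by
    obtain ⟨l, e⟩ := exists_rep_mul R h p _ rfl
    have h1 := act_indι R X h p _ rfl l e
    rw [act] at h1
    rw [← Functor.map_comp_assoc, indι_desc, reassoc_of% h1, indι_desc,
      twist_act hf _ _ _ (h * R.rep p) l e rfl]
    exact W.act_act rfl f

theorem indDesc_hom {f : X.obj ⟶ W.obj} (hf : IsResHom hL X W f) :
    (indDesc R hf).hom = indDescHom R f := rfl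

@[simp]
theorem indIn_desc {f : X.obj ⟶ W.obj} (hf : IsResHom hL X W f) :
    indIn R X ≫ (indDesc R hf).hom = f := by
  have h1 : indIn R X ≫ (indDesc R hf).hom = inv (X.μ R.base) ≫
      W.act ⟨R.base, hL R.base.2⟩ f := by
    rw [indIn, Category.assoc]
    exact congrArg (_ ≫ ·) (indι_desc f _)
  rw [h1, hf, IsIso.inv_hom_id_assoc]

@[simp]
theorem indIn_desc_assoc {f : X.obj ⟶ W.obj} (hf : IsResHom hL X W f) {Z : C} (h : W.obj ⟶ Z) :
    indIn R X ≫ (indDesc R hf).hom ≫ h = f ≫ h := by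
  simp only [← Category.assoc, indIn_desc]

variable (R) in
/-- The morphism `W ⟶ I_L^H X` attached to a morphism `p : W ⟶ X`: its component at the
representative `t` is `T^t p` after the inverse of `μ^t`. -/
def indLift (p : W.obj ⟶ X.obj) : W.obj ⟶ ((ind R).obj X).obj :=
  biproduct.lift fun q => inv (W.μ (R.rep q)) ≫ (T.fn (R.rep q)).map p

@[simp]
theorem indLift_π (p : W.obj ⟶ X.obj) (q) :
    indLift R (W := W) p ≫ indπ R X q = inv (W.μ (R.rep q)) ≫ (T.fn (R.rep q)).map p :=
  biproduct.lift_π _ _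

@[simp]
theorem indLift_π_assoc (p : W.obj ⟶ X.obj) (q) {Z : C} (h : (T.fn (R.rep q)).obj X.obj ⟶ Z) :
    indLift R (W := W) p ≫ indπ R X q ≫ h =
      inv (W.μ (R.rep q)) ≫ (T.fn (R.rep q)).map p ≫ h := by
  simp only [← Category.assoc, indLift_π]

theorem indLift_desc [Fintype (H ⧸ L.subgroupOf H)] (p : W.obj ⟶ X.obj) (f : X.obj ⟶ W.obj) :
    indLift R p ≫ indDescHom R f = ∑ q, W.conjEnd (R.rep q) (p ≫ f) := by
  rw [← Category.id_comp (indDescHom R f), ← sum_indπ_indι, Preadditive.sum_comp,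
    Preadditive.comp_sum]
  refine Finset.sum_congr rfl fun q _ => ?_
  rw [Category.assoc, indι_desc, indLift_π_assoc, comp_act, conjEnd]

theorem desc_indLift_eq_zero (f : X.obj ⟶ W.obj) {L' : Subgroup G}
    {R' : CosetReps L' H} {X' : T.Equivariant L'} (p : W.obj ⟶ X'.obj)
    (h : ∀ g, W.act g f ≫ p = 0) : indDescHom R f ≫ indLift R' p = 0 := by
  refine indObj_hom_ext R X fun r => biproduct.hom_ext _ _ fun s => ?_
  change _ ≫ indπ R' X' s = _ ≫ indπ R' X' s
  rw [indι_desc_assoc, Category.assoc, indLift_π,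
    act_inv_μ_map f p _ _ ((R'.rep s)⁻¹ * R.rep r) (by simp), h]
  simp

theorem desc_indLift (f : X.obj ⟶ W.obj) (p : W.obj ⟶ X.obj) (hfp : f ≫ p = 𝟙 _)
    (h : ∀ g : H, (g : G) ∉ L → W.act g f ≫ p = 0) : indDescHom R f ≫ indLift R p = 𝟙 _ := by
  refine indObj_hom_ext R X fun r => biproduct.hom_ext _ _ fun s => ?_
  change _ ≫ indπ R X s = (_ ≫ 𝟙 _) ≫ indπ R X s
  rw [Category.comp_id]
  by_cases hrs : r = s
  · subst hrs
    rw [indι_desc_assoc, Category.assoc, indLift_π, act, Category.assoc, IsIso.hom_inv_id_assoc,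
      ← Functor.map_comp, hfp, indι_π_self, CategoryTheory.Functor.map_id]
  · rw [indι_desc_assoc, Category.assoc, indLift_π,
      act_inv_μ_map f p _ _ ((R.rep s)⁻¹ * R.rep r) (by simp), h, indι_π_ne R X hrs]
    · simp
    · intro h'
      refine hrs ?_
      rw [← R.mk_rep r, ← R.mk_rep s]
      exact (QuotientGroup.eq.2 (Subgroup.mem_subgroupOf.2 h')).symm

/-- A criterion for `W` to be induced from a retract `X` of its restriction to `L`: the orbit of
the idempotent `W ⟶ X ⟶ W` consists of orthogonal idempotents with sum `1`. -/
theorem isIso_indDesc {f : X.obj ⟶ W.obj} (hf : IsResHom hL X W f) (p : W.obj ⟶ X.obj)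
    (hfp : f ≫ p = 𝟙 _) (h : ∀ g : H, (g : G) ∉ L → W.act g f ≫ p = 0)
    (hsum : letI := Fintype.ofFinite (H ⧸ L.subgroupOf H)
      ∑ q, W.conjEnd (R.rep q) (p ≫ f) = 𝟙 _) : IsIso (indDesc R hf) := by
  have : IsIso (indDesc R hf).hom := ⟨indLift R p, desc_indLift f p hfp h, by
    have := Fintype.ofFinite (H ⧸ L.subgroupOf H)
    rw [indDesc_hom, indLift_desc]
    convert hsum⟩
  exact isIso_of_isIso_hom _

end Desc

end Induction

end GroupAction

namespace GroupAction

attribute [local instance] GroupAction.additive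

open Equivariant

/-! ### Restriction and conjugation -/

section ConjRes

variable {G : Type t} [Group G] {C : Type u} [Category.{v} C] {T : GroupAction G C}

variable (T) in
/-- `R_H^H ≅ id`. -/
def resId (H : Subgroup G) : res (T := T) (le_refl H) ≅ 𝟭 (T.Equivariant H) :=
  NatIso.ofComponents (fun X => Equivariant.isoMk (Iso.refl X.obj) fun _ => map_id_comm _ _)
    fun _ => hom_ext _ _ ((Category.comp_id _).trans (Category.id_comp _).symm)

variable (T) in
/-- `R_J^H ≅ R_J^K R_K^H`. -/
def resComp {J K H : Subgroup G} (hJK : J ≤ K) (hKH : K ≤ H) :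
    res (T := T) (hJK.trans hKH) ≅ res hKH ⋙ res hJK :=
  NatIso.ofComponents (fun X => Equivariant.isoMk (X := (res (hJK.trans hKH)).obj X)
      (Y := (res hKH ⋙ res hJK).obj X) (Iso.refl X.obj) fun _ => map_id_comm _ _)
    fun _ => hom_ext _ _ ((Category.comp_id _).trans (Category.id_comp _).symm)

variable (T) in
/-- `c_{K,a} R_K^H ≅ R_{K'}^{H'} c_{H,a}`. -/
def conjRes (a : G) {K H K' H' : Subgroup G} (h : K ≤ H) (h' : K' ≤ H')
    (hK : K' = MulAut.conj a • K) (hH : H' = MulAut.conj a • H) :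
    res (T := T) h ⋙ conj a hK ≅ conj a hH ⋙ res h' :=
  NatIso.ofComponents (fun X => Equivariant.isoMk (X := (res h ⋙ conj a hK).obj X)
      (Y := (conj a hH ⋙ res h').obj X) (Iso.refl ((T.fn a).obj X.obj)) fun _ => map_id_comm _ _)
    fun _ => hom_ext _ _ ((Category.comp_id _).trans (Category.id_comp _).symm)

theorem isResHom_id {H : Subgroup G} (X : T.Equivariant H) : IsResHom le_rfl X X (𝟙 X.obj) :=
  fun l => by rw [act_id, Category.comp_id]

theorem twist_μ {H : Subgroup G} (X : T.Equivariant H) (g r s : H) (l : H)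
    (e : (g : G) * r = s * l) :
    twist X g r s l e ≫ X.μ s = (T.fn g).map (X.μ r) ≫ X.μ g := by
  have h := twist_act (isResHom_id X) g r s (g * r) l e rfl
  rw [act_id, act_id, ← X.μ_mul] at h
  exact h

theorem conjμ_eq (a : G) {H H' : Subgroup G} (h : H' = MulAut.conj a • H) (X : T.Equivariant H)
    (g : H') (g' : H) (e : (g : G) * a = a * g') : conjμ a h X g = twist X g a a g' e := by
  have : (⟨a⁻¹ * g * a, conj_mem h g⟩ : H) = g' := Subtype.ext (by
    simp only [mul_assoc, e, inv_mul_cancel_left])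
  subst this
  rfl

/-- The conjugate `T^a X` of the equivariant object `X`; this is the object function of `conj`,
as a reducible definition. -/
@[reducible]
def conjObj (a : G) {H H' : Subgroup G} (h : H' = MulAut.conj a • H) (X : T.Equivariant H) :
    T.Equivariant H' where
  obj := (T.fn a).obj X.obj
  μ := conjμ a h X
  isIso_μ := T.isIso_of_axioms _ _ (conjμ_mul a h X) (conjμ_one a h X)
  μ_mul := conjμ_mul a h X
  μ_one := conjμ_one a h X

variable (T) in
/-- `c_{H,a} ≅ id` for `a ∈ H`. -/
def conjId {H : Subgroup G} (a : G) (ha : a ∈ H) (h : H = MulAut.conj a • H) :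
    conj (T := T) a h ≅ 𝟭 (T.Equivariant H) :=
  NatIso.ofComponents (fun X => Equivariant.isoMk (X := (conj a h).obj X)
      (@asIso _ _ _ _ (X.μ ⟨a, ha⟩) (X.isIso_μ _))
      fun g => (twist_μ X g ⟨a, ha⟩ ⟨a, ha⟩ ⟨a⁻¹ * g * a, conj_mem h g⟩
        (by simp only [mul_assoc, mul_inv_cancel_left])).symm)
    fun f => hom_ext _ _ (f.comm ⟨a, ha⟩)

theorem conj_conj_μ {a b c : G} (e : a * b = c) {H H' H'' : Subgroup G} (X : T.Equivariant H)
    (hb : H' = MulAut.conj b • H)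
    (ha : H'' = MulAut.conj a • H') (hc : H'' = MulAut.conj c • H) (g : H'') :
    conjμ a ha (conjObj b hb X) g ≫ (T.mul a b c e).hom.app X.obj =
      (T.fn g).map ((T.mul a b c e).hom.app X.obj) ≫ conjμ c hc X g := by
  obtain ⟨g₁, hg₁⟩ : ∃ g₁ : H', (g : G) * a = a * g₁ := ⟨⟨_, conj_mem ha g⟩, by group⟩
  obtain ⟨g₂, hg₂⟩ : ∃ g₂ : H, (g₁ : G) * b = b * g₂ := ⟨⟨_, conj_mem hb g₁⟩, by group⟩
  have hg : (g : G) * c = c * g₂ := by rw [← e, ← mul_assoc, hg₁, mul_assoc, hg₂, mul_assoc]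
  rw [conjμ_eq a ha _ g g₁ hg₁, conjμ_eq c hc X g g₂ hg]
  have h1 : (conjObj b hb X).μ g₁ = twist X g₁ b b g₂ hg₂ := conjμ_eq b hb X g₁ g₂ hg₂
  have a1 := T.assoc g a b (g * a) c (g * c) rfl e (by rw [← e, mul_assoc]) rfl X.obj
  have a2 := T.assoc a g₁ b (g * a) (g₁ * b) (g * c) hg₁.symm rfl (by rw [← e, mul_assoc])
    (by rw [hg₂, ← mul_assoc, e, hg]) X.obj
  have a3 := T.assoc a b g₂ c (g₁ * b) (g * c) e hg₂.symm hg.symm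
    (by rw [hg₂, ← mul_assoc, e, hg]) X.obj
  have n1 := mul_naturality (T := T) e (X.μ g₂)
  rw [twist_eq _ (g : G) a a (g * a) g₁ hg₁ rfl hg₁.symm, h1,
    twist_eq X g₁ b b (g₁ * b) g₂ hg₂ rfl hg₂.symm,
    twist_eq X g c c (g * c) g₂ hg rfl hg.symm]
  simp only [Functor.map_comp, Category.assoc]
  rw [n1, ← reassoc_of% a1]
  congr 1
  rw [← cancel_epi ((T.mul a g₁ (g * a) hg₁.symm).hom.app ((T.fn b).obj X.obj)),
    reassoc_of% a2, Iso.hom_inv_id_app_assoc]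
  congr 1
  rw [← cancel_epi ((T.fn a).map ((T.mul b g₂ (g₁ * b) hg₂.symm).hom.app X.obj)),
    ← reassoc_of% a3, Iso.hom_inv_id_app_assoc, ← Functor.map_comp_assoc, Iso.hom_inv_id_app,
    CategoryTheory.Functor.map_id]
  exact Category.id_comp _

variable (T) in
/-- `c_{H,ab} ≅ c_{bHb⁻¹,a} c_{H,b}`. -/
def conjComp (a b c : G) (e : a * b = c) {H H' H'' : Subgroup G} (hb : H' = MulAut.conj b • H)
    (ha : H'' = MulAut.conj a • H') (hc : H'' = MulAut.conj c • H) :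
    conj (T := T) c hc ≅ conj b hb ⋙ conj a ha :=
  NatIso.ofComponents (fun X => (Equivariant.isoMk (X := (conj b hb ⋙ conj a ha).obj X)
      (Y := (conj c hc).obj X) ((T.mul a b c e).app X.obj)
      fun g => (conj_conj_μ e X hb ha hc g).symm).symm)
    fun f => hom_ext _ _ ((T.mul a b c e).inv.naturality f.hom)

section Act

variable (a : G) {H H' L L' : Subgroup G} (hH : H' = MulAut.conj a • H)

theorem act_conj (W : T.Equivariant H)
    (g : H') (g' : H) (e : (g : G) * a = a * g') {X : C} (f : X ⟶ W.obj) :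
    (conjObj a hH W).act g ((T.fn a).map f) = (T.mul g a (g * a) rfl).hom.app X ≫
      (T.mul a g' (g * a) e.symm).inv.app X ≫ (T.fn a).map (W.act g' f) := by
  have h1 : (conjObj a hH W).μ g = _ := (conjμ_eq a hH W g g' e).trans
    (twist_eq W g a a (g * a) g' e rfl e.symm)
  have n := (T.mul a g' (g * a) e.symm).inv.naturality f
  dsimp only [Functor.comp_map] at n
  rw [act, h1, ← Category.assoc, mul_naturality, Category.assoc, act, Functor.map_comp,
    reassoc_of% n]

theorem conjEnd_conj (W : T.Equivariant H)
    (g : H') (g' : H) (e : (g : G) * a = a * g') (f : W.obj ⟶ W.obj) :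
    (conjObj a hH W).conjEnd g ((T.fn a).map f) = (T.fn a).map (W.conjEnd g' f) := by
  have h1 : (conjObj a hH W).μ g = _ := (conjμ_eq a hH W g g' e).trans
    (twist_eq W g a a (g * a) g' e rfl e.symm)
  rw [conjEnd, IsIso.inv_comp_eq, act_conj a hH W g g' e, h1, Category.assoc, Category.assoc,
    ← Functor.map_comp, conjEnd, IsIso.hom_inv_id_assoc]

variable {a} in
theorem mem_iff_of_eq_conj (hL : L' = MulAut.conj a • L) {x : G} : x ∈ L' ↔ a⁻¹ * x * a ∈ L := by
  subst hL
  rw [Subgroup.mem_pointwise_smul_iff_inv_smul_mem]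
  simp [← map_inv]

end Act

end ConjRes

/-! ### Transitivity of induction and compatibility with conjugation -/

section Induction

variable {G : Type t} [Group G] {C : Type u} [Category.{v} C] {T : GroupAction G C}
  [Finite G] [Preadditive C] [HasFiniteBiproducts C] {J K L H : Subgroup G}

theorem indIn_map (R : CosetReps L H) {X Y : T.Equivariant L} (f : X ⟶ Y) :
    indIn R X ≫ ((ind R).map f).hom = f.hom ≫ indIn R Y := by
  have h1 : indBaseι R X ≫ ((ind R).map f).hom = (T.fn R.base).map f.hom ≫ indBaseι R Y :=
    biproduct.ι_map (fun q => (T.fn (R.rep q)).map f.hom) ((1 : H) : H ⧸ L.subgroupOf H)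
  rw [indIn, indIn, Category.assoc, h1, IsIso.inv_comp_eq, ← reassoc_of% f.comm,
    IsIso.hom_inv_id_assoc]

theorem indIn_map_assoc (R : CosetReps L H) {X Y : T.Equivariant L} (f : X ⟶ Y) {Z : C}
    (h : ((ind R).obj Y).obj ⟶ Z) :
    indIn R X ≫ ((ind R).map f).hom ≫ h = f.hom ≫ indIn R Y ≫ h := by
  simp only [← Category.assoc, indIn_map]

/-- The morphism `I_H^H X ⟶ X` extending the identity. -/
def indIdHom (R : CosetReps H H) (X : T.Equivariant H) : (ind R).obj X ⟶ X :=
  indDesc R (isResHom_id X)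

/-- The unit `X ⟶ I_H^H X`. -/
def indIdInv (R : CosetReps H H) (X : T.Equivariant H) : X ⟶ (ind R).obj X :=
  ⟨indIn R X, isResHom_indIn R X le_rfl⟩

@[simp]
theorem indIn_indIdHom (R : CosetReps H H) (X : T.Equivariant H) :
    indIn R X ≫ (indIdHom R X).hom = 𝟙 X.obj := indIn_desc _

@[simp]
theorem indIn_indIdHom_assoc (R : CosetReps H H) (X : T.Equivariant H) {Z : C} (h : X.obj ⟶ Z) :
    indIn R X ≫ (indIdHom R X).hom ≫ h = h := by
  simp only [← Category.assoc, indIn_indIdHom, Category.id_comp]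

theorem indIdInv_hom (R : CosetReps H H) (X : T.Equivariant H) :
    (indIdInv R X).hom = indIn R X := rfl

/-- `I_H^H ≅ id`. -/
def indId (R : CosetReps H H) : ind (T := T) R ≅ 𝟭 (T.Equivariant H) :=
  NatIso.ofComponents (fun X =>
    { hom := indIdHom R X
      inv := indIdInv R X
      hom_inv_id := ind_hom_ext R (by
        rw [comp_hom, indIn_indIdHom_assoc, indIdInv_hom]
        exact (Category.comp_id _).symm)
      inv_hom_id := hom_ext _ _ (indIn_indIdHom _ _) })
    fun {X Y} f => ind_hom_ext R (by
      change indIn R X ≫ ((ind R).map f).hom ≫ (indIdHom R Y).hom =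
        indIn R X ≫ (indIdHom R X).hom ≫ f.hom
      rw [indIn_map_assoc, indIn_indIdHom, indIn_indIdHom_assoc, Category.comp_id])

section Comp

variable (hJK : J ≤ K) (hKH : K ≤ H) (R : CosetReps J H) (R₁ : CosetReps J K)
    (R₂ : CosetReps K H) (X : T.Equivariant J)

/-- The morphism `I_J^H X ⟶ I_K^H I_J^K X` extending the units `X ⟶ I_J^K X ⟶ I_K^H I_J^K X`. -/
def indCompHom : (ind R).obj X ⟶ (ind R₂).obj ((ind R₁).obj X) :=
  indDesc R ((isResHom_indIn R₁ X hJK).trans (isResHom_indIn R₂ _ hKH))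

@[simp]
theorem indIn_indCompHom : indIn R X ≫ (indCompHom hJK hKH R R₁ R₂ X).hom =
    indIn R₁ X ≫ indIn R₂ ((ind R₁).obj X) := indIn_desc _

@[simp]
theorem indIn_indCompHom_assoc {Z : C} (h : ((ind R₂).obj ((ind R₁).obj X)).obj ⟶ Z) :
    indIn R X ≫
    (indCompHom hJK hKH R R₁ R₂ X).hom ≫ h = indIn R₁ X ≫ indIn R₂ ((ind R₁).obj X) ≫ h := by
  simp only [← Category.assoc, indIn_indCompHom]

/-- The morphism `I_J^K X ⟶ R_K^H I_J^H X` extending the unit. -/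
def indCompAux : (ind R₁).obj X ⟶ (res hKH).obj ((ind R).obj X) :=
  indDesc R₁ (hL := hJK) (W := (res hKH).obj ((ind R).obj X)) (f := indIn R X)
    (isResHom_indIn R X (hJK.trans hKH))

/-- The inverse of `indCompHom`. -/
def indCompInv : (ind R₂).obj ((ind R₁).obj X) ⟶ (ind R).obj X :=
  indDesc R₂ (f := (indCompAux hJK hKH R R₁ X).hom) (isResHom_hom hKH _)

theorem indIn_indCompInv : indIn R₁ X ≫ indIn R₂ ((ind R₁).obj X) ≫
    (indCompInv hJK hKH R R₁ R₂ X).hom = indIn R X :=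
  (congrArg (indIn R₁ X ≫ ·) (indIn_desc _)).trans (indIn_desc _)

include hKH in
/-- A morphism from `I_K^H I_J^K X` is determined by its restriction to `X`. -/
theorem ind_ind_hom_ext {W : T.Equivariant H} {f g : (ind R₂).obj ((ind R₁).obj X) ⟶ W}
    (h : indIn R₁ X ≫ indIn R₂ ((ind R₁).obj X) ≫ f.hom =
      indIn R₁ X ≫ indIn R₂ ((ind R₁).obj X) ≫ g.hom) : f = g := by
  refine ind_hom_ext R₂ ?_
  let i : (ind R₁).obj X ⟶ (res hKH).obj ((ind R₂).obj ((ind R₁).obj X)) :=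
    ⟨indIn R₂ ((ind R₁).obj X), isResHom_indIn R₂ _ hKH⟩
  exact congrArg Hom.hom (ind_hom_ext R₁ (f := i ≫ (res hKH).map f) (g := i ≫ (res hKH).map g) h)

/-- `I_J^H ≅ I_K^H I_J^K`. -/
def indComp : ind (T := T) R ≅ ind R₁ ⋙ ind R₂ :=
  NatIso.ofComponents (fun X =>
    { hom := indCompHom hJK hKH R R₁ R₂ X
      inv := indCompInv hJK hKH R R₁ R₂ X
      hom_inv_id := ind_hom_ext R (by
        rw [comp_hom, indIn_indCompHom_assoc, indIn_indCompInv]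
        exact (Category.comp_id _).symm)
      inv_hom_id := ind_ind_hom_ext hKH R₁ R₂ X (by
        have h := indIn_indCompInv hJK hKH R R₁ R₂ X
        rw [comp_hom, reassoc_of% h, indIn_indCompHom]
        exact congrArg (indIn R₁ X ≫ ·) (Category.comp_id _).symm) })
    fun {X Y} f => ind_hom_ext R (by
      change indIn R X ≫ ((ind R).map f).hom ≫ (indCompHom hJK hKH R R₁ R₂ Y).hom =
        indIn R X ≫ (indCompHom hJK hKH R R₁ R₂ X).hom ≫ ((ind R₂).map ((ind R₁).map f)).hom
      rw [indIn_map_assoc, indIn_indCompHom, indIn_indCompHom_assoc, indIn_map, indIn_map_assoc])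

end Comp

section Conj

variable (a : G) {H' L' : Subgroup G} (hH : H' = MulAut.conj a • H)
  (hL : L' = MulAut.conj a • L) (h : L ≤ H) (h' : L' ≤ H') (R : CosetReps L H)
  (R' : CosetReps L' H') (X : T.Equivariant L)

theorem isResHom_conj_indIn (a : G) {H' L' : Subgroup G} (hH : H' = MulAut.conj a • H)
    (hL : L' = MulAut.conj a • L) (h : L ≤ H) (h' : L' ≤ H') (R : CosetReps L H)
    (X : T.Equivariant L) :
    IsResHom h' (conjObj a hL X) (conjObj a hH ((ind R).obj X)) ((T.fn a).map (indIn R X)) :=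
  fun l => ((conj a hL).map (⟨indIn R X, isResHom_indIn R X h⟩ :
    X ⟶ (res h).obj ((ind R).obj X))).comm l

/-- The inverse of the isomorphism `c_{H,a} I_L^H X ⟶ I_{L'}^{H'} c_{L,a} X`: it extends the
conjugate of the unit. -/
def conjIndInv : (ind R').obj (conjObj a hL X) ⟶ conjObj a hH ((ind R).obj X) :=
  indDesc R' (isResHom_conj_indIn a hH hL h h' R X)

@[simp]
theorem indIn_conjIndInv : indIn R' (conjObj a hL X) ≫ (conjIndInv a hH hL h h' R R' X).hom =
    (T.fn a).map (indIn R X) := indIn_desc _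

theorem indIn_conjIndInv_assoc {Z : C} (f : (T.fn a).obj ((ind R).obj X).obj ⟶ Z) :
    indIn R' (conjObj a hL X) ≫ (conjIndInv a hH hL h h' R R' X).hom ≫ f =
      (T.fn a).map (indIn R X) ≫ f :=
  indIn_desc_assoc (isResHom_conj_indIn a hH hL h h' R X) f

/-- Conjugation by `a` carries the cosets of `L` in `H` to those of `L'` in `H'`, and `T^a` carries
the conjugates of the idempotent of `I_L^H X` to conjugates of its image in `T^a I_L^H X`. -/
instance isIso_conjIndInv : IsIso (conjIndInv a hH hL h h' R R' X) := by
  have hmem (g : H') : a⁻¹ * g * a ∈ H := conj_mem hH g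
  let c (g : H') : H := ⟨a⁻¹ * g * a, hmem g⟩
  have hc (g : H') : (g : G) * a = a * c g := by simp only [c]; group
  refine isIso_indDesc _ ((T.fn a).map (indOut R X)) ?_ ?_ ?_
  · rw [← Functor.map_comp, indIn_indOut]
    exact (T.fn a).map_id _
  · intro g hg
    rw [act_conj a hH _ g (c g) (hc g), Category.assoc, Category.assoc, ← Functor.map_comp,
      act_indIn_indOut R X (c g) fun hg' => hg ((mem_iff_of_eq_conj hL).2 hg')]
    simp
  · let := Fintype.ofFinite (H' ⧸ L'.subgroupOf H')
    -- conjugating by `g` on `T^a I_L^H X` is `T^a` of conjugating by `c g` on `I_L^H X`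
    rw [← Functor.map_comp]
    simp only [fun q => conjEnd_conj a hH ((ind R).obj X) (R'.rep q) (c (R'.rep q)) (hc _)]
    rw [← Functor.map_sum, sum_conjEnd_indOut_indIn R X]
    · exact (T.fn a).map_id _
    · have hmk (g g' : H') : ((c g : H ⧸ L.subgroupOf H) = c g') ↔
          (g : H' ⧸ L'.subgroupOf H') = g' := by
        rw [QuotientGroup.eq, QuotientGroup.eq, Subgroup.mem_subgroupOf, Subgroup.mem_subgroupOf,
          mem_iff_of_eq_conj hL]
        simp only [c, Subgroup.coe_mul, Subgroup.coe_inv]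
        group
      refine ⟨fun q q' hq => ?_, fun q => ?_⟩
      · rw [← R'.mk_rep q, ← R'.mk_rep q']
        exact (hmk _ _).1 hq
      · obtain ⟨y, rfl⟩ := QuotientGroup.mk_surjective q
        have hy : a * y * a⁻¹ ∈ H' := (mem_iff_of_eq_conj hH).2 (by
          simp only [mul_assoc, inv_mul_cancel_left, inv_mul_cancel, mul_one]; exact y.2)
        have : c ⟨_, hy⟩ = y := Subtype.ext (by simp only [c]; group)
        refine ⟨((⟨_, hy⟩ : H') : H' ⧸ L'.subgroupOf H'), ?_⟩
        exact ((hmk _ _).2 (R'.mk_rep _)).trans (congrArg _ this)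

/-- The isomorphism `c_{H,a} I_L^H X ⟶ I_{L'}^{H'} c_{L,a} X`. -/
def conjIndHom : conjObj a hH ((ind R).obj X) ⟶ (ind R').obj (conjObj a hL X) :=
  inv (conjIndInv a hH hL h h' R R' X)

theorem map_indIn_conjIndHom : (T.fn a).map (indIn R X) ≫
    (conjIndHom a hH hL h h' R R' X).hom = indIn R' (conjObj a hL X) := by
  rw [← indIn_conjIndInv a hH hL h h' R R' X, Category.assoc, ← comp_hom, conjIndHom,
    IsIso.hom_inv_id, id_hom, Category.comp_id]

theorem map_indIn_conjIndHom_assoc {Z : C} (f : ((ind R').obj (conjObj a hL X)).obj ⟶ Z) :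
    (T.fn a).map (indIn R X) ≫ (conjIndHom a hH hL h h' R R' X).hom ≫ f =
      indIn R' (conjObj a hL X) ≫ f := by
  rw [← Category.assoc, map_indIn_conjIndHom]

/-- `c_{H,a} I_L^H ≅ I_{L'}^{H'} c_{L,a}`. -/
def conjInd : ind (T := T) R ⋙ conj a hH ≅ conj a hL ⋙ ind R' :=
  (NatIso.ofComponents (fun X =>
    { hom := conjIndInv a hH hL h h' R R' X
      inv := conjIndHom a hH hL h h' R R' X
      hom_inv_id := (asIso (conjIndInv a hH hL h h' R R' X)).hom_inv_id
      inv_hom_id := (asIso (conjIndInv a hH hL h h' R R' X)).inv_hom_id })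
    fun {X Y} f => ind_hom_ext R' (by
      change indIn R' (conjObj a hL X) ≫ ((ind R').map ((conj a hL).map f)).hom ≫
          (conjIndInv a hH hL h h' R R' Y).hom =
        indIn R' (conjObj a hL X) ≫ (conjIndInv a hH hL h h' R R' X).hom ≫
          (T.fn a).map ((ind R).map f).hom
      have h1 := indIn_map_assoc R' ((conj a hL).map f) (conjIndInv a hH hL h h' R R' Y).hom
      refine h1.trans ?_
      rw [indIn_conjIndInv_assoc, ← Functor.map_comp, indIn_map, Functor.map_comp]
      exact congrArg ((T.fn a).map f.hom ≫ ·) (indIn_conjIndInv a hH hL h h' R R' Y))).symm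

variable {X} in
/-- A morphism from `c_{H,a} I_L^H X` is determined by its restriction to `T^a X`. -/
theorem conj_ind_hom_ext (hL : L' = MulAut.conj a • L) (h : L ≤ H) (h' : L' ≤ H')
    (R' : CosetReps L' H') {W : T.Equivariant H'}
    {f g : conjObj a hH ((ind R).obj X) ⟶ W}
    (hfg : (T.fn a).map (indIn R X) ≫ f.hom = (T.fn a).map (indIn R X) ≫ g.hom) : f = g := by
  rw [← cancel_epi (conjIndInv a hH hL h h' R R' X)]
  refine ind_hom_ext R' ?_
  rwa [comp_hom, comp_hom, indIn_conjIndInv_assoc, indIn_conjIndInv_assoc]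

end Conj

end Induction
end GroupAction

/-! ### The Mackey decomposition -/

section Decomposition

variable {M : Type u₁} [Category.{v₁} M] {N : Type u₂} [Category.{v₂} N] [Preadditive N]
  [HasFiniteBiproducts N] {ι : Type w} [Fintype ι] {F : M ⥤ N} {F' : ι → (M ⥤ N)}

/-- A direct sum decomposition of a functor from natural inclusions which are jointly an
isomorphism at every object. -/
def DirectSumDecomposition.ofIsIso (incl : ∀ i, F' i ⟶ F)
    (h : ∀ X, IsIso (biproduct.desc fun i => (incl i).app X)) : DirectSumDecomposition F F' where
  proj i :=
    { app X := inv (biproduct.desc fun i => (incl i).app X) ≫ biproduct.π (fun i => (F' i).obj X) i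
      naturality X Y f := by
        rw [← cancel_epi (biproduct.desc fun i => (incl i).app X), Category.assoc,
          IsIso.hom_inv_id_assoc]
        refine biproduct.hom_ext' _ _ fun j => ?_
        rw [biproduct.ι_desc_assoc, ← NatTrans.naturality_assoc]
        have h1 : (incl j).app Y ≫ inv (biproduct.desc fun i => (incl i).app Y) =
            biproduct.ι (fun i => (F' i).obj Y) j := by
          rw [IsIso.comp_inv_eq, biproduct.ι_desc]
        rw [reassoc_of% h1]
        by_cases hij : j = i
        · subst hij
          rw [biproduct.ι_π_self, biproduct.ι_π_self_assoc, Category.comp_id]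
        · rw [biproduct.ι_π_ne _ hij, biproduct.ι_π_ne_assoc _ hij, comp_zero, zero_comp] }
  incl := incl
  incl_proj i := by
    ext X
    have h1 : (incl i).app X ≫ inv (biproduct.desc fun i => (incl i).app X) =
        biproduct.ι (fun i => (F' i).obj X) i := by
      rw [IsIso.comp_inv_eq, biproduct.ι_desc]
    rw [NatTrans.comp_app, reassoc_of% h1, biproduct.ι_π_self, NatTrans.id_app]
  incl_proj_ne i j hij X := by
    have h1 : (incl i).app X ≫ inv (biproduct.desc fun i => (incl i).app X) =
        biproduct.ι (fun i => (F' i).obj X) i := by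
      rw [IsIso.comp_inv_eq, biproduct.ι_desc]
    rw [reassoc_of% h1, biproduct.ι_π_ne _ hij]
  total X := by
    have h1 (i : ι) : (inv (biproduct.desc fun i => (incl i).app X) ≫
        biproduct.π (fun i => (F' i).obj X) i) ≫ (incl i).app X =
        inv (biproduct.desc fun i => (incl i).app X) ≫
          (biproduct.π (fun i => (F' i).obj X) i ≫ biproduct.ι (fun i => (F' i).obj X) i) ≫
            biproduct.desc fun i => (incl i).app X := by
      simp only [Category.assoc, biproduct.ι_desc]
    rw [Finset.sum_congr rfl fun i _ => h1 i, ← Preadditive.comp_sum, ← Preadditive.sum_comp,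
      sum_biproduct_π_comp_ι, Category.id_comp, IsIso.inv_hom_id]

end Decomposition

namespace GroupAction

attribute [local instance] GroupAction.additive

open Equivariant

section Mackey

variable {G : Type t} [Group G] [Finite G] {C : Type u} [Category.{v} C] {T : GroupAction G C}
  [Preadditive C] [HasFiniteBiproducts C]

omit [Finite G] in
theorem Equivariant.isIso_desc {L : Subgroup G} {ι : Type t} [Fintype ι]
    {A : ι → T.Equivariant L} {W : T.Equivariant L} (i : ∀ x, A x ⟶ W)
    (p : ∀ x, W.obj ⟶ (A x).obj) (h₁ : ∀ x, (i x).hom ≫ p x = 𝟙 _)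
    (h₂ : ∀ x y, x ≠ y → (i x).hom ≫ p y = 0) (h₃ : ∑ x, p x ≫ (i x).hom = 𝟙 _) :
    IsIso (biproduct.desc i) := by
  have h₄ (x : ι) : (biproduct.ι A x).hom ≫ (biproduct.desc i).hom = (i x).hom :=
    congrArg Hom.hom (biproduct.ι_desc i x)
  have : IsIso (biproduct.desc i).hom := by
    refine ⟨∑ x, p x ≫ (biproduct.ι A x).hom, ?_, ?_⟩
    · refine map_biproduct_hom_ext A (forget T L) fun y => ?_
      change (biproduct.ι A y).hom ≫ _ ≫ _ = (biproduct.ι A y).hom ≫ 𝟙 _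
      rw [reassoc_of% h₄, Preadditive.comp_sum, Finset.sum_eq_single y, reassoc_of% h₁,
        Category.comp_id]
      · intro x _ hx
        rw [← Category.assoc, h₂ _ _ hx.symm, zero_comp]
      · exact fun h => absurd (Finset.mem_univ y) h
    · simp only [Preadditive.sum_comp, Category.assoc, h₄, h₃]
  exact isIso_of_isIso_hom _

variable {L K H : Subgroup G} (hL : L ≤ H) (hK : K ≤ H) (R : CosetReps K H) (X : T.Equivariant K)

/-- The restriction to `xKx⁻¹ ⊓ L` of the conjugate `T^x X`, as a reducible definition. -/
@[reducible]
def mackeyObj (L : Subgroup G) (x : G) (X : T.Equivariant K) :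
    T.Equivariant (MulAut.conj x • K ⊓ L) where
  obj := (T.fn x).obj X.obj
  μ g := conjμ x rfl X ⟨g, inf_le_left (a := MulAut.conj x • K) g.2⟩
  isIso_μ := ((res (inf_le_left : MulAut.conj x • K ⊓ L ≤ MulAut.conj x • K)).obj
    ((conj x rfl).obj X)).isIso_μ
  μ_mul := ((res (inf_le_left : MulAut.conj x • K ⊓ L ≤ MulAut.conj x • K)).obj
    ((conj x rfl).obj X)).μ_mul
  μ_one := ((res (inf_le_left : MulAut.conj x • K ⊓ L ≤ MulAut.conj x • K)).obj
    ((conj x rfl).obj X)).μ_one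

/-- The morphism `T^x X ⟶ I_K^H X` given by the equivariant structure and the unit. -/
def mackeyIn (x : H) : (T.fn x).obj X.obj ⟶ ((ind R).obj X).obj :=
  ((ind R).obj X).act x (indIn R X)

/-- The retraction of `mackeyIn`. -/
def mackeyOut (x : H) : ((ind R).obj X).obj ⟶ (T.fn x).obj X.obj :=
  inv (((ind R).obj X).μ x) ≫ (T.fn x).map (indOut R X)

include hK in
theorem isResHom_mackeyIn (x : H) :
    IsResHom (inf_le_right : MulAut.conj (x : G) • K ⊓ L ≤ L) (mackeyObj L x X)
      ((res hL).obj ((ind R).obj X)) (mackeyIn R X x) := fun l => by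
  let l' : H := ⟨l, hL (inf_le_right (a := MulAut.conj (x : G) • K) l.2)⟩
  change ((ind R).obj X).act l' (mackeyIn R X x) = _
  have h1 := twist_act (isResHom_indIn R X hK) l x x (l' * x)
    ⟨(x : G)⁻¹ * l * x, (mem_iff_of_eq_conj rfl).1 (inf_le_left (a := MulAut.conj (x : G) • K) l.2)⟩
    (by group) rfl
  rw [mackeyIn, act_act (gh := l' * x) _ rfl]
  exact h1.symm

theorem mackeyIn_out (x : H) : mackeyIn R X x ≫ mackeyOut R X x = 𝟙 _ := by
  rw [mackeyIn, mackeyOut, act, Category.assoc, IsIso.hom_inv_id_assoc, ← Functor.map_comp,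
    indIn_indOut, CategoryTheory.Functor.map_id]

theorem mackeyIn_naturality {X Y : T.Equivariant K} (x : H) (f : X ⟶ Y) :
    (T.fn x).map f.hom ≫ mackeyIn R Y x = mackeyIn R X x ≫ ((ind R).map f).hom := by
  rw [mackeyIn, mackeyIn, act_comp, indIn_map, comp_act]

theorem mackeyOut_in (x : H) : mackeyOut R X x ≫ mackeyIn R X x =
    ((ind R).obj X).conjEnd x (indOut R X ≫ indIn R X) := by
  rw [mackeyIn, mackeyOut, Category.assoc, comp_act, conjEnd]

theorem act_mackeyIn_out (g x y : H) (h : (x : G)⁻¹ * g * y ∉ K) :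
    ((ind R).obj X).act g (mackeyIn R X y) ≫ mackeyOut R X x = 0 := by
  rw [mackeyIn, mackeyOut, act_act (gh := g * y) _ rfl, Category.assoc,
    act_inv_μ_map (indIn R X) _ x (g * y) (x⁻¹ * g * y)
      (by simp only [Subgroup.coe_mul, Subgroup.coe_inv]; group), act_indIn_indOut R X _ h]
  simp

omit [Finite G] in
theorem _root_.IsDoubleCosetReps.mem {S : Finset G} (hS : IsDoubleCosetReps L K H S) {x : G}
    (hx : x ∈ S) : x ∈ H :=
  hS.1 x hx

omit [Finite G] in
/-- The double cosets `L x K` are disjoint unions of left cosets of `K` indexed by the left cosets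
of `xKx⁻¹ ⊓ L` in `L`. -/
theorem bijective_mackey {S : Finset G} (hS : IsDoubleCosetReps L K H S)
    (R' : ∀ x : S, CosetReps (MulAut.conj x.1 • K ⊓ L) L) :
    Function.Bijective fun j : Σ x : S, L ⧸ (MulAut.conj x.1 • K ⊓ L).subgroupOf L =>
      (((⟨(R' j.1).rep j.2, hL ((R' j.1).rep j.2).2⟩ : H) * ⟨j.1, hS.mem j.1.2⟩ : H) :
        H ⧸ K.subgroupOf H) := by
  constructor
  · rintro ⟨x, q⟩ ⟨x', q'⟩ h
    have h1 : (((R' x).rep q : G) * x)⁻¹ * ((R' x').rep q' * x') ∈ K :=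
      Subgroup.mem_subgroupOf.1 (QuotientGroup.eq.1 h)
    obtain ⟨z, -, hz⟩ := hS.2 x' (hS.mem x'.2)
    have hx : x = x' := by
      refine Subtype.ext ((hz x ⟨x.2, (((R' x').rep q')⁻¹ * (R' x).rep q : L), Subtype.mem _, _, h1,
        ?_⟩).trans (hz x' ⟨x'.2, 1, L.one_mem, 1, K.one_mem, by simp⟩).symm)
      simp only [Subgroup.coe_mul, Subgroup.coe_inv]
      group
    subst hx
    have hq : q = q' := by
      rw [← (R' x).mk_rep q, ← (R' x).mk_rep q', QuotientGroup.eq, Subgroup.mem_subgroupOf]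
      refine Subgroup.mem_inf.2 ⟨(mem_iff_of_eq_conj rfl).2 ?_, Subtype.mem _⟩
      simp only [Subgroup.coe_mul, Subgroup.coe_inv]
      convert h1 using 1
      group
    rw [hq]
  · intro q
    obtain ⟨g, rfl⟩ := QuotientGroup.mk_surjective q
    obtain ⟨x, ⟨hx, l, hl, y, hy, e⟩, -⟩ := hS.2 g g.2
    let q : L ⧸ (MulAut.conj x • K ⊓ L).subgroupOf L := ((⟨l, hl⟩ : L) : _)
    refine ⟨⟨⟨x, hx⟩, q⟩, ?_⟩
    have h1 : ((R' ⟨x, hx⟩).rep q : G)⁻¹ * l ∈ MulAut.conj x • K ⊓ L :=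
      Subgroup.mem_subgroupOf.1 (QuotientGroup.eq.1 ((R' ⟨x, hx⟩).mk_rep q))
    have h2 := K.mul_mem ((mem_iff_of_eq_conj rfl).1 (Subgroup.mem_inf.1 h1).1) hy
    refine QuotientGroup.eq.2 (Subgroup.mem_subgroupOf.2 ?_)
    simp only [Subgroup.coe_mul, Subgroup.coe_inv, e]
    convert h2 using 1
    group

section

variable {S : Finset G} (hS : IsDoubleCosetReps L K H S)
  (R' : ∀ x : G, CosetReps (MulAut.conj x • K ⊓ L) L)

/-- The inclusion of the summand at `x` in the Mackey decomposition: the morphism extending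
`mackeyIn`. -/
def mackeyIncl (x : H) (R' : CosetReps (MulAut.conj (x : G) • K ⊓ L) L) :
    (ind R').obj (mackeyObj L x X) ⟶ (res hL).obj ((ind R).obj X) :=
  indDesc R' (isResHom_mackeyIn hL hK R X x)

theorem indIn_mackeyIncl (x : H) (R' : CosetReps (MulAut.conj (x : G) • K ⊓ L) L) :
    indIn R' (mackeyObj L x X) ≫ (mackeyIncl hL hK R X x R').hom = mackeyIn R X x :=
  indIn_desc _

/-- The conjugates of the idempotent `I_K^H X ⟶ X ⟶ I_K^H X` by representatives of `H / K` are
orthogonal with sum `1`; by `bijective_mackey` they can be taken to be the `g x`, where `x` runs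
through the double cosets and `g` through `L / (xKx⁻¹ ⊓ L)`. The partial sum for fixed `x` is the
idempotent of the summand indexed by `x`. -/
theorem isIso_desc_mackeyIncl : IsIso (biproduct.desc fun x : S =>
    mackeyIncl hL hK R X ⟨x, hS.mem x.2⟩ (R' x)) := by
  refine isIso_desc _ (fun x => indLift (R' x) (X := mackeyObj L x X)
    (W := (res hL).obj ((ind R).obj X)) (mackeyOut R X ⟨x, hS.mem x.2⟩)) (fun x => ?_)
    (fun x y hxy => ?_) ?_
  · refine desc_indLift (W := (res hL).obj ((ind R).obj X)) _ _ (mackeyIn_out R X _) fun g hg => ?_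
    refine act_mackeyIn_out R X ⟨g, hL g.2⟩ _ _ fun h => hg (Subgroup.mem_inf.2 ⟨?_, g.2⟩)
    exact (mem_iff_of_eq_conj rfl).2 h
  · refine desc_indLift_eq_zero (W := (res hL).obj ((ind R).obj X)) _ _ fun g => ?_
    refine act_mackeyIn_out R X ⟨g, hL g.2⟩ _ _ fun h => hxy ?_
    obtain ⟨z, -, hz⟩ := hS.2 x (hS.mem x.2)
    refine Subtype.ext ((hz x ⟨x.2, 1, L.one_mem, 1, K.one_mem, by simp⟩).trans
      (hz y ⟨y.2, (g⁻¹ : L), Subtype.mem _, _, h, ?_⟩).symm)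
    simp only [Subgroup.coe_inv]
    group
  · have (x : G) := Fintype.ofFinite (L ⧸ (MulAut.conj x • K ⊓ L).subgroupOf L)
    have h1 (x : S) : indLift (R' x) (X := mackeyObj L x X) (W := (res hL).obj ((ind R).obj X))
        (mackeyOut R X ⟨x, hS.mem x.2⟩) ≫
          (mackeyIncl hL hK R X ⟨x, hS.mem x.2⟩ (R' x)).hom =
        ∑ q, ((ind R).obj X).conjEnd (⟨(R' x).rep q, hL ((R' x).rep q).2⟩ * ⟨x, hS.mem x.2⟩)
          (indOut R X ≫ indIn R X) := by
      refine (indLift_desc (W := (res hL).obj ((ind R).obj X)) _ _).trans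
        (Finset.sum_congr rfl fun q _ => ?_)
      exact (congrArg (((ind R).obj X).conjEnd ⟨(R' x).rep q, hL ((R' x).rep q).2⟩)
        (mackeyOut_in R X _)).trans (conjEnd_conjEnd _ _ _ _ rfl _)
    have hγ := bijective_mackey hL hS fun x => R' x
    have h2 := sum_conjEnd_indOut_indIn R X _ hγ
    rw [Fintype.sum_sigma] at h2
    exact (Finset.sum_congr rfl fun x _ => h1 x).trans h2

/-- The Mackey decomposition of `R_L^H I_K^H`. -/
def mackeyDecomposition : DirectSumDecomposition (ind (T := T) R ⋙ res hL) fun x : S =>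
    conj x.1 (rfl : MulAut.conj x.1 • K = MulAut.conj x.1 • K) ⋙
      res (inf_le_left : MulAut.conj x.1 • K ⊓ L ≤ MulAut.conj x.1 • K) ⋙ ind (R' x.1) :=
  .ofIsIso (fun x =>
    { app X := mackeyIncl hL hK R X ⟨x, hS.mem x.2⟩ (R' x)
      naturality X Y f := ind_hom_ext (R' x) (by
        change indIn (R' x) (mackeyObj L x X) ≫ ((ind (R' x)).map (X := mackeyObj L x X)
            (Y := mackeyObj L x Y) ((res inf_le_left).map ((conj x.1 rfl).map f))).hom ≫
            (mackeyIncl hL hK R Y ⟨x, hS.mem x.2⟩ (R' x)).hom =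
          indIn (R' x) (mackeyObj L x X) ≫ (mackeyIncl hL hK R X ⟨x, hS.mem x.2⟩ (R' x)).hom ≫
            ((ind R).map f).hom
        exact (indIn_map_assoc _ _ _).trans ((congrArg (_ ≫ ·)
          (indIn_mackeyIncl hL hK R Y ⟨x, hS.mem x.2⟩ (R' x))).trans
            ((mackeyIn_naturality R ⟨x, hS.mem x.2⟩ f).trans ((congrArg (· ≫ _)
              (indIn_mackeyIncl hL hK R X ⟨x, hS.mem x.2⟩ (R' x)).symm).trans
                (Category.assoc _ _ _)))) ) })
    fun X => isIso_desc_mackeyIncl hL hK R X hS R'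

end

end Mackey

end GroupAction

/-! ### The coherence conditions -/

namespace GroupAction

attribute [local instance] GroupAction.additive

open Equivariant

section Coherence

variable {G : Type t} [Group G] {C : Type u} [Category.{v} C] {T : GroupAction G C}

theorem mul_inv_app_map_one (a : G) (X : C) :
    (T.mul a 1 a (mul_one a)).inv.app X = (T.fn a).map (T.one.hom.app X) := by
  rw [← cancel_mono ((T.mul a 1 a (mul_one a)).hom.app X), Iso.inv_hom_id_app]
  exact (T.mul_unit a X).symm

theorem mul_inv_app_one_map (a : G) (X : C) :
    (T.mul 1 a a (one_mul a)).inv.app X = T.one.hom.app ((T.fn a).obj X) := by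
  rw [← cancel_mono ((T.mul 1 a a (one_mul a)).hom.app X), Iso.inv_hom_id_app]
  exact (T.unit_mul a X).symm

theorem mul_inv_assoc {a b c ab bc abc : G} (e₁ : a * b = ab) (e₂ : b * c = bc) (e₃ : ab * c = abc)
    (e₄ : a * bc = abc) (X : C) :
    (T.mul ab c abc e₃).inv.app X ≫ (T.mul a b ab e₁).inv.app ((T.fn c).obj X) =
      (T.mul a bc abc e₄).inv.app X ≫ (T.fn a).map ((T.mul b c bc e₂).inv.app X) := by
  rw [← cancel_mono ((T.mul a b ab e₁).hom.app ((T.fn c).obj X)),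
    ← cancel_mono ((T.mul ab c abc e₃).hom.app X)]
  have h := T.assoc a b c ab bc abc e₁ e₂ e₃ e₄ X
  simp only [Category.assoc]
  rw [Iso.inv_hom_id_app_assoc, Iso.inv_hom_id_app, h, ← Functor.map_comp_assoc,
    Iso.inv_hom_id_app, CategoryTheory.Functor.map_id]
  exact ((congrArg (_ ≫ ·) (Category.id_comp _)).trans (Iso.inv_hom_id_app _ _)).symm

theorem mul_inv_naturality {g h k : G} (e : g * h = k) {X Y : C} (f : X ⟶ Y) :
    (T.fn k).map f ≫ (T.mul g h k e).inv.app Y =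
      (T.mul g h k e).inv.app X ≫ (T.fn g).map ((T.fn h).map f) :=
  (T.mul g h k e).inv.naturality f

variable [Finite G] [Preadditive C] [HasFiniteBiproducts C]

/-- The natural isomorphisms of the categorical Mackey functor `H ↦ C^H`. -/
def mackeyIsos (T : GroupAction G C) (σ : ∀ {L H : Subgroup G}, L ≤ H → CosetReps L H) :
    MackeyIsos (T.mackeyData σ) where
  indId _ := indId (σ le_rfl)
  resId := resId T
  conjId := conjId T
  resComp := resComp T
  indComp hJK hKH := indComp hJK hKH _ _ _
  conjComp := conjComp T
  conjInd a _ _ _ _ h h' hK hH := conjInd a hH hK h h' _ _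
  conjRes := conjRes T
  mackey hL hK _ hX := mackeyDecomposition hL hK (σ hK) hX fun _ => σ inf_le_right
  indComp_right_id {L H} h X := ind_hom_ext (σ h) (by
    change indIn (σ h) X ≫ (indCompHom h le_rfl (σ h) (σ h) (σ le_rfl) X).hom ≫
      (indIdHom (σ le_rfl) ((ind (σ h)).obj X)).hom = indIn (σ h) X ≫ 𝟙 _
    rw [indIn_indCompHom_assoc, indIn_indIdHom])
  indComp_left_id {L H} h X := ind_hom_ext (σ h) (by
    change indIn (σ h) X ≫ (indCompHom le_rfl h (σ h) (σ le_rfl) (σ h) X).hom ≫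
      ((ind (σ h)).map (indIdHom (σ le_rfl) X)).hom = indIn (σ h) X ≫ 𝟙 _
    rw [indIn_indCompHom_assoc, indIn_map, indIn_indIdHom_assoc, Category.comp_id])
  resComp_right_id _ _ := hom_ext _ _ (Category.comp_id _)
  resComp_left_id _ _ := hom_ext _ _ (Category.comp_id _)
  conjComp_right_id a H _ h₁ h X := hom_ext _ _ (by
    change (T.mul a 1 a (mul_one a)).inv.app X.obj ≫ (T.fn a).map (X.μ 1) = 𝟙 _
    rw [mul_inv_app_map_one]
    exact ((T.fn a).map_comp _ _).symm.trans
      ((congrArg (T.fn a).map X.μ_one).trans ((T.fn a).map_id _)))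
  conjComp_left_id a _ _ h h₁ X := hom_ext _ _ (by
    change (T.mul 1 a a (one_mul a)).inv.app X.obj ≫ conjμ a h X 1 = 𝟙 _
    rw [mul_inv_app_one_map]
    exact conjμ_one a h X)
  diagram_R _ _ _ _ := rfl
  diagram_I {J K L H} hJK hKL hLH X := ind_hom_ext _ (by
    change indIn (σ ((hJK.trans hKL).trans hLH)) X ≫
        (indCompHom (hJK.trans hKL) hLH _ (σ (hJK.trans hKL)) (σ hLH) X).hom ≫
        ((ind (σ hLH)).map (indCompHom hJK hKL _ (σ hJK) (σ hKL) X)).hom =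
      indIn (σ ((hJK.trans hKL).trans hLH)) X ≫
        (indCompHom hJK (hKL.trans hLH) _ (σ hJK) (σ (hKL.trans hLH)) X).hom ≫
          (indCompHom hKL hLH _ (σ hKL) (σ hLH) ((ind (σ hJK)).obj X)).hom
    rw [indIn_indCompHom_assoc, indIn_indCompHom_assoc, indIn_map, indIn_indCompHom_assoc,
      indIn_indCompHom])
  diagram_C a b c ab bc abc e₁ e₂ e₃ e₄ _ _ _ _ hc hb ha hab hbc habc X :=
    hom_ext _ _ (mul_inv_assoc e₁ e₂ e₃ e₄ X.obj)
  diagram_RRC a _ _ _ _ _ _ _ _ _ _ _ _ _ X := hom_ext _ _ (by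
    change (T.fn a).map (𝟙 X.obj) ≫ 𝟙 _ ≫ 𝟙 _ = 𝟙 _ ≫ 𝟙 _
    simp)
  diagram_RCC a b ab e _ _ _ _ _ _ _ _ _ _ _ _ _ _ _ X := hom_ext _ _ (by
    change 𝟙 _ ≫ (T.mul a b ab e).inv.app X.obj =
      (T.mul a b ab e).inv.app X.obj ≫ (T.fn a).map (𝟙 _) ≫ 𝟙 _
    simp)
  diagram_IIC a _ _ _ _ _ _ hKL hLH hKL' hLH' hK hL hH X := by
    refine conj_ind_hom_ext a hH (σ (hKL.trans hLH)) hK (hKL.trans hLH) (hKL'.trans hLH')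
      (σ (hKL'.trans hLH')) ?_
    change (T.fn a).map (indIn (σ (hKL.trans hLH)) X) ≫
        (T.fn a).map (indCompHom hKL hLH _ (σ hKL) (σ hLH) X).hom ≫
          (conjIndHom a hH hL hLH hLH' (σ hLH) (σ hLH') ((ind (σ hKL)).obj X)).hom ≫
            ((ind (σ hLH')).map (conjIndHom a hL hK hKL hKL' (σ hKL) (σ hKL') X)).hom =
      (T.fn a).map (indIn (σ (hKL.trans hLH)) X) ≫
        (conjIndHom a hH hK (hKL.trans hLH) (hKL'.trans hLH') (σ (hKL.trans hLH))
          (σ (hKL'.trans hLH')) X).hom ≫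
            (indCompHom hKL' hLH' _ (σ hKL') (σ hLH') (conjObj a hK X)).hom
    rw [map_indIn_conjIndHom_assoc, indIn_indCompHom, ← Functor.map_comp_assoc, indIn_indCompHom,
      Functor.map_comp, Category.assoc, map_indIn_conjIndHom_assoc, indIn_map,
      map_indIn_conjIndHom_assoc]
  diagram_ICC a b ab e _ _ _ _ _ _ h h₁ h₂ hL₁ hH₁ hL₂ hH₂ hL hH X := by
    refine conj_ind_hom_ext ab hH (σ h) hL h h₂ (σ h₂) ?_
    change (T.fn ab).map (indIn (σ h) X) ≫ (conjIndHom ab hH hL h h₂ (σ h) (σ h₂) X).hom ≫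
        ((ind (σ h₂)).map (Y := conjObj a hL₂ (conjObj b hL₁ X))
          ((conjComp T a b ab e hL₁ hL₂ hL).hom.app X)).hom =
      (T.fn ab).map (indIn (σ h) X) ≫ (T.mul a b ab e).inv.app ((ind (σ h)).obj X).obj ≫
        (T.fn a).map (conjIndHom b hH₁ hL₁ h h₁ (σ h) (σ h₁) X).hom ≫
          (conjIndHom a hH₂ hL₂ h₁ h₂ (σ h₁) (σ h₂) (conjObj b hL₁ X)).hom
    rw [← Category.assoc ((T.fn ab).map _) ((T.mul a b ab e).inv.app _), mul_inv_naturality,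
      Category.assoc, ← Functor.map_comp_assoc, map_indIn_conjIndHom, map_indIn_conjIndHom]
    exact (map_indIn_conjIndHom_assoc ab hH hL h h₂ (σ h) (σ h₂) X _).trans (indIn_map (σ h₂)
      (X := conjObj ab hL X) (Y := conjObj a hL₂ (conjObj b hL₁ X))
        ((conjComp T a b ab e hL₁ hL₂ hL).hom.app X))

theorem isCanonical_mackeyIsos (T : GroupAction G C)
    (σ : ∀ {L H : Subgroup G}, L ≤ H → CosetReps L H) : IsCanonical (T.mackeyIsos σ) where
  resId _ _ := rfl
  resComp _ _ _ := rfl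
  conjRes _ _ _ _ _ _ _ _ _ _ := rfl
  conjComp _ _ _ _ _ _ _ _ _ _ _ := rfl
  conjId _ _ _ _ := rfl
  indId _ X := congrArg biproduct.desc (funext fun _ => act_id X _)

end Coherence

end GroupAction

/-! ### The categorical Mackey functor -/

section VecModule

variable (k : Type w) [CommRing k] {G : Type t} [Group G] {M : Subgroup G → Type u}
  [∀ H, Category.{v} (M H)] [∀ H, Preadditive (M H)] [∀ H, HasFiniteBiproducts (M H)]
  [∀ H, Linear k (M H)] {D : MackeyData M} (φ : MackeyIsos D)
  [∀ {K H : Subgroup G} (h : K ≤ H), (D.ind h).Additive]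
  [∀ {K H : Subgroup G} (h : K ≤ H), (D.ind h).Linear k]
  [∀ {K H : Subgroup G} (h : K ≤ H), (D.res h).Additive]
  [∀ {K H : Subgroup G} (h : K ≤ H), (D.res h).Linear k]
  [∀ (a : G) {H H' : Subgroup G} (h : H' = MulAut.conj a • H), (D.conj a h).Additive]
  [∀ (a : G) {H H' : Subgroup G} (h : H' = MulAut.conj a • H), (D.conj a h).Linear k]

/-- All the functors of the categorical Mackey functor are linear, and every natural transformation
between linear functors is a morphism of module functors. -/
def MackeyIsos.vecMackeyModule :
    letI (H : Subgroup G) : MonoidalLeftAction (Vec k) (M H) := vecAction k _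
    MackeyModule (Vec k) φ :=
  letI (H : Subgroup G) : MonoidalLeftAction (Vec k) (M H) := vecAction k _
  { ind := fun h => vecLinear k (D.ind h)
    res := fun h => vecLinear k (D.res h)
    conj := fun a _ _ h => vecLinear k (D.conj a h)
    indId := fun _ => (isVecLineator_vecLinear _).isModuleHom isVecLineator_id _
    resId := fun _ => (isVecLineator_vecLinear _).isModuleHom isVecLineator_id _
    conjId := fun _ _ _ => (isVecLineator_vecLinear _).isModuleHom isVecLineator_id _
    resComp := fun _ _ => (isVecLineator_vecLinear _).isModuleHom
      ((isVecLineator_vecLinear _).comp (isVecLineator_vecLinear _)) _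
    indComp := fun _ _ => (isVecLineator_vecLinear _).isModuleHom
      ((isVecLineator_vecLinear _).comp (isVecLineator_vecLinear _)) _
    conjComp := fun _ _ _ _ _ _ _ _ _ _ => (isVecLineator_vecLinear _).isModuleHom
      ((isVecLineator_vecLinear _).comp (isVecLineator_vecLinear _)) _
    conjInd := fun _ _ _ _ _ _ _ _ _ =>
      ((isVecLineator_vecLinear _).comp (isVecLineator_vecLinear _)).isModuleHom
      ((isVecLineator_vecLinear _).comp (isVecLineator_vecLinear _)) _
    conjRes := fun _ _ _ _ _ _ _ _ _ =>
      ((isVecLineator_vecLinear _).comp (isVecLineator_vecLinear _)).isModuleHom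
      ((isVecLineator_vecLinear _).comp (isVecLineator_vecLinear _)) _
    mackey_proj := fun _ _ _ _ _ =>
      ((isVecLineator_vecLinear _).comp (isVecLineator_vecLinear _)).isModuleHom
      ((isVecLineator_vecLinear _).comp
        ((isVecLineator_vecLinear _).comp (isVecLineator_vecLinear _))) _
    mackey_incl := fun _ _ _ _ _ =>
      ((isVecLineator_vecLinear _).comp
        ((isVecLineator_vecLinear _).comp (isVecLineator_vecLinear _))).isModuleHom
      ((isVecLineator_vecLinear _).comp (isVecLineator_vecLinear _)) _ }

end VecModule

namespace GroupAction

attribute [local instance] GroupAction.additive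

open Equivariant

section Functors

variable {G : Type t} [Group G] {C : Type u} [Category.{v} C] {T : GroupAction G C}
  [Preadditive C] [HasFiniteBiproducts C] {K H : Subgroup G}

instance (h : K ≤ H) : (res (T := T) h).Additive where

instance (a : G) (h : K = MulAut.conj a • H) : (conj (T := T) a h).Additive where
  map_add := hom_ext _ _ (T.fn a).map_add

instance [Finite G] (R : CosetReps K H) : (ind (T := T) R).Additive where
  map_add {X Y f g} := ind_hom_ext R (by
    rw [add_hom, Preadditive.comp_add, indIn_map, indIn_map, indIn_map, add_hom,
      Preadditive.add_comp])

variable {k : Type w} [CommRing k] [Linear k C] [∀ g : G, (T.fn g).Linear k]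

instance (h : K ≤ H) : (res (T := T) h).Linear k where

instance (a : G) (h : K = MulAut.conj a • H) : (conj (T := T) a h).Linear k where
  map_smul f r := hom_ext _ _ (Functor.Linear.map_smul (F := T.fn a) f.hom r)

instance [Finite G] (R : CosetReps K H) : (ind (T := T) R).Linear k where
  map_smul f r := ind_hom_ext R (by
    rw [smul_hom, Linear.comp_smul, indIn_map, indIn_map, smul_hom, Linear.smul_comp])

end Functors

section MackeyFunctor

attribute [local instance] Abelian.hasFiniteBiproducts

variable (k : Type w) [CommRing k] {G : Type t} [Group G] [Finite G] {C : Type u}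
  [Category.{v} C] [Abelian C] [Linear k C] (T : GroupAction G C)
  [∀ g : G, (T.fn g).Linear k] (σ : ∀ {L H : Subgroup G}, L ≤ H → CosetReps L H)

instance {K H : Subgroup G} (h : K ≤ H) : ((T.mackeyData σ).ind h).Additive :=
  inferInstanceAs (ind (T := T) (σ h)).Additive

instance {K H : Subgroup G} (h : K ≤ H) : ((T.mackeyData σ).res h).Additive :=
  inferInstanceAs (res (T := T) h).Additive

instance (a : G) {H H' : Subgroup G} (h : H' = MulAut.conj a • H) :
    ((T.mackeyData σ).conj a h).Additive :=
  inferInstanceAs (conj (T := T) a h).Additive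

instance {K H : Subgroup G} (h : K ≤ H) : ((T.mackeyData σ).ind h).Linear k :=
  inferInstanceAs ((ind (T := T) (σ h)).Linear k)

instance {K H : Subgroup G} (h : K ≤ H) : ((T.mackeyData σ).res h).Linear k :=
  inferInstanceAs ((res (T := T) h).Linear k)

instance (a : G) {H H' : Subgroup G} (h : H' = MulAut.conj a • H) :
    ((T.mackeyData σ).conj a h).Linear k :=
  inferInstanceAs ((conj (T := T) a h).Linear k)

/-- The categorical Mackey functor `H ↦ C^H`. -/
def mackeyFunctor :
    letI (H : Subgroup G) : MonoidalLeftAction (Vec k) (T.Equivariant H) := vecAction k _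
    CategoricalMackeyFunctor k (Vec k) (T.mackeyData σ) :=
  letI (H : Subgroup G) : MonoidalLeftAction (Vec k) (T.Equivariant H) := vecAction k _
  { abelian := fun _ => ⟨Equivariant.abelian, rfl⟩
    action_add_left := copowerMap_add_left
    action_smul_left := copowerMap_smul_left
    action_add_right := copowerMap_add_right
    action_smul_right := copowerMap_smul_right
    ind_additive := fun _ => inferInstance
    res_additive := fun _ => inferInstance
    conj_additive := fun _ _ _ _ => inferInstance
    ind_linear := fun _ => inferInstance
    res_linear := fun _ => inferInstance
    conj_linear := fun _ _ _ _ => inferInstance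
    isos := T.mackeyIsos σ
    modules := (T.mackeyIsos σ).vecMackeyModule k }

end MackeyFunctor

end GroupAction

/-! ### Module functors from invertible oplax structures -/

section OfIsIso

open scoped MonoidalLeftAction MonoidalRightAction

variable {S : Type u₁} [Category.{v₁} S] [MonoidalCategory S]
  {M : Type u₂} [Category.{v₂} M] {N : Type u₃} [Category.{v₃} N]

/-- A module functor from an oplax structure consisting of isomorphisms. -/
@[reducible]
def leftLinearOfIsIso [MonoidalLeftAction S M] [MonoidalLeftAction S N] {F : M ⥤ N}
    (δ : Lineator S F) (hδ : ∀ s m, IsIso (δ s m))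
    (naturality_left : ∀ {s s' : S} (f : s ⟶ s') (m : M),
      F.map (f ⊵ₗ m) ≫ δ s' m = δ s m ≫ f ⊵ₗ F.obj m)
    (naturality_right : ∀ (s : S) {m m' : M} (f : m ⟶ m'),
      F.map (s ⊴ₗ f) ≫ δ s m' = δ s m ≫ s ⊴ₗ F.map f)
    (associativity : ∀ (s s' : S) (m : M), δ (s ⊗ s') m ≫ (αₗ s s' (F.obj m)).hom =
      F.map (αₗ s s' m).hom ≫ δ s (s' ⊙ₗ m) ≫ s ⊴ₗ δ s' m)
    (unitality : ∀ m : M, δ (𝟙_ S) m ≫ (λₗ[S] (F.obj m)).hom = F.map (λₗ[S] m).hom) :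
    F.LeftLinear S where
  δₗ := δ
  δₗ_naturality_left := naturality_left
  δₗ_naturality_right := naturality_right
  δₗ_associativity := associativity
  δₗ_unitality_inv m := by
    rw [← cancel_mono (λₗ[S] (F.obj m)).hom, Category.assoc, unitality, ← F.map_comp,
      Iso.inv_hom_id, Iso.inv_hom_id, F.map_id]
  μₗ s m := inv (δ s m)
  μₗ_naturality_left f m := by
    rw [IsIso.comp_inv_eq, Category.assoc, naturality_left, IsIso.inv_hom_id_assoc]
  μₗ_naturality_right s _ _ f := by
    rw [IsIso.comp_inv_eq, Category.assoc, naturality_right, IsIso.inv_hom_id_assoc]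
  μₗ_associativity s s' m := by
    rw [IsIso.inv_comp_eq, reassoc_of% associativity,
      ← MonoidalLeftAction.actionHomRight_comp_assoc,
      IsIso.hom_inv_id, MonoidalLeftAction.actionHomRight_id, Category.id_comp, IsIso.hom_inv_id,
      Category.comp_id]
  μₗ_unitality m := by
    rw [← unitality, IsIso.inv_hom_id_assoc]
  μₗ_comp_δₗ _ _ := IsIso.inv_hom_id _
  δₗ_comp_μₗ _ _ := IsIso.hom_inv_id _

/-- A right module functor from an oplax structure consisting of isomorphisms. -/
@[reducible]
def rightLinearOfIsIso [MonoidalRightAction S M] [MonoidalRightAction S N] {F : M ⥤ N}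
    (δ : ∀ (m : M) (s : S), F.obj (m ⊙ᵣ s) ⟶ F.obj m ⊙ᵣ s) (hδ : ∀ m s, IsIso (δ m s))
    (naturality_left : ∀ {m m' : M} (f : m ⟶ m') (s : S),
      F.map (f ⊵ᵣ s) ≫ δ m' s = δ m s ≫ F.map f ⊵ᵣ s)
    (naturality_right : ∀ (m : M) {s s' : S} (f : s ⟶ s'),
      F.map (m ⊴ᵣ f) ≫ δ m s' = δ m s ≫ F.obj m ⊴ᵣ f)
    (associativity : ∀ (m : M) (s s' : S), δ m (s ⊗ s') ≫ (αᵣ (F.obj m) s s').hom =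
      F.map (αᵣ m s s').hom ≫ δ (m ⊙ᵣ s) s' ≫ δ m s ⊵ᵣ s')
    (unitality : ∀ m : M, δ m (𝟙_ S) ≫ (ρᵣ[S] (F.obj m)).hom = F.map (ρᵣ[S] m).hom) :
    F.RightLinear S where
  δᵣ := δ
  δᵣ_naturality_left := naturality_left
  δᵣ_naturality_right := naturality_right
  δᵣ_associativity := associativity
  δᵣ_unitality_inv m := by
    rw [← cancel_mono (ρᵣ[S] (F.obj m)).hom, Category.assoc, unitality, ← F.map_comp,
      Iso.inv_hom_id, Iso.inv_hom_id, F.map_id]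
  μᵣ m s := inv (δ m s)
  μᵣ_naturality_left f m := by
    rw [IsIso.comp_inv_eq, Category.assoc, naturality_left, IsIso.inv_hom_id_assoc]
  μᵣ_naturality_right s _ _ f := by
    rw [IsIso.comp_inv_eq, Category.assoc, naturality_right, IsIso.inv_hom_id_assoc]
  μᵣ_associativity m s s' := by
    rw [IsIso.inv_comp_eq, reassoc_of% associativity,
      ← MonoidalRightAction.comp_actionHomLeft_assoc,
      IsIso.hom_inv_id, MonoidalRightAction.id_actionHomLeft, Category.id_comp, IsIso.hom_inv_id,
      Category.comp_id]
  μᵣ_unitality m := by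
    rw [← unitality, IsIso.inv_hom_id_assoc]
  μᵣ_comp_δᵣ _ _ := IsIso.inv_hom_id _
  δᵣ_comp_μᵣ _ _ := IsIso.hom_inv_id _

end OfIsIso

/-! ### The projection formulas -/

namespace GroupAction

attribute [local instance] GroupAction.additive

open Equivariant Functor.OplaxMonoidal

section Projection

variable {G : Type t} [Group G] {C : Type u} [Category.{v} C] {T : GroupAction G C}
  [MonoidalCategory C] [T.MonoidalAction] {K H : Subgroup G}

/-- The restriction of an equivariant object; this is the object function of `res`, as a reducible
definition. -/
@[reducible]
def resObj (h : K ≤ H) (X : T.Equivariant H) : T.Equivariant K where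
  obj := X.obj
  μ g := X.μ ⟨g, h g.2⟩
  isIso_μ := ((res h).obj X).isIso_μ
  μ_mul := ((res h).obj X).μ_mul
  μ_one := X.μ_one

/-- The tensor product of equivariant objects, as a reducible definition. -/
@[reducible]
def tensObj (X Y : T.Equivariant H) : T.Equivariant H where
  obj := X.obj ⊗ Y.obj
  μ g := δ (T.fn g) X.obj Y.obj ≫ (X.μ g ⊗ₘ Y.μ g)
  isIso_μ := (X ⊗ Y).isIso_μ
  μ_mul := (X ⊗ Y).μ_mul
  μ_one := (X ⊗ Y).μ_one

theorem act_whiskerLeft (X Y : T.Equivariant H) (g : H) {A : C} (f : A ⟶ Y.obj) :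
    (tensObj X Y).act g (X.obj ◁ f) = δ (T.fn g) X.obj A ≫ (X.μ g ⊗ₘ Y.act g f) := by
  rw [act, ← δ_natural_right_assoc, act, ← id_tensorHom, tensorHom_comp_tensorHom,
    Category.id_comp]

theorem act_whiskerRight (X Y : T.Equivariant H) (g : H) {A : C} (f : A ⟶ X.obj) :
    (tensObj X Y).act g (f ▷ Y.obj) = δ (T.fn g) A Y.obj ≫ (X.act g f ⊗ₘ Y.μ g) := by
  rw [act, ← δ_natural_left_assoc, act, ← tensorHom_id, tensorHom_comp_tensorHom,
    Category.id_comp]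

theorem conjEnd_whiskerLeft (X Y : T.Equivariant H) (g : H) (e : Y.obj ⟶ Y.obj) :
    (tensObj X Y).conjEnd g (X.obj ◁ e) = X.obj ◁ Y.conjEnd g e := by
  rw [conjEnd, IsIso.inv_comp_eq, act_whiskerLeft, Category.assoc, ← id_tensorHom,
    tensorHom_comp_tensorHom, Category.comp_id, conjEnd, IsIso.hom_inv_id_assoc]

theorem conjEnd_whiskerRight (X Y : T.Equivariant H) (g : H) (e : X.obj ⟶ X.obj) :
    (tensObj X Y).conjEnd g (e ▷ Y.obj) = X.conjEnd g e ▷ Y.obj := by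
  rw [conjEnd, IsIso.inv_comp_eq, act_whiskerRight, Category.assoc, ← tensorHom_id,
    tensorHom_comp_tensorHom, Category.comp_id, conjEnd, IsIso.hom_inv_id_assoc]

variable [Finite G] [Preadditive C] [HasFiniteBiproducts C]
  (h : K ≤ H) (R : CosetReps K H) (M : T.Equivariant H) (V : T.Equivariant K)

theorem isResHom_whiskerLeft_indIn : IsResHom h (tensObj (resObj h M) V)
    (tensObj M ((ind R).obj V)) (M.obj ◁ indIn R V) := fun l => by
  rw [act_whiskerLeft, isResHom_indIn R V h, Category.assoc, ← id_tensorHom,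
    tensorHom_comp_tensorHom, Category.comp_id]

theorem isResHom_whiskerRight_indIn : IsResHom h (tensObj V (resObj h M))
    (tensObj ((ind R).obj V) M) (indIn R V ▷ M.obj) := fun l => by
  rw [act_whiskerRight, isResHom_indIn R V h, Category.assoc, ← tensorHom_id,
    tensorHom_comp_tensorHom, Category.comp_id]

/-- The projection formula `I_K^H (R_K^H M ⊗ V) ⟶ M ⊗ I_K^H V`. -/
def indTensorLeft : (ind R).obj (tensObj (resObj h M) V) ⟶ tensObj M ((ind R).obj V) :=
  indDesc R (isResHom_whiskerLeft_indIn h R M V)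

/-- The projection formula `I_K^H (V ⊗ R_K^H M) ⟶ I_K^H V ⊗ M`. -/
def indTensorRight : (ind R).obj (tensObj V (resObj h M)) ⟶ tensObj ((ind R).obj V) M :=
  indDesc R (isResHom_whiskerRight_indIn h R M V)

theorem indIn_indTensorLeft : indIn R (tensObj (resObj h M) V) ≫ (indTensorLeft h R M V).hom =
    M.obj ◁ indIn R V := indIn_desc _

theorem indIn_indTensorRight : indIn R (tensObj V (resObj h M)) ≫ (indTensorRight h R M V).hom =
    indIn R V ▷ M.obj := indIn_desc _

section

variable {h R M V}

theorem indIn_indTensorLeft_comp {W : T.Equivariant H} (χ : tensObj M ((ind R).obj V) ⟶ W) :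
    indIn R (tensObj (resObj h M) V) ≫ (indTensorLeft h R M V ≫ χ).hom =
      M.obj ◁ indIn R V ≫ χ.hom := by
  rw [comp_hom, ← Category.assoc, indIn_indTensorLeft]

theorem indIn_indTensorRight_comp {W : T.Equivariant H} (χ : tensObj ((ind R).obj V) M ⟶ W) :
    indIn R (tensObj V (resObj h M)) ≫ (indTensorRight h R M V ≫ χ).hom =
      indIn R V ▷ M.obj ≫ χ.hom := by
  rw [comp_hom, ← Category.assoc, indIn_indTensorRight]

theorem map_indTensorLeft {A : T.Equivariant K} {φ : A ⟶ tensObj (resObj h M) V}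
    {ψ : (ind R).obj A ⟶ tensObj M ((ind R).obj V)}
    (e : φ.hom ≫ M.obj ◁ indIn R V = indIn R A ≫ ψ.hom) :
    (ind R).map φ ≫ indTensorLeft h R M V = ψ :=
  ind_hom_ext R (by rw [comp_hom, indIn_map_assoc, ← e, indIn_indTensorLeft])

theorem map_indTensorRight {A : T.Equivariant K} {φ : A ⟶ tensObj V (resObj h M)}
    {ψ : (ind R).obj A ⟶ tensObj ((ind R).obj V) M}
    (e : φ.hom ≫ indIn R V ▷ M.obj = indIn R A ≫ ψ.hom) :
    (ind R).map φ ≫ indTensorRight h R M V = ψ :=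
  ind_hom_ext R (by rw [comp_hom, indIn_map_assoc, ← e, indIn_indTensorRight])

theorem map_indTensorLeft_comp {A : T.Equivariant K} {W : T.Equivariant H}
    {φ : A ⟶ tensObj (resObj h M) V} {χ : tensObj M ((ind R).obj V) ⟶ W} {ψ : (ind R).obj A ⟶ W}
    (e : φ.hom ≫ M.obj ◁ indIn R V ≫ χ.hom = indIn R A ≫ ψ.hom) :
    (ind R).map φ ≫ indTensorLeft h R M V ≫ χ = ψ :=
  ind_hom_ext R (by rw [comp_hom, indIn_map_assoc, ← e, indIn_indTensorLeft_comp])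

theorem map_indTensorRight_comp {A : T.Equivariant K} {W : T.Equivariant H}
    {φ : A ⟶ tensObj V (resObj h M)} {χ : tensObj ((ind R).obj V) M ⟶ W} {ψ : (ind R).obj A ⟶ W}
    (e : φ.hom ≫ indIn R V ▷ M.obj ≫ χ.hom = indIn R A ≫ ψ.hom) :
    (ind R).map φ ≫ indTensorRight h R M V ≫ χ = ψ :=
  ind_hom_ext R (by rw [comp_hom, indIn_map_assoc, ← e, indIn_indTensorRight_comp])

end

variable [MonoidalPreadditive C]

/-- The criterion applies to `M ⊗ I_K^H V` with the idempotent
`M ⊗ I_K^H V ⟶ M ⊗ V ⟶ M ⊗ I_K^H V`, whose conjugates are `M` tensored with the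
conjugates of the idempotent of `I_K^H V`. -/
instance isIso_indTensorLeft : IsIso (indTensorLeft h R M V) := by
  refine isIso_indDesc _ (M.obj ◁ indOut R V) ?_ (fun g hg => ?_) ?_
  · rw [← whiskerLeft_comp, indIn_indOut, whiskerLeft_id]
  · rw [act_whiskerLeft, Category.assoc, ← id_tensorHom, tensorHom_comp_tensorHom,
      act_indIn_indOut R V g hg, MonoidalPreadditive.tensor_zero, comp_zero]
  · let := Fintype.ofFinite (H ⧸ K.subgroupOf H)
    simp only [← whiskerLeft_comp, conjEnd_whiskerLeft]
    rw [← whiskerLeft_sum, sum_conjEnd_indOut_indIn R V R.rep, whiskerLeft_id]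
    simp only [R.mk_rep]
    exact Function.bijective_id

instance isIso_indTensorRight : IsIso (indTensorRight h R M V) := by
  refine isIso_indDesc _ (indOut R V ▷ M.obj) ?_ (fun g hg => ?_) ?_
  · rw [← comp_whiskerRight, indIn_indOut, id_whiskerRight]
  · rw [act_whiskerRight, Category.assoc, ← tensorHom_id, tensorHom_comp_tensorHom,
      act_indIn_indOut R V g hg, MonoidalPreadditive.zero_tensor, comp_zero]
  · let := Fintype.ofFinite (H ⧸ K.subgroupOf H)
    simp only [← comp_whiskerRight, conjEnd_whiskerRight]
    rw [← sum_whiskerRight, sum_conjEnd_indOut_indIn R V R.rep, id_whiskerRight]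
    simp only [R.mk_rep]
    exact Function.bijective_id

end Projection

end GroupAction

/-! ### The module functors of the categorical Green functor -/

namespace GroupAction

attribute [local instance] GroupAction.additive

open Equivariant Functor.OplaxMonoidal

section ModuleFunctors

variable {G : Type t} [Group G] {C : Type u} [Category.{v} C] {T : GroupAction G C}
  [MonoidalCategory C] [T.MonoidalAction] {K H : Subgroup G}

section Ind

variable [Finite G] [Preadditive C] [HasFiniteBiproducts C]
  (h : K ≤ H) (R : CosetReps K H)

theorem indTensorLeft_associativity_hom (s s' : T.Equivariant H) (m : T.Equivariant K) :
    (𝟙 (s.obj ⊗ s'.obj) ▷ m.obj ≫ (α_ s.obj s'.obj m.obj).hom) ≫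
        s.obj ◁ indIn R (tensObj (resObj h s') m) ≫ s.obj ◁ (indTensorLeft h R s' m).hom =
      (s.obj ⊗ s'.obj) ◁ indIn R m ≫ (α_ s.obj s'.obj _).hom := by
  rw [id_whiskerRight, Category.id_comp, ← whiskerLeft_comp, indIn_indTensorLeft,
    associator_naturality_right]

theorem indTensorRight_associativity_hom (m : T.Equivariant K) (s s' : T.Equivariant H) :
    (m.obj ◁ 𝟙 (s.obj ⊗ s'.obj) ≫ (α_ m.obj s.obj s'.obj).inv) ≫
        indIn R (tensObj m (resObj h s)) ▷ s'.obj ≫ (indTensorRight h R s m).hom ▷ s'.obj =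
      indIn R m ▷ (s.obj ⊗ s'.obj) ≫ (α_ _ s.obj s'.obj).inv := by
  rw [whiskerLeft_id, Category.id_comp, ← comp_whiskerRight, indIn_indTensorRight,
    associator_inv_naturality_left]

variable {h R} in
theorem indTensorLeft_comp_eq_map {M : T.Equivariant H} {V W : T.Equivariant K}
    {φ : tensObj (resObj h M) V ⟶ W} {χ : tensObj M ((ind R).obj V) ⟶ (ind R).obj W}
    (e : M.obj ◁ indIn R V ≫ χ.hom = φ.hom ≫ indIn R W) :
    indTensorLeft h R M V ≫ χ = (ind R).map φ :=
  ind_hom_ext R (by rw [indIn_indTensorLeft_comp, indIn_map, e])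

variable {h R} in
theorem indTensorRight_comp_eq_map {M : T.Equivariant H} {V W : T.Equivariant K}
    {φ : tensObj V (resObj h M) ⟶ W} {χ : tensObj ((ind R).obj V) M ⟶ (ind R).obj W}
    (e : indIn R V ▷ M.obj ≫ χ.hom = φ.hom ≫ indIn R W) :
    indTensorRight h R M V ≫ χ = (ind R).map φ :=
  ind_hom_ext R (by rw [indIn_indTensorRight_comp, indIn_map, e])

variable [MonoidalPreadditive C]

/-- Induction as a left module functor. -/
@[reducible]
def indLeftLinear :
    letI := leftActionVia (res (T := T) h)
    letI := MonoidalCategory.selfLeftAction (T.Equivariant H)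
    (ind (T := T) R).LeftLinear (T.Equivariant H) :=
  letI := leftActionVia (res (T := T) h)
  letI := MonoidalCategory.selfLeftAction (T.Equivariant H)
  leftLinearOfIsIso (F := ind (T := T) R) (indTensorLeft h R)
    (fun s m => isIso_indTensorLeft h R s m)
    (fun {_ _} f m => map_indTensorLeft ((whisker_exchange f.hom (indIn R m)).symm.trans
      (indIn_indTensorLeft_comp (f ▷ (ind R).obj m)).symm))
    (fun s {m m'} f => map_indTensorLeft (Eq.trans
      (show s.obj ◁ f.hom ≫ s.obj ◁ indIn R m' = s.obj ◁ indIn R m ≫ s.obj ◁ ((ind R).map f).hom by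
        rw [← whiskerLeft_comp, ← whiskerLeft_comp, indIn_map])
      (indIn_indTensorLeft_comp (s ◁ (ind R).map f)).symm))
    (fun s s' m => (map_indTensorLeft_comp ((indTensorLeft_associativity_hom h R s s' m).trans
      (indIn_indTensorLeft_comp (R := R) (M := tensObj s s') (V := m)
        (α_ s s' ((ind R).obj m)).hom).symm)).symm)
    (fun m => indTensorLeft_comp_eq_map (M := tensorUnit T H)
      (show 𝟙_ C ◁ indIn R m ≫ (λ_ _).hom = (𝟙 (𝟙_ C) ▷ m.obj ≫ (λ_ m.obj).hom) ≫ indIn R m by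
        rw [id_whiskerRight, Category.id_comp, leftUnitor_naturality]))

/-- Induction as a right module functor. -/
@[reducible]
def indRightLinear :
    letI := rightActionVia (res (T := T) h)
    letI := MonoidalCategory.selRightfAction (T.Equivariant H)
    (ind (T := T) R).RightLinear (T.Equivariant H) :=
  letI := rightActionVia (res (T := T) h)
  letI := MonoidalCategory.selRightfAction (T.Equivariant H)
  rightLinearOfIsIso (F := ind (T := T) R) (fun m s => indTensorRight h R s m)
    (fun m s => isIso_indTensorRight h R s m)
    (fun {m m'} f s => map_indTensorRight (Eq.trans
      (show f.hom ▷ s.obj ≫ indIn R m' ▷ s.obj = indIn R m ▷ s.obj ≫ ((ind R).map f).hom ▷ s.obj by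
        rw [← comp_whiskerRight, ← comp_whiskerRight, indIn_map])
      (indIn_indTensorRight_comp ((ind R).map f ▷ s)).symm))
    (fun m {_ _} f => map_indTensorRight ((whisker_exchange (indIn R m) f.hom).trans
      (indIn_indTensorRight_comp ((ind R).obj m ◁ f)).symm))
    (fun m s s' => (map_indTensorRight_comp ((indTensorRight_associativity_hom h R m s s').trans
      (indIn_indTensorRight_comp (R := R) (M := tensObj s s') (V := m)
        (α_ ((ind R).obj m) s s').inv).symm)).symm)
    (fun m => indTensorRight_comp_eq_map (M := tensorUnit T H)
      (show indIn R m ▷ 𝟙_ C ≫ (ρ_ _).hom = (m.obj ◁ 𝟙 (𝟙_ C) ≫ (ρ_ m.obj).hom) ≫ indIn R m by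
        rw [whiskerLeft_id, Category.id_comp, rightUnitor_naturality]))

/-- Induction as a module functor over `C^G`. -/
@[reducible]
def indTopLinear :
    letI := leftActionVia (res (T := T) (le_top : K ≤ ⊤))
    letI := leftActionVia (res (T := T) (le_top : H ≤ ⊤))
    (ind (T := T) R).LeftLinear (T.Equivariant (⊤ : Subgroup G)) :=
  letI := leftActionVia (res (T := T) (le_top : K ≤ ⊤))
  letI := leftActionVia (res (T := T) (le_top : H ≤ ⊤))
  leftLinearOfIsIso (F := ind (T := T) R) (fun s m => indTensorLeft h R (resObj le_top s) m)
    (fun s m => isIso_indTensorLeft h R (resObj le_top s) m)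
    (fun {s s'} f m => map_indTensorLeft (h := h) (M := resObj le_top s')
      (A := tensObj (resObj le_top s) m) ((whisker_exchange f.hom (indIn R m)).symm.trans
      (indIn_indTensorLeft_comp (h := h) (M := resObj le_top s)
        ((res le_top).map f ▷ (ind R).obj m)).symm))
    (fun s {m m'} f => map_indTensorLeft (h := h) (M := resObj le_top s)
      (A := tensObj (resObj le_top s) m) (Eq.trans
      (show s.obj ◁ f.hom ≫ s.obj ◁ indIn R m' = s.obj ◁ indIn R m ≫ s.obj ◁ ((ind R).map f).hom by
        rw [← whiskerLeft_comp, ← whiskerLeft_comp, indIn_map])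
      (indIn_indTensorLeft_comp (h := h) (M := resObj le_top s)
        (resObj le_top s ◁ (ind R).map f)).symm))
    (fun s s' m => (map_indTensorLeft_comp (h := h) (M := resObj le_top s)
      (V := tensObj (resObj le_top s') m) (A := tensObj (resObj le_top (tensObj s s')) m)
      (((indTensorLeft_associativity_hom h R (resObj le_top s) (resObj le_top s') m).trans
      (show _ = (s.obj ⊗ s'.obj) ◁ indIn R m ≫ 𝟙 (s.obj ⊗ s'.obj) ▷ _ ≫ (α_ s.obj s'.obj _).hom by
        rw [id_whiskerRight, Category.id_comp])).trans
      (indIn_indTensorLeft_comp (h := h) (R := R) (M := resObj le_top (tensObj s s')) (V := m)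
        (MonoidalLeftActionStruct.actionAssocIso s s' ((ind R).obj m)).hom).symm)).symm)
    (fun m => indTensorLeft_comp_eq_map (h := h) (M := resObj le_top (tensorUnit T ⊤))
      (show 𝟙_ C ◁ indIn R m ≫ 𝟙 (𝟙_ C) ▷ _ ≫ (λ_ _).hom =
          (𝟙 (𝟙_ C) ▷ m.obj ≫ (λ_ m.obj).hom) ≫ indIn R m by
        rw [id_whiskerRight, Category.id_comp, id_whiskerRight, Category.id_comp,
          leftUnitor_naturality]))

end Ind

/-- Restriction as a module functor over `C^G`. -/
@[reducible]
def resTopLinear (h : K ≤ H) :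
    letI := leftActionVia (res (T := T) (le_top : H ≤ ⊤))
    letI := leftActionVia (res (T := T) (le_top : K ≤ ⊤))
    (res (T := T) h).LeftLinear (T.Equivariant (⊤ : Subgroup G)) :=
  letI := leftActionVia (res (T := T) (le_top : H ≤ ⊤))
  letI := leftActionVia (res (T := T) (le_top : K ≤ ⊤))
  leftLinearOfIsIso (F := res (T := T) h)
    (fun s m => 𝟙 (tensObj (resObj le_top s) (resObj h m)))
    (fun s m => IsIso.id (tensObj (resObj le_top s) (resObj h m)))
    (fun {s s'} f m => hom_ext _ _
      (show f.hom ▷ m.obj ≫ 𝟙 _ = 𝟙 _ ≫ f.hom ▷ m.obj by simp))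
    (fun s {m m'} f => hom_ext _ _
      (show s.obj ◁ f.hom ≫ 𝟙 _ = 𝟙 _ ≫ s.obj ◁ f.hom by simp))
    (fun s s' m => hom_ext _ _
      (show 𝟙 _ ≫ 𝟙 (s.obj ⊗ s'.obj) ▷ m.obj ≫ (α_ s.obj s'.obj m.obj).hom =
        (𝟙 (s.obj ⊗ s'.obj) ▷ m.obj ≫ (α_ s.obj s'.obj m.obj).hom) ≫ 𝟙 _ ≫ s.obj ◁ 𝟙 _ by simp))
    (fun m => hom_ext _ _ (Category.id_comp _))

theorem conj_top (a : G) : (⊤ : Subgroup G) = MulAut.conj a • ⊤ := by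
  simp

section Conj

variable (a : G) (h : K = MulAut.conj a • H)

/-- The isomorphism `c_{H,a} (R_H^G s ⊗ m) ⟶ R_{H'}^G s ⊗ c_{H,a} m`. -/
def conjTensor (s : T.Equivariant (⊤ : Subgroup G)) (m : T.Equivariant H) :
    conjObj a h (tensObj (resObj le_top s) m) ⟶ tensObj (resObj le_top s) (conjObj a h m) :=
  δ (conj (T := T) a h) ((res le_top).obj s) m ≫
    ((conjRes T a le_top le_top h (conj_top a)).hom.app s ≫
      (res le_top).map ((conjId T a (Subgroup.mem_top a) (conj_top a)).hom.app s)) ▷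
        (conj a h).obj m

theorem conjTensor_hom (s : T.Equivariant (⊤ : Subgroup G)) (m : T.Equivariant H) :
    (conjTensor a h s m).hom =
      δ (T.fn a) s.obj m.obj ≫ s.μ ⟨a, Subgroup.mem_top a⟩ ▷ (T.fn a).obj m.obj :=
  congrArg (fun x => δ (T.fn a) s.obj m.obj ≫ x ▷ (T.fn a).obj m.obj) (Category.id_comp _)

instance isIso_conjTensor (s : T.Equivariant (⊤ : Subgroup G)) (m : T.Equivariant H) :
    IsIso (conjTensor a h s m) := by
  have : IsIso (conjTensor a h s m).hom := by
    rw [conjTensor_hom]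
    infer_instance
  exact isIso_of_isIso_hom _

/-- Conjugation as a module functor over `C^G`. -/
@[reducible]
def conjTopLinear :
    letI := leftActionVia (res (T := T) (le_top : H ≤ ⊤))
    letI := leftActionVia (res (T := T) (le_top : K ≤ ⊤))
    (conj (T := T) a h).LeftLinear (T.Equivariant (⊤ : Subgroup G)) :=
  letI := leftActionVia (res (T := T) (le_top : H ≤ ⊤))
  letI := leftActionVia (res (T := T) (le_top : K ≤ ⊤))
  leftLinearOfIsIso (F := conj (T := T) a h) (conjTensor a h) (isIso_conjTensor a h)
    (fun {s s'} f m => hom_ext _ _ (by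
      change (T.fn a).map (f.hom ▷ m.obj) ≫ (conjTensor a h s' m).hom =
        (conjTensor a h s m).hom ≫ f.hom ▷ (T.fn a).obj m.obj
      have hf := f.comm ⟨a, Subgroup.mem_top a⟩
      dsimp only at hf
      rw [conjTensor_hom, conjTensor_hom, ← δ_natural_left_assoc, Category.assoc,
        ← comp_whiskerRight, ← comp_whiskerRight]
      exact congrArg (fun x => δ (T.fn a) s.obj m.obj ≫ x ▷ (T.fn a).obj m.obj) hf))
    (fun s {m m'} f => hom_ext _ _ (by
      change (T.fn a).map (s.obj ◁ f.hom) ≫ (conjTensor a h s m').hom =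
        (conjTensor a h s m).hom ≫ s.obj ◁ (T.fn a).map f.hom
      rw [conjTensor_hom, conjTensor_hom, ← δ_natural_right_assoc, Category.assoc,
        whisker_exchange]))
    (fun s s' m => hom_ext _ _ (by
      change (conjTensor a h (tensObj s s') m).hom ≫ 𝟙 (s.obj ⊗ s'.obj) ▷ (T.fn a).obj m.obj ≫
          (α_ s.obj s'.obj ((T.fn a).obj m.obj)).hom =
        (T.fn a).map (𝟙 (s.obj ⊗ s'.obj) ▷ m.obj ≫ (α_ s.obj s'.obj m.obj).hom) ≫
          (conjTensor a h s (tensObj (resObj le_top s') m)).hom ≫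
            s.obj ◁ (conjTensor a h s' m).hom
      rw [conjTensor_hom, conjTensor_hom, conjTensor_hom]
      have h1 := Functor.OplaxMonoidal.associativity (T.fn a) s.obj s'.obj m.obj
      simp only [id_whiskerRight, Category.id_comp, Category.assoc, comp_whiskerRight,
        whiskerLeft_comp, MonoidalCategory.tensorHom_def]
      rw [← whisker_exchange_assoc, ← reassoc_of% h1]
      simp only [associator_naturality_middle, associator_naturality_left_assoc]))
    (fun m => hom_ext _ _ (by
      change (conjTensor a h (tensorUnit T ⊤) m).hom ≫ 𝟙 (𝟙_ C) ▷ (T.fn a).obj m.obj ≫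
        (λ_ ((T.fn a).obj m.obj)).hom = (T.fn a).map (𝟙 (𝟙_ C) ▷ m.obj ≫ (λ_ m.obj).hom)
      rw [conjTensor_hom]
      have h1 := Functor.OplaxMonoidal.left_unitality_hom (T.fn a) m.obj
      rw [id_whiskerRight, Category.assoc]
      exact (congrArg (fun x => δ (T.fn a) (𝟙_ C) m.obj ≫ η (T.fn a) ▷ (T.fn a).obj m.obj ≫ x)
        (Category.id_comp _)).trans (h1.trans (congrArg (T.fn a).map
          ((congrArg (· ≫ (λ_ m.obj).hom) (id_whiskerRight _ _)).trans
            (Category.id_comp _)).symm))))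

end Conj

end ModuleFunctors

end GroupAction

/-! ### Compatibility with the action of `C^G` -/

section Decomposition

open scoped MonoidalLeftAction

variable {S : Type u₁} [Category.{v₁} S] [MonoidalCategory S]
  {M : Type u₂} [Category.{v₂} M] [MonoidalLeftAction S M]
  {N : Type u₃} [Category.{v₃} N] [MonoidalLeftAction S N] [Preadditive N]
  {ι : Type w} [Fintype ι] {F : M ⥤ N} {F' : ι → (M ⥤ N)}

/-- The projections of a direct sum decomposition are morphisms of module functors if the
inclusions are, since the inclusions are jointly epimorphic. -/
theorem DirectSumDecomposition.isModuleHom_proj (d : DirectSumDecomposition F F')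
    {δ : Lineator S F} {δ' : ∀ i, Lineator S (F' i)}
    (h0 : ∀ (s : S) (m m' : N), s ⊴ₗ (0 : m ⟶ m') = 0)
    (h : ∀ i, IsModuleHom (δ' i) δ (d.incl i)) (i : ι) : IsModuleHom δ (δ' i) (d.proj i) := by
  intro s m
  have key (j : ι) : (d.incl j).app (s ⊙ₗ m) ≫ (d.proj i).app (s ⊙ₗ m) ≫ δ' i s m =
      (d.incl j).app (s ⊙ₗ m) ≫ δ s m ≫ s ⊴ₗ (d.proj i).app m := by
    rw [← Category.assoc _ (δ s m), h j s m, Category.assoc,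
      ← MonoidalLeftAction.actionHomRight_comp]
    by_cases hij : j = i
    · subst hij
      have h1 (X : M) := congrArg (fun τ => τ.app X) (d.incl_proj j)
      simp only [NatTrans.comp_app, NatTrans.id_app] at h1
      rw [reassoc_of% h1, h1, MonoidalLeftAction.actionHomRight_id, Category.comp_id]
    · rw [d.incl_proj_ne j i hij, h0, comp_zero, ← Category.assoc, d.incl_proj_ne j i hij,
        zero_comp]
  rw [← Category.id_comp ((d.proj i).app (s ⊙ₗ m)), ← Category.id_comp (δ s m), ← d.total]
  simp only [Preadditive.sum_comp, Category.assoc, key]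

end Decomposition

namespace GroupAction

attribute [local instance] GroupAction.additive

open Equivariant Functor.OplaxMonoidal

section Top

variable {G : Type t} [Group G] {C : Type u} [Category.{v} C] {T : GroupAction G C}
  [MonoidalCategory C] [T.MonoidalAction] {J K H : Subgroup G}

/-- The morphism `X ◁ f` of equivariant objects, between reducible tensor products. -/
@[reducible]
def tensLeft (X : T.Equivariant H) {Y Y' : T.Equivariant H} (f : Y ⟶ Y') :
    tensObj X Y ⟶ tensObj X Y' :=
  X ◁ f

/-- The morphism `f ▷ Y` of equivariant objects, between reducible tensor products. -/
@[reducible]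
def tensRight {X X' : T.Equivariant H} (f : X ⟶ X') (Y : T.Equivariant H) :
    tensObj X Y ⟶ tensObj X' Y :=
  f ▷ Y

theorem tensLeft_hom (X : T.Equivariant H) {Y Y' : T.Equivariant H} (f : Y ⟶ Y') :
    (tensLeft X f).hom = X.obj ◁ f.hom := rfl

theorem tensRight_hom {X X' : T.Equivariant H} (f : X ⟶ X') (Y : T.Equivariant H) :
    (tensRight f Y).hom = f.hom ▷ Y.obj := rfl

theorem conjTensor_conjId (a : G) (ha : a ∈ H) (h : H = MulAut.conj a • H)
    (s : T.Equivariant (⊤ : Subgroup G)) (m : T.Equivariant H) :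
    (tensObj (resObj le_top s) m).μ ⟨a, ha⟩ =
      (conjTensor a h s m).hom ≫ s.obj ◁ m.μ ⟨a, ha⟩ := by
  rw [conjTensor_hom, Category.assoc]
  exact congrArg (δ (T.fn a) s.obj m.obj ≫ ·) (MonoidalCategory.tensorHom_def _ _)

/-- The isomorphism `c_{H,ab} ≅ c_{H',a} c_{H,b}` commutes with the action of `C^G`: this combines
the monoidality of `T₂` with the equivariance `μ^a T^a(μ^b) = μ^{ab} T₂^{a,b}` of `s`. -/
theorem conjTensor_conjComp {a b c : G} (e : a * b = c) {H' H'' : Subgroup G}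
    (hb : H' = MulAut.conj b • H) (ha : H'' = MulAut.conj a • H') (hc : H'' = MulAut.conj c • H)
    (s : T.Equivariant (⊤ : Subgroup G)) (m : T.Equivariant H) :
    (T.mul a b c e).inv.app (s.obj ⊗ m.obj) ≫ (T.fn a).map (conjTensor b hb s m).hom ≫
        (conjTensor a ha s (conjObj b hb m)).hom =
      (conjTensor c hc s m).hom ≫ s.obj ◁ (T.mul a b c e).inv.app m.obj := by
  have h1 := mul_δ (T := T) e s.obj m.obj
  have h2 := s.μ_mul' (g := ⟨a, Subgroup.mem_top a⟩) (h := ⟨b, Subgroup.mem_top b⟩)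
    (k := ⟨c, Subgroup.mem_top c⟩) (Subtype.ext e) e
  have h3 {A A' A'' B B' : C} (f : A ⟶ A') (g : A' ⟶ A'') (i : B ≅ B') :
      (f ⊗ₘ i.hom) ≫ g ▷ B' ≫ A'' ◁ i.inv = (f ≫ g) ▷ B := by
    rw [MonoidalCategory.tensorHom_def, Category.assoc, whisker_exchange_assoc,
      ← whiskerLeft_comp, Iso.hom_inv_id, whiskerLeft_id, Category.comp_id, comp_whiskerRight]
  rw [conjTensor_hom, conjTensor_hom, conjTensor_hom,
    ← cancel_epi ((T.mul a b c e).hom.app (s.obj ⊗ m.obj)), Iso.hom_inv_id_app_assoc,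
    Category.assoc, reassoc_of% h1, Functor.map_comp, Category.assoc, ← δ_natural_left_assoc,
    ← comp_whiskerRight]
  exact congrArg (fun x => (T.fn a).map (δ (T.fn b) s.obj m.obj) ≫ δ (T.fn a) _ _ ≫ x)
    ((congrArg (· ▷ _) h2).trans (h3 _ _ ((T.mul a b c e).app m.obj)).symm)

variable [Finite G] [Preadditive C] [HasFiniteBiproducts C]

theorem indTensorLeft_indId (R : CosetReps H H) (M V : T.Equivariant H) :
    indIdHom R (tensObj (resObj le_rfl M) V) =
      indTensorLeft le_rfl R M V ≫ tensLeft M (indIdHom R V) :=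
  ind_hom_ext R (by
    rw [indIn_indIdHom, indIn_indTensorLeft_comp, tensLeft_hom, ← whiskerLeft_comp,
      indIn_indIdHom, whiskerLeft_id])

section Comp

variable (hJK : J ≤ K) (hKH : K ≤ H) (R : CosetReps J H) (R₁ : CosetReps J K)
    (R₂ : CosetReps K H) (M : T.Equivariant H) (V : T.Equivariant J)

theorem indTensorLeft_indComp :
    indCompHom hJK hKH R R₁ R₂ (tensObj (resObj (hJK.trans hKH) M) V) ≫
        (ind R₂).map (indTensorLeft hJK R₁ (resObj hKH M) V) ≫
          indTensorLeft hKH R₂ M ((ind R₁).obj V) =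
      indTensorLeft (hJK.trans hKH) R M V ≫ tensLeft M (indCompHom hJK hKH R R₁ R₂ V) :=
  ind_hom_ext R (by
    have h1 := indIn_indTensorLeft hJK R₁ (resObj hKH M) V
    rw [indIn_indTensorLeft_comp, tensLeft_hom, ← whiskerLeft_comp, indIn_indCompHom, comp_hom,
      comp_hom, indIn_indCompHom_assoc, indIn_map_assoc,
      indIn_indTensorLeft hKH R₂ M ((ind R₁).obj V), whiskerLeft_comp, reassoc_of% h1])

theorem indTensorRight_indComp :
    indCompHom hJK hKH R R₁ R₂ (tensObj V (resObj (hJK.trans hKH) M)) ≫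
        (ind R₂).map (indTensorRight hJK R₁ (resObj hKH M) V) ≫
          indTensorRight hKH R₂ M ((ind R₁).obj V) =
      indTensorRight (hJK.trans hKH) R M V ≫ tensRight (indCompHom hJK hKH R R₁ R₂ V) M :=
  ind_hom_ext R (by
    have h1 := indIn_indTensorRight hJK R₁ (resObj hKH M) V
    rw [indIn_indTensorRight_comp, tensRight_hom, ← comp_whiskerRight, indIn_indCompHom,
      comp_hom, comp_hom, indIn_indCompHom_assoc, indIn_map_assoc,
      indIn_indTensorRight hKH R₂ M ((ind R₁).obj V), comp_whiskerRight, reassoc_of% h1])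

end Comp

/-- The isomorphism `c_{H,a} I_K^H ≅ I_{K'}^{H'} c_{K,a}` commutes with the action of `C^G`. -/
theorem conjTensor_conjInd (a : G) {H' K' : Subgroup G} (h : K ≤ H) (h' : K' ≤ H')
    (hK : K' = MulAut.conj a • K) (hH : H' = MulAut.conj a • H) (R : CosetReps K H)
    (R' : CosetReps K' H') (s : T.Equivariant (⊤ : Subgroup G)) (m : T.Equivariant K) :
    conjIndHom a hH hK h h' R R' (tensObj (resObj le_top s) m) ≫
        (ind R').map (conjTensor a hK s m) ≫
          indTensorLeft h' R' (resObj le_top s) (conjObj a hK m) =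
      (conj a hH).map (X := (ind R).obj (tensObj (resObj le_top s) m))
          (indTensorLeft h R (resObj le_top s) m) ≫
        conjTensor a hH s ((ind R).obj m) ≫
          tensLeft (resObj le_top s) (conjIndHom a hH hK h h' R R' m) := by
  refine conj_ind_hom_ext a hH R hK h h' R' ?_
  change (T.fn a).map (indIn R (tensObj (resObj le_top s) m)) ≫
      (conjIndHom a hH hK h h' R R' (tensObj (resObj le_top s) m)).hom ≫
        ((ind R').map (conjTensor a hK s m)).hom ≫
          (indTensorLeft h' R' (resObj le_top s) (conjObj a hK m)).hom =
    (T.fn a).map (indIn R (tensObj (resObj le_top s) m)) ≫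
      (T.fn a).map (indTensorLeft h R (resObj le_top s) m).hom ≫
        (conjTensor a hH s ((ind R).obj m)).hom ≫ s.obj ◁ (conjIndHom a hH hK h h' R R' m).hom
  have h1 := indIn_indTensorLeft h' R' (resObj le_top s) (conjObj a hK m)
  have h2 := indIn_indTensorLeft h R (resObj le_top s) m
  rw [map_indIn_conjIndHom_assoc, indIn_map_assoc, h1, ← Functor.map_comp_assoc, h2,
    conjTensor_hom, conjTensor_hom, Category.assoc, Category.assoc,
    ← δ_natural_right_assoc, whisker_exchange_assoc, ← whiskerLeft_comp, map_indIn_conjIndHom]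

theorem mackeyIn_indTensorLeft (hK : K ≤ H) (R : CosetReps K H) (x : H)
    (s : T.Equivariant (⊤ : Subgroup G)) (m : T.Equivariant K) :
    mackeyIn R (tensObj (resObj le_top s) m) x ≫ (indTensorLeft hK R (resObj le_top s) m).hom =
      (conjTensor (x : G) rfl s m).hom ≫ s.obj ◁ mackeyIn R m x := by
  rw [mackeyIn, act_comp, indIn_indTensorLeft hK R (resObj le_top s) m, act_whiskerLeft,
    conjTensor_hom, MonoidalCategory.tensorHom_def, mackeyIn, Category.assoc]

/-- The inclusions of the summands of the Mackey decomposition commute with the action of `C^G`. -/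
theorem mackeyIncl_conjTensor {L : Subgroup G} (hL : L ≤ H) (hK : K ≤ H) (R : CosetReps K H)
    (x : H) (R' : CosetReps (MulAut.conj (x : G) • K ⊓ L) L)
    (s : T.Equivariant (⊤ : Subgroup G)) (m : T.Equivariant K) :
    mackeyIncl hL hK R (tensObj (resObj le_top s) m) x R' ≫
        (res hL).map (indTensorLeft hK R (resObj le_top s) m) =
      (ind R').map (Y := tensObj (resObj inf_le_right (resObj le_top s)) (mackeyObj L x m))
          ((res inf_le_left).map (conjTensor (x : G) rfl s m)) ≫
        indTensorLeft inf_le_right R' (resObj le_top s) (mackeyObj L x m) ≫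
          tensLeft (resObj le_top s) (mackeyIncl hL hK R m x R') := by
  refine ind_hom_ext R' ?_
  have h1 := indIn_mackeyIncl hL hK R (tensObj (resObj le_top s) m) x R'
  have h2 := indIn_mackeyIncl hL hK R m x R'
  have h3 := indIn_indTensorLeft_comp (h := inf_le_right) (R := R') (M := resObj le_top s)
    (V := mackeyObj L x m) (tensLeft (resObj le_top s) (mackeyIncl hL hK R m x R'))
  have h4 : s.obj ◁ indIn R' (mackeyObj L x m) ≫ s.obj ◁ (mackeyIncl hL hK R m x R').hom =
      s.obj ◁ mackeyIn R m x :=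
    (whiskerLeft_comp _ _ _).symm.trans (congrArg (s.obj ◁ ·) h2)
  exact ((Category.assoc _ _ _).symm.trans
    (congrArg (· ≫ (indTensorLeft hK R (resObj le_top s) m).hom) h1)).trans
    ((mackeyIn_indTensorLeft hK R x s m).trans ((congrArg ((conjTensor (x : G) rfl s m).hom ≫ ·)
      (h3.trans h4)).symm.trans (indIn_map_assoc R'
        (X := mackeyObj L x (tensObj (resObj le_top s) m))
        (Y := tensObj (resObj inf_le_right (resObj le_top s)) (mackeyObj L x m))
          ((res inf_le_left).map (conjTensor (x : G) rfl s m)) _).symm))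

end Top

end GroupAction

/-! ### The categorical Green functor -/

namespace GroupAction

attribute [local instance] GroupAction.additive

open Equivariant Functor.OplaxMonoidal

section IsMonoidal

variable {G : Type t} [Group G] {C : Type u} [Category.{v} C] [MonoidalCategory C]
  {T : GroupAction G C} [T.MonoidalAction]

open Functor.LaxMonoidal

theorem isMonoidal_resComp {J K H : Subgroup G} (hJK : J ≤ K) (hKH : K ≤ H) :
    NatTrans.IsMonoidal (resComp T hJK hKH).hom where
  unit := hom_ext _ _ (by
    change 𝟙 (𝟙_ C) ≫ 𝟙 (𝟙_ C) = 𝟙 (𝟙_ C) ≫ 𝟙 (𝟙_ C)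
    simp)
  tensor X Y := hom_ext _ _ (by
    change 𝟙 (X.obj ⊗ Y.obj) ≫ 𝟙 (X.obj ⊗ Y.obj) =
      (𝟙 X.obj ⊗ₘ 𝟙 Y.obj) ≫ 𝟙 (X.obj ⊗ Y.obj) ≫ 𝟙 (X.obj ⊗ Y.obj)
    simp)

theorem isMonoidal_conjComp {a b c : G} (e : a * b = c) {H H' H'' : Subgroup G}
    (hb : H' = MulAut.conj b • H) (ha : H'' = MulAut.conj a • H') (hc : H'' = MulAut.conj c • H) :
    NatTrans.IsMonoidal (conjComp T a b c e hb ha hc).hom :=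
  have h : NatTrans.IsMonoidal (T.mul a b c e).inv := inferInstance
  { unit := hom_ext _ _ h.unit
    tensor := fun X Y => hom_ext _ _ (h.tensor X.obj Y.obj) }

end IsMonoidal

section TopModule

variable {G : Type t} [Group G] [Finite G] {C : Type u} [Category.{v} C] [Preadditive C]
  [HasFiniteBiproducts C] [MonoidalCategory C] [MonoidalPreadditive C] (T : GroupAction G C)
  [T.MonoidalAction] (σ : ∀ {L H : Subgroup G}, L ≤ H → CosetReps L H)

variable {T} in
omit [MonoidalPreadditive C] in
/-- The isomorphism `R_J^H ≅ R_J^K R_K^H` does not contribute to the module structure of induction,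
since it is the identity on underlying objects. -/
theorem map_resComp_indTensorLeft {J K H : Subgroup G} (hJK : J ≤ K) (hKH : K ≤ H)
    (R : CosetReps J K) (M : T.Equivariant H) (V : T.Equivariant J) :
    (ind R).map (X := tensObj (resObj (hJK.trans hKH) M) V)
        (Y := tensObj (resObj hJK (resObj hKH M)) V) ((resComp T hJK hKH).hom.app M ▷ V) ≫
      indTensorLeft hJK R (resObj hKH M) V = indTensorLeft hJK R (resObj hKH M) V :=
  (congrArg (fun x => (ind R).map x ≫ indTensorLeft hJK R (resObj hKH M) V)
    (show _ = 𝟙 (tensObj (resObj hJK (resObj hKH M)) V) from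
      hom_ext _ _ (id_whiskerRight M.obj V.obj))).trans
    ((congrArg (· ≫ _) ((ind R).map_id _)).trans (Category.id_comp _))

variable {T} in
omit [MonoidalPreadditive C] in
theorem map_resComp_indTensorRight {J K H : Subgroup G} (hJK : J ≤ K) (hKH : K ≤ H)
    (R : CosetReps J K) (M : T.Equivariant H) (V : T.Equivariant J) :
    (ind R).map (X := tensObj V (resObj (hJK.trans hKH) M))
        (Y := tensObj V (resObj hJK (resObj hKH M))) (V ◁ (resComp T hJK hKH).hom.app M) ≫
      indTensorRight hJK R (resObj hKH M) V = indTensorRight hJK R (resObj hKH M) V :=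
  (congrArg (fun x => (ind R).map x ≫ indTensorRight hJK R (resObj hKH M) V)
    (show _ = 𝟙 (tensObj V (resObj hJK (resObj hKH M))) from
      hom_ext _ _ (whiskerLeft_id V.obj M.obj))).trans
    ((congrArg (· ≫ _) ((ind R).map_id _)).trans (Category.id_comp _))

theorem isModuleHom_mackeyIncl {L K H : Subgroup G} (hL : L ≤ H) (hK : K ≤ H) (S : Finset G)
    (hS : IsDoubleCosetReps L K H S) (x : S) :
    letI := (T.mackeyData σ).topAction
    IsModuleHom ((lineator (conjTopLinear x.1 rfl)).comp ((lineator (resTopLinear inf_le_left)).comp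
        (lineator (indTopLinear inf_le_right (σ inf_le_right)))))
      ((lineator (indTopLinear hK (σ hK))).comp (lineator (resTopLinear hL)))
      (((T.mackeyIsos σ).mackey hL hK S hS).incl x) := by
  intro s m
  have h := mackeyIncl_conjTensor hL hK (σ hK) ⟨x, hS.mem x.2⟩ (σ inf_le_right) s m
  refine (congrArg (_ ≫ ·) (Category.comp_id _)).trans (h.trans (Eq.trans ?_
    (Category.assoc _ _ _).symm))
  exact congrArg (_ ≫ ·) (congrArg (· ≫ _) ((congrArg (· ≫ _)
    ((ind (σ inf_le_right)).map_id _)).trans (Category.id_comp _)).symm)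

/-- All the natural isomorphisms are isomorphisms of module functors over `C^G`. -/
@[reducible]
def topModule :
    letI := (T.mackeyData σ).topAction
    MackeyModule (T.Equivariant (⊤ : Subgroup G)) (T.mackeyIsos σ) :=
  letI := (T.mackeyData σ).topAction
  { ind := fun h => indTopLinear h (σ h)
    res := fun h => resTopLinear h
    conj := fun a _ _ h => conjTopLinear a h
    indId := fun H s m => (Category.comp_id _).trans
      (indTensorLeft_indId (σ le_rfl) (resObj le_top s) m)
    resId := fun H s m => hom_ext _ _ (by
      change 𝟙 (s.obj ⊗ m.obj) ≫ 𝟙 (s.obj ⊗ m.obj) = 𝟙 (s.obj ⊗ m.obj) ≫ s.obj ◁ 𝟙 m.obj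
      simp)
    conjId := fun a ha h s m => (Category.comp_id _).trans
      (hom_ext _ _ (conjTensor_conjId a ha h s m))
    resComp := fun _ _ s m => hom_ext _ _ (by
      change 𝟙 (s.obj ⊗ m.obj) ≫ 𝟙 (s.obj ⊗ m.obj) ≫ 𝟙 (s.obj ⊗ m.obj) =
        𝟙 (s.obj ⊗ m.obj) ≫ s.obj ◁ 𝟙 m.obj
      simp)
    indComp := fun hJK hKH s m =>
      indTensorLeft_indComp hJK hKH (σ _) (σ _) (σ _) (resObj le_top s) m
    conjComp := fun a b c e _ _ _ hb ha hc s m =>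
      hom_ext _ _ (conjTensor_conjComp e hb ha hc s m)
    conjInd := fun a _ _ _ _ h h' hK hH s m =>
      (conjTensor_conjInd a h h' hK hH (σ h) (σ h') s m).trans (Category.assoc _ _ _).symm
    conjRes := fun a _ _ _ _ h h' hK hH s m => hom_ext _ _ (by
      change 𝟙 ((T.fn a).obj (s.obj ⊗ m.obj)) ≫ (conjTensor a hH s m).hom ≫ 𝟙 _ =
        ((T.fn a).map (𝟙 _) ≫ (conjTensor a hK s (resObj h m)).hom) ≫
          s.obj ◁ 𝟙 ((T.fn a).obj m.obj)
      rw [conjTensor_hom, conjTensor_hom]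
      simp)
    mackey_proj := fun hL hK S hS x => DirectSumDecomposition.isModuleHom_proj _
      (fun s m m' => MonoidalPreadditive.whiskerLeft_zero)
      (fun x => isModuleHom_mackeyIncl T σ hL hK S hS x) x
    mackey_incl := fun hL hK S hS x => isModuleHom_mackeyIncl T σ hL hK S hS x }

end TopModule

section Green

attribute [local instance] Abelian.hasFiniteBiproducts

variable (k : Type w) [CommRing k] {G : Type t} [Group G] [Finite G] {C : Type u}
  [Category.{v} C] [Abelian C] [Linear k C] (T : GroupAction G C)
  [∀ g : G, (T.fn g).Linear k] (σ : ∀ {L H : Subgroup G}, L ≤ H → CosetReps L H)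
  [MonoidalCategory C] [MonoidalPreadditive C] [MonoidalLinear k C] [T.MonoidalAction]

/-- The categorical Green functor `H ↦ C^H`. -/
def greenFunctor :
    letI := (T.mackeyData σ).topAction
    CategoricalGreenFunctor k (T.Equivariant (⊤ : Subgroup G)) (T.mackeyData σ) :=
  letI := (T.mackeyData σ).topAction
  { abelian := fun _ => ⟨Equivariant.abelian, rfl⟩
    action_add_left := fun f g m =>
      MonoidalPreadditive.add_whiskerRight ((res (T := T) le_top).map f) ((res le_top).map g)
    action_smul_left := fun r f m =>
      MonoidalLinear.smul_whiskerRight r ((res (T := T) le_top).map f) m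
    action_add_right := fun _ _ _ _ _ => MonoidalPreadditive.whiskerLeft_add _ _
    action_smul_right := fun _ _ _ _ _ => MonoidalLinear.whiskerLeft_smul _ _ _
    ind_additive := fun _ => inferInstance
    res_additive := fun _ => inferInstance
    conj_additive := fun _ _ _ _ => inferInstance
    ind_linear := fun _ => inferInstance
    res_linear := fun _ => inferInstance
    conj_linear := fun _ _ _ _ => inferInstance
    isos := T.mackeyIsos σ
    modules := T.topModule σ
    indLeft := fun h => indLeftLinear h (σ h)
    indRight := fun h => indRightLinear h (σ h)
    resComp_monoidal := isMonoidal_resComp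
    conjComp_monoidal := fun _ _ _ => isMonoidal_conjComp
    indComp_left := fun hJK hKH m v =>
      (indTensorLeft_indComp hJK hKH (σ _) (σ _) (σ _) m v).symm.trans
        (congrArg (fun x => indCompHom hJK hKH (σ _) (σ _) (σ _)
            (tensObj (resObj (hJK.trans hKH) m) v) ≫ (ind (σ hKH)).map x ≫
              indTensorLeft hKH (σ hKH) m ((ind (σ hJK)).obj v))
          (map_resComp_indTensorLeft hJK hKH (σ hJK) m v).symm)
    indComp_right := fun hJK hKH m v =>
      (indTensorRight_indComp hJK hKH (σ _) (σ _) (σ _) m v).symm.trans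
        (congrArg (fun x => indCompHom hJK hKH (σ _) (σ _) (σ _)
            (tensObj v (resObj (hJK.trans hKH) m)) ≫ (ind (σ hKH)).map x ≫
              indTensorRight hKH (σ hKH) m ((ind (σ hJK)).obj v))
          (map_resComp_indTensorRight hJK hKH (σ hJK) m v).symm)
    top := T.topModule σ
    top_res := fun h m v => hom_ext _ _ (by
      change 𝟙 (m.obj ⊗ v.obj) = 𝟙 (m.obj ⊗ v.obj) ≫ 𝟙 m.obj ▷ v.obj
      simp)
    top_ind := fun h m v => (map_resComp_indTensorLeft h le_top (σ h) m v).symm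
    top_conj := fun _ _ _ _ _ _ _ => rfl }

end Green

end GroupAction

end

theorem theorem1p1 {k : Type w} [CommRing k] {G : Type t} [Group G] [Finite G]
    {C : Type u} [Category.{v} C] [Abelian C] [Linear k C]
    (T : GroupAction G C) [∀ g : G, (T.fn g).Linear k]
    (σ : ∀ {L H : Subgroup G}, L ≤ H → GroupAction.CosetReps L H) :
    ∃ (_ : ∀ H : Subgroup G, MonoidalLeftAction (Vec k) (T.Equivariant H))
      (F : CategoricalMackeyFunctor k (Vec k) (T.mackeyData σ)),
      GroupAction.IsCanonical F.isos ∧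
      ∀ [MonoidalCategory C] [MonoidalPreadditive C] [MonoidalLinear k C] [T.MonoidalAction],
        letI := (T.mackeyData σ).topAction
        ∃ F' : CategoricalGreenFunctor k (T.Equivariant (⊤ : Subgroup G)) (T.mackeyData σ),
          F'.isos = F.isos := by
  exact ⟨fun H => vecAction k _, T.mackeyFunctor k σ, T.isCanonical_mackeyIsos σ,
    ⟨T.greenFunctor k σ, rfl⟩⟩
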